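/- **Sequential hiring.** An instance consists of $n\ge 1$ applicants with values $v_i\ge 0$ and acceptance probabilities $p_i\in[0,1]$ ($i\in[n]$, real numbers), a number $k$ of positions and a number $T\ge 1$ of stages. Applicant $i$ accepts an offer with probability $p_i$, independently of the others. A *hiring policy* $\mathcal H$ maps each state $(t,k_t,\mathcal A_t)$ with $t\in[T]$, $k_t\in[k]$, $\emptyset\ne\mathcal A_t\subseteq[n]$ to an applicant $\mathcal H(t,k_t,\mathcal A_t)\in\mathcal A_t$. The process starts in $(1,k,[n])$. In state $(t,k_t,\mathcal A_t)$ the applicant $i=\mathcal H(t,k_t,\mathcal A_t)$ gets an offer; if she accepts, the reward $v_i$ is collected and the next state is $(t+1,k_t-1,\mathcal A_t\setminus\{i\})$, otherwise it is $(t+1,k_t,\mathcal A_t\setminus\{i\})$. The process stops when $t=T+1$, $k_t=0$ or $\mathcal A_t=\emptyset$. Let $\mathcal R(\mathcal H)$ be the expected total reward. **Theorem.** There are a single algorithm and absolute constants $C,a,b,d\in\mathbb N$ such that, for every real $\epsilon>0$ and every instance, the algorithm, given the instance and $\epsilon$, computes a hiring policy $\mathcal H$ with $$\mathcal R(\mathcal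 H)\ \ge\ (1-\epsilon)\cdot\mathcal R(\mathcal H')\qquad\text{for every hiring policy }\mathcal H'$$ in at most $$C\cdot n^{a}\cdot T^{\,b\,(1/\epsilon)^{d}\log T}$$ steps, that is, in time $O(n^{O(1)}\cdot T^{O_\epsilon(\log T)})$, where $O_\epsilon(f)$ stands for $O((1/\epsilon)^{O(1)}\cdot f)$. Here the algorithm is a program of a real random access machine (unit cost for the four arithmetic operations on and comparisons of real numbers, for addition, subtraction and comparison of natural numbers, for conversion of a natural number to a real one, and for indexed memory access; no rounding of reals), and the policy $\mathcal H$ is written out explicitly as a decision diagram: a binary decision tree with possibly shared subtrees, each node of which names the applicant to be offered next and the nodes to go to upon acceptance and upon rejection. -/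

import Mathlib

open Finset

noncomputable section

namespace SeqHiring

/-! ### The sequential hiring problem -/

/-- An instance of sequential hiring: `n` applicants (indexed by `Fin n`), `k` positions, `T` stages,
values `v i ≥ 0` and acceptance probabilities `p i ∈ [0, 1]`. -/
structure Instance where
  n : ℕ
  k : ℕ
  T : ℕ
  v : Fin n → ℝ
  p : Fin n → ℝ
  v_nonneg : ∀ i, 0 ≤ v i
  p_nonneg : ∀ i, 0 ≤ p i
  p_le_one : ∀ i, p i ≤ 1

/-- An adaptive hiring policy: in every state `(t, κ, A)` with `1 ≤ t ≤ T`, `1 ≤ κ ≤ k` and `A ≠ ∅`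
(stage, number of open positions, set of available applicants) it picks an applicant of `A`.
Its values at other arguments are never used. -/
structure Policy (I : Instance) where
  pick : ℕ → ℕ → Finset (Fin I.n) → Fin I.n
  pick_mem : ∀ t κ A, 1 ≤ t → t ≤ I.T → 1 ≤ κ → κ ≤ I.k → A.Nonempty → pick t κ A ∈ A

/-- The cumulative reward that the policy `H` collects when the decisions of the applicants are `x`
(`x i = true` iff applicant `i` accepts when offered), in the last `m` stages, that is, in the
stages `T + 1 - m, …, T`, starting with `κ` open positions and available set `A`. -/
def Policy.realizedReward {I : Instance} (H : Policy I) (x : Fin I.n → Bool) :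
    ℕ → ℕ → Finset (Fin I.n) → ℝ
  | 0, _, _ => 0
  | m + 1, κ, A =>
    if κ = 0 ∨ A = ∅ then 0
    else
      let i := H.pick (I.T - m) κ A
      if x i = true then I.v i + H.realizedReward x m (κ - 1) (A.erase i)
      else H.realizedReward x m κ (A.erase i)

/-- The probability of the decision vector `x`: the decisions of the applicants are independent and
applicant `i` accepts with probability `p i`. -/
def Instance.prob (I : Instance) (x : Fin I.n → Bool) : ℝ :=
  ∏ i, if x i = true then I.p i else 1 - I.p i

/-- The total expected reward of a policy, from stage `1` with all `k` positions open and all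
applicants available. -/
def Policy.expectedReward {I : Instance} (H : Policy I) : ℝ :=
  ∑ x : Fin I.n → Bool, I.prob x * H.realizedReward x I.T I.k Finset.univ

/-! ### Machine model: a real random access machine

The memory consists of arrays of natural numbers and arrays of real numbers; a program can name only
finitely many of them. Elementary operations have unit cost: array access with computed index,
addition and (truncated) subtraction of naturals, the four field operations on reals, conversion of
a natural number to a real number, and comparisons. There are no real constants, and there is no way
to round a real number to an integer. -/

/-- A memory content: `nat a j` and `real a j` are the entries `j` of the arrays with name `a`. -/
structure Mem where
  nat : ℕ → ℕ → ℕ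
  real : ℕ → ℕ → ℝ

/-- Expressions with natural number value. -/
inductive NExp where
  | const (c : ℕ)
  | get (a : ℕ) (j : NExp)
  | add (e f : NExp)
  | sub (e f : NExp)

/-- Expressions with real value. -/
inductive RExp where
  | ofNat (e : NExp)
  | get (a : ℕ) (j : NExp)
  | add (e f : RExp)
  | sub (e f : RExp)
  | mul (e f : RExp)
  | div (e f : RExp)

/-- Tests. -/
inductive Test where
  | leN (e f : NExp)
  | leR (e f : RExp)
  | neg (b : Test)

/-- Programs. `setN a j e` and `setR a j e` write the value of `e` into entry `j` of array `a`. -/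
inductive Prog where
  | skip
  | setN (a : ℕ) (j e : NExp)
  | setR (a : ℕ) (j : NExp) (e : RExp)
  | seq (P Q : Prog)
  | ite (b : Test) (P Q : Prog)
  | loop (b : Test) (P : Prog)

/-- The value of an expression. -/
def NExp.eval (s : Mem) : NExp → ℕ
  | const c => c
  | get a j => s.nat a (j.eval s)
  | add e f => e.eval s + f.eval s
  | sub e f => e.eval s - f.eval s

/-- The number of steps that the evaluation of an expression takes. -/
def NExp.cost : NExp → ℕ
  | const _ => 1
  | get _ j => j.cost + 1
  | add e f => e.cost + f.cost + 1
  | sub e f => e.cost + f.cost + 1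

/-- The value of an expression. -/
def RExp.eval (s : Mem) : RExp → ℝ
  | ofNat e => (e.eval s : ℝ)
  | get a j => s.real a (j.eval s)
  | add e f => e.eval s + f.eval s
  | sub e f => e.eval s - f.eval s
  | mul e f => e.eval s * f.eval s
  | div e f => e.eval s / f.eval s

/-- The number of steps that the evaluation of an expression takes. -/
def RExp.cost : RExp → ℕ
  | ofNat e => e.cost + 1
  | get _ j => j.cost + 1
  | add e f => e.cost + f.cost + 1
  | sub e f => e.cost + f.cost + 1
  | mul e f => e.cost + f.cost + 1
  | div e f => e.cost + f.cost + 1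

/-- The test succeeds. -/
def Test.holds (s : Mem) : Test → Prop
  | leN e f => e.eval s ≤ f.eval s
  | leR e f => e.eval s ≤ f.eval s
  | neg b => ¬ b.holds s

/-- The number of steps that a test takes. -/
def Test.cost : Test → ℕ
  | leN e f => e.cost + f.cost + 1
  | leR e f => e.cost + f.cost + 1
  | neg b => b.cost + 1

/-- Write the natural number `w` into entry `j` of the array `a`. -/
def Mem.putN (s : Mem) (a j w : ℕ) : Mem :=
  { s with nat := Function.update s.nat a (Function.update (s.nat a) j w) }

/-- Write the real number `w` into entry `j` of the array `a`. -/
def Mem.putR (s : Mem) (a j : ℕ) (w : ℝ) : Mem :=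
  { s with real := Function.update s.real a (Function.update (s.real a) j w) }

/-- `Exec P s c s'`: started in memory `s`, the program `P` halts after `c` steps in memory `s'`. -/
inductive Exec : Prog → Mem → ℕ → Mem → Prop where
  | skip (s : Mem) : Exec Prog.skip s 1 s
  | setN (s : Mem) (a : ℕ) (j e : NExp) :
      Exec (Prog.setN a j e) s (j.cost + e.cost + 1) (s.putN a (j.eval s) (e.eval s))
  | setR (s : Mem) (a : ℕ) (j : NExp) (e : RExp) :
      Exec (Prog.setR a j e) s (j.cost + e.cost + 1) (s.putR a (j.eval s) (e.eval s))
  | seq {P Q : Prog} {s s' s'' : Mem} {c d : ℕ} :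
      Exec P s c s' → Exec Q s' d s'' → Exec (Prog.seq P Q) s (c + d) s''
  | ite_pos {b : Test} {P Q : Prog} {s s' : Mem} {c : ℕ} :
      b.holds s → Exec P s c s' → Exec (Prog.ite b P Q) s (b.cost + c) s'
  | ite_neg {b : Test} {P Q : Prog} {s s' : Mem} {c : ℕ} :
      ¬ b.holds s → Exec Q s c s' → Exec (Prog.ite b P Q) s (b.cost + c) s'
  | loop_done {b : Test} {P : Prog} {s : Mem} :
      ¬ b.holds s → Exec (Prog.loop b P) s b.cost s
  | loop_step {b : Test} {P : Prog} {s s' s'' : Mem} {c d : ℕ} :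
      b.holds s → Exec P s c s' → Exec (Prog.loop b P) s' d s'' →
        Exec (Prog.loop b P) s (b.cost + c + d) s''

/-! ### Input and output -/

/-- The input memory for the instance `I` and the accuracy `ε`: the natural numbers `n`, `k`, `T`
are at entry `0` of the arrays `0`, `1`, `2`; the values and the acceptance probabilities are in the
real arrays `0` and `1`; `ε` is at entry `0` of the real array `2`; everything else is zero. -/
def Instance.input (I : Instance) (ε : ℝ) : Mem where
  nat a j :=
    if a = 0 ∧ j = 0 then I.n
    else if a = 1 ∧ j = 0 then I.k
    else if a = 2 ∧ j = 0 then I.T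
    else 0
  real a j :=
    if a = 0 then (if h : j < I.n then I.v ⟨j, h⟩ else 0)
    else if a = 1 then (if h : j < I.n then I.p ⟨j, h⟩ else 0)
    else if a = 2 ∧ j = 0 then ε
    else 0

/-- An explicit representation of a policy as a decision diagram, that is, a binary decision tree in
which equal subtrees may be shared: node `u` names the applicant `app u` who receives the next
offer; the node `onAccept u`, respectively `onReject u`, is used next if she accepts, respectively
rejects. -/
structure Diagram where
  root : ℕ
  app : ℕ → ℕ
  onAccept : ℕ → ℕ
  onReject : ℕ → ℕ

/-- The diagram that a program leaves in the memory: its root is at entry `0` of the array `3`, the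
labels and the two kinds of successors are in the arrays `4`, `5`, `6`. -/
def Mem.diagram (s : Mem) : Diagram where
  root := s.nat 3 0
  app := s.nat 4
  onAccept := s.nat 5
  onReject := s.nat 6

/-- In the last `m` stages, with `κ` open positions and available set `A`, the diagram makes, from
its node `u` on, exactly the offers that the policy `H` makes, whatever the applicants decide. -/
def Diagram.FollowsFrom (D : Diagram) {I : Instance} (H : Policy I) :
    ℕ → ℕ → ℕ → Finset (Fin I.n) → Prop
  | 0, _, _, _ => True
  | m + 1, u, κ, A =>
    κ = 0 ∨ A = ∅ ∨
      (D.app u = (H.pick (I.T - m) κ A : ℕ) ∧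
        D.FollowsFrom H m (D.onAccept u) (κ - 1) (A.erase (H.pick (I.T - m) κ A)) ∧
        D.FollowsFrom H m (D.onReject u) κ (A.erase (H.pick (I.T - m) κ A)))

/-- The diagram represents the policy `H`. -/
def Diagram.Represents (D : Diagram) {I : Instance} (H : Policy I) : Prop :=
  D.FollowsFrom H I.T D.root I.k Finset.univ

end SeqHiring

end

/-! The program is a dynamic program over *classes* of applicants.

Write `m` for the number of stages and `κ` for the number of positions, both capped (more stages
than applicants, or more positions than stages, are useless). Expected rewards and policies are
handled through the recursion over states (`Policy.value`, and `bestVal` for the optimum over all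
policies that, in every state, choose among certain admissible applicants).

An applicant belongs to a class (`classOf`) according to the levels of its expected reward `p v`
and of its value `v` on geometric scales of ratio `1 - 1 / q`, where `q` is about `16 / ε`. The
levels of `p v` go down from the maximum `M` of `p v`; as the optimal value is at least `M`, those
below `M / (m q)`, roughly, are negligible, so `O(q (q + log m))` levels suffice. The levels of
`v` go down from a threshold `X`, and there are only polynomially many (in `q`) of them: what is
above `X` is one level, and so is what is below the last one. Within a class, applicants of
smaller acceptance probability are preferred, and only the first `m` of them can matter. A
class-ordered policy always offers to the first remaining member of some class, so that its states
are given by one counter for each of the `D = O(q ^ 4 (q + log m))` classes, plus the numbers of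
stages and positions, which makes `(m + 1) ^ (D + 2)` states, numbered in base `m + 1`. The best
class-ordered policy is found by going through all states (`solve_ensures`), and the states are
the nodes of the diagram (`Solved.represents`).

That class-ordered policies are nearly optimal for a suitable `X` is `exists_guess`. The suitable
`X` is `G q` for a guess `G` of the optimal value up to a factor of two; the guesses `M 2 ^ g` are
tried one after the other. There are two regimes.

* Few positions, `κ < q ^ 4` (`mul_bestVal_le_classVal_of_few`). An applicant of value above `G q`
  accepts with such a small probability that it may be treated as a sure gain that takes no
  position: if `m` such applicants had a total probability that is not small, offering to them
  would earn more than `2 G`. Values far below `G` cannot add up to anything with so few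
  positions. The remaining applicants of a class are interchangeable after rounding
  (`bestVal_le_of_counts`, `mul_bestVal_le`), and a class-ordered policy simulates an optimal
  policy for the rounded instance (`mul_bestVal_le_heads`).
* Many positions, and so many stages (`mul_bestVal_le_classVal_of_many`). The probabilities with
  which an optimal policy makes its offers are a fractional selection of total size at most `m`
  and total acceptance probability at most `κ`. It is rounded to a set with slightly smaller
  bounds by a derandomised exponential-moment argument (`exists_rounding`); exchanges within the
  classes make the set closed under predecessors (`exists_down_closed`). Offering to its members
  in any class-respecting order is good enough, as the positions hardly ever run out
  (`sum_mul_le_bestVal_heads`).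

With a single stage, a single class suffices, and no more would fit into the time bound, whose
exponent `log T` vanishes. When `ε ≥ 1`, every policy will do.

Programs are verified with total-correctness triples that also bound the number of steps
(`Prog.Ensures`); a program leaves the arrays alone that it does not name as targets
(`Prog.Ensures.frame`). -/

namespace SeqHiring

/-! ### Expected rewards as a recursion over states -/

theorem Instance.sum_prob (I : Instance) : ∑ x : Fin I.n → Bool, I.prob x = 1 := by
  unfold Instance.prob
  rw [← Fintype.prod_sum (fun i (b : Bool) => if b = true then I.p i else 1 - I.p i)]
  simp

/-- The decision of applicant `i` is independent of any quantity `F` that does not depend on it. -/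
theorem Instance.sum_prob_ite (I : Instance) (i : Fin I.n) (F G : (Fin I.n → Bool) → ℝ)
    (hF : ∀ x b, F (Function.update x i b) = F x) (hG : ∀ x b, G (Function.update x i b) = G x) :
    ∑ x, I.prob x * (if x i = true then F x else G x) =
      I.p i * ∑ x, I.prob x * F x + (1 - I.p i) * ∑ x, I.prob x * G x := by
  have split : ∀ H : (Fin I.n → Bool) → ℝ, (∀ x b, H (Function.update x i b) = H x) →
      ∑ x, (if x i = true then I.prob x * H x else 0) = I.p i * ∑ x, I.prob x * H x := by
    intro H hH
    have hq : ∀ x, I.prob x = (if x i = true then I.p i else 1 - I.p i) *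
        ∏ j ∈ univ.erase i, (if x j = true then I.p j else 1 - I.p j) := by
      intro x
      exact (Finset.mul_prod_erase univ (fun j => if x j = true then I.p j else 1 - I.p j)
        (mem_univ i)).symm
    have hr : ∀ x b, (∏ j ∈ univ.erase i,
          (if Function.update x i b j = true then I.p j else 1 - I.p j)) =
        ∏ j ∈ univ.erase i, (if x j = true then I.p j else 1 - I.p j) := by
      intro x b
      refine Finset.prod_congr rfl fun j hj => ?_
      rw [Function.update_of_ne (Finset.ne_of_mem_erase hj)]
    have flip : ∑ x, (if x i = true then (1 - I.p i) * (I.prob x * H x) else 0) =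
        ∑ x, (if x i = true then 0 else I.p i * (I.prob x * H x)) := by
      refine Finset.sum_nbij' (fun x => Function.update x i (!x i))
        (fun x => Function.update x i (!x i)) (by simp) (by simp) (by simp) (by simp) ?_
      intro x _
      rw [hq x, hq (Function.update x i _), hr, hH]
      by_cases hx : x i = true <;> simp [hx]
      ring
    have hsum : ∑ x, (if x i = true then I.prob x * H x else 0) +
        ∑ x, (if x i = true then 0 else I.prob x * H x) = ∑ x, I.prob x * H x := by
      rw [← Finset.sum_add_distrib]
      exact Finset.sum_congr rfl fun x _ => by split_ifs <;> simp
    have e1 : ∑ x, (if x i = true then (1 - I.p i) * (I.prob x * H x) else 0) =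
        (1 - I.p i) * ∑ x, (if x i = true then I.prob x * H x else 0) := by
      rw [Finset.mul_sum]
      exact Finset.sum_congr rfl fun x _ => by split_ifs <;> simp
    have e2 : ∑ x, (if x i = true then 0 else I.p i * (I.prob x * H x)) =
        I.p i * ∑ x, (if x i = true then 0 else I.prob x * H x) := by
      rw [Finset.mul_sum]
      exact Finset.sum_congr rfl fun x _ => by split_ifs <;> simp
    rw [e1, e2] at flip
    rw [← hsum]
    linarith
  have h1 := split F hF
  have h2 := split G hG
  have h3 : ∑ x, I.prob x * (if x i = true then F x else G x) =
      ∑ x, (if x i = true then I.prob x * F x else 0) + (∑ x, I.prob x * G x -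
        ∑ x, (if x i = true then I.prob x * G x else 0)) := by
    rw [← Finset.sum_sub_distrib, ← Finset.sum_add_distrib]
    exact Finset.sum_congr rfl fun x _ => by split_ifs <;> simp
  rw [h3, h1, h2]
  ring

/-- The expected reward of a policy in the last `m` stages, from the state with `κ` open positions
and available set `A`. -/
noncomputable def Policy.value {I : Instance} (H : Policy I) : ℕ → ℕ → Finset (Fin I.n) → ℝ
  | 0, _, _ => 0
  | m + 1, κ, A =>
    if κ = 0 ∨ A = ∅ then 0
    else
      I.p (H.pick (I.T - m) κ A) *
          (I.v (H.pick (I.T - m) κ A) + H.value m (κ - 1) (A.erase (H.pick (I.T - m) κ A))) +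
        (1 - I.p (H.pick (I.T - m) κ A)) * H.value m κ (A.erase (H.pick (I.T - m) κ A))

theorem Policy.realizedReward_update {I : Instance} (H : Policy I) (x : Fin I.n → Bool)
    (i : Fin I.n) (b : Bool) : ∀ (m κ : ℕ) (A : Finset (Fin I.n)), m ≤ I.T → κ ≤ I.k → i ∉ A →
      H.realizedReward (Function.update x i b) m κ A = H.realizedReward x m κ A := by
  intro m
  induction m with
  | zero => intros; rfl
  | succ m ih =>
    intro κ A hm hκ hi
    simp only [Policy.realizedReward]
    split_ifs with h h1 h2 h2
    · rfl
    all_goals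
      push Not at h
      have hmem := H.pick_mem (I.T - m) κ A (by omega) (by omega) (by omega) hκ
        h.2
      have hne : H.pick (I.T - m) κ A ≠ i := fun e => hi (e ▸ hmem)
      have hi' : i ∉ A.erase (H.pick (I.T - m) κ A) := fun h => hi (Finset.mem_of_mem_erase h)
      rw [Function.update_of_ne hne] at h1
      first
        | exact absurd h1 h2
        | exact absurd h2 h1
        | rw [ih _ _ (by omega) (by omega) hi']

theorem Policy.sum_prob_realizedReward {I : Instance} (H : Policy I) :
    ∀ (m κ : ℕ) (A : Finset (Fin I.n)), m ≤ I.T → κ ≤ I.k →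
      ∑ x, I.prob x * H.realizedReward x m κ A = H.value m κ A := by
  intro m
  induction m with
  | zero => intros; simp [Policy.realizedReward, Policy.value]
  | succ m ih =>
    intro κ A hm hκ
    simp only [Policy.realizedReward, Policy.value]
    split_ifs with h
    · simp
    · have hi : H.pick (I.T - m) κ A ∉ A.erase (H.pick (I.T - m) κ A) := Finset.notMem_erase _ _
      rw [I.sum_prob_ite (H.pick (I.T - m) κ A)
        (fun x => I.v (H.pick (I.T - m) κ A) +
          H.realizedReward x m (κ - 1) (A.erase (H.pick (I.T - m) κ A)))
        (fun x => H.realizedReward x m κ (A.erase (H.pick (I.T - m) κ A)))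
        (fun x b => by
          show _ + _ = _ + _
          rw [H.realizedReward_update x _ b m _ _ (by omega) (by omega) hi])
        (fun x b => H.realizedReward_update x _ b m _ _ (by omega) (by omega) hi)]
      simp only [mul_add, Finset.sum_add_distrib]
      rw [ih _ _ (by omega) (by omega), ih _ _ (by omega) (by omega), ← Finset.sum_mul, I.sum_prob]
      ring

theorem Policy.expectedReward_eq_value {I : Instance} (H : Policy I) :
    H.expectedReward = H.value I.T I.k univ :=
  H.sum_prob_realizedReward _ _ _ le_rfl le_rfl

theorem Policy.value_nonneg {I : Instance} (H : Policy I) :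
    ∀ (m κ : ℕ) (A : Finset (Fin I.n)), 0 ≤ H.value m κ A := by
  intro m
  induction m with
  | zero => intros; simp [Policy.value]
  | succ m ih =>
    intro κ A
    simp only [Policy.value]
    split_ifs
    · exact le_rfl
    · have := I.p_nonneg (H.pick (I.T - m) κ A)
      have := I.p_le_one (H.pick (I.T - m) κ A)
      have := I.v_nonneg (H.pick (I.T - m) κ A)
      have := ih (κ - 1) (A.erase (H.pick (I.T - m) κ A))
      have := ih κ (A.erase (H.pick (I.T - m) κ A))
      have h1 : 0 ≤ 1 - I.p (H.pick (I.T - m) κ A) := by linarith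
      positivity

/-! ### Optimal values under restricted choices -/

section bestVal

variable {ι : Type*} [DecidableEq ι]

/-- The optimal value with `m` stages and `κ` positions left and available set `A`, when an offer to
`i` has expected immediate gain `gain i` and uses up a position with probability `acc i`, and only
the applicants in `adm A` may receive an offer in a state with available set `A`. The process stops
when there is none. Rounded instances are covered by taking `gain` and `acc` that do not come from
one and the same pair of a value and a probability. -/
noncomputable def bestVal (gain acc : ι → ℝ) (adm : Finset ι → Finset ι) : ℕ → ℕ → Finset ι → ℝ
  | 0, _, _ => 0
  | _ + 1, 0, _ => 0
  | m + 1, κ + 1, A =>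
    if h : (adm A).Nonempty then
      (adm A).sup' h fun i => gain i + acc i * bestVal gain acc adm m κ (A.erase i) +
        (1 - acc i) * bestVal gain acc adm m (κ + 1) (A.erase i)
    else 0

variable {gain acc : ι → ℝ} {adm : Finset ι → Finset ι}

@[simp] theorem bestVal_zero_stages (κ : ℕ) (A : Finset ι) : bestVal gain acc adm 0 κ A = 0 := by
  simp [bestVal]

@[simp] theorem bestVal_zero_positions (m : ℕ) (A : Finset ι) :
    bestVal gain acc adm m 0 A = 0 := by
  cases m <;> simp [bestVal]

theorem bestVal_of_empty {m κ : ℕ} {A : Finset ι} (h : adm A = ∅) :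
    bestVal gain acc adm m κ A = 0 := by
  cases m <;> cases κ <;> simp [bestVal, h]

theorem le_bestVal {m κ : ℕ} {A : Finset ι} {i : ι} (hi : i ∈ adm A) :
    gain i + acc i * bestVal gain acc adm m κ (A.erase i) +
        (1 - acc i) * bestVal gain acc adm m (κ + 1) (A.erase i) ≤
      bestVal gain acc adm (m + 1) (κ + 1) A := by
  rw [bestVal, dif_pos ⟨i, hi⟩]
  exact Finset.le_sup' (fun i => gain i + acc i * bestVal gain acc adm m κ (A.erase i) +
        (1 - acc i) * bestVal gain acc adm m (κ + 1) (A.erase i)) hi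

theorem exists_bestVal_eq {A : Finset ι} (h : (adm A).Nonempty) (m κ : ℕ) :
    ∃ i ∈ adm A, bestVal gain acc adm (m + 1) (κ + 1) A =
      gain i + acc i * bestVal gain acc adm m κ (A.erase i) +
        (1 - acc i) * bestVal gain acc adm m (κ + 1) (A.erase i) := by
  rw [bestVal, dif_pos h]
  exact Finset.exists_mem_eq_sup' h _

/-- To bound `bestVal` from above, bound every single step. -/
theorem bestVal_le {m κ : ℕ} {A : Finset ι} {b : ℝ} (h0 : 0 ≤ b)
    (h : ∀ i ∈ adm A, gain i + acc i * bestVal gain acc adm m κ (A.erase i) +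
        (1 - acc i) * bestVal gain acc adm m (κ + 1) (A.erase i) ≤ b) :
    bestVal gain acc adm (m + 1) (κ + 1) A ≤ b := by
  rcases (adm A).eq_empty_or_nonempty with he | hne
  · rwa [bestVal_of_empty he]
  · obtain ⟨i, hi, e⟩ := exists_bestVal_eq (gain := gain) (acc := acc) hne m κ
    rw [e]
    exact h i hi

section nonneg

variable (hg : ∀ i, 0 ≤ gain i) (ha : ∀ i, 0 ≤ acc i) (ha1 : ∀ i, acc i ≤ 1)
include hg ha ha1

theorem bestVal_nonneg : ∀ (m κ : ℕ) (A : Finset ι), 0 ≤ bestVal gain acc adm m κ A := by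
  intro m
  induction m with
  | zero => simp
  | succ m ih =>
    intro κ A
    cases κ with
    | zero => simp
    | succ κ =>
      rcases (adm A).eq_empty_or_nonempty with he | hne
      · rw [bestVal_of_empty he]
      · obtain ⟨i, -, e⟩ := exists_bestVal_eq (gain := gain) (acc := acc) hne m κ
        rw [e]
        have := hg i
        have := ha i
        have h1 : 0 ≤ 1 - acc i := by linarith [ha1 i]
        have := ih κ (A.erase i)
        have := ih (κ + 1) (A.erase i)
        positivity

theorem bestVal_le_succ_positions : ∀ (m κ : ℕ) (A : Finset ι),
    bestVal gain acc adm m κ A ≤ bestVal gain acc adm m (κ + 1) A := by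
  intro m
  induction m with
  | zero => simp
  | succ m ih =>
    intro κ A
    cases κ with
    | zero =>
      rw [bestVal_zero_positions]
      exact bestVal_nonneg hg ha ha1 _ _ _
    | succ κ =>
      refine bestVal_le (bestVal_nonneg hg ha ha1 _ _ _) fun i hi => ?_
      refine le_trans ?_ (le_bestVal hi)
      have h1 : 0 ≤ 1 - acc i := by linarith [ha1 i]
      gcongr
      · exact ha i
      · exact ih _ _
      · exact ih _ _

theorem bestVal_le_succ_stages : ∀ (m κ : ℕ) (A : Finset ι),
    bestVal gain acc adm m κ A ≤ bestVal gain acc adm (m + 1) κ A := by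
  intro m
  induction m with
  | zero =>
    intro κ A
    rw [bestVal_zero_stages]
    exact bestVal_nonneg hg ha ha1 _ _ _
  | succ m ih =>
    intro κ A
    cases κ with
    | zero => simp
    | succ κ =>
      refine bestVal_le (bestVal_nonneg hg ha ha1 _ _ _) fun i hi => ?_
      refine le_trans ?_ (le_bestVal hi)
      have h1 : 0 ≤ 1 - acc i := by linarith [ha1 i]
      gcongr
      · exact ha i
      · exact ih _ _
      · exact ih _ _

/-- With no restriction on the offers, more available applicants are better. -/
theorem bestVal_mono_set : ∀ (m κ : ℕ) (A B : Finset ι), A ⊆ B →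
    bestVal gain acc id m κ A ≤ bestVal gain acc id m κ B := by
  intro m
  induction m with
  | zero => simp
  | succ m ih =>
    intro κ A B hAB
    cases κ with
    | zero => simp
    | succ κ =>
      refine bestVal_le (bestVal_nonneg hg ha ha1 _ _ _) fun i hi => ?_
      refine le_trans ?_ (le_bestVal (i := i) (hAB hi))
      have h1 : 0 ≤ 1 - acc i := by linarith [ha1 i]
      have := Finset.erase_subset_erase i hAB
      gcongr
      · exact ha i
      · exact ih _ _ _ this
      · exact ih _ _ _ this

theorem bestVal_erase_le (m κ : ℕ) (A : Finset ι) (i : ι) :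
    bestVal gain acc id m κ (A.erase i) ≤ bestVal gain acc id (m + 1) κ A :=
  (bestVal_mono_set hg ha ha1 _ _ _ _ (Finset.erase_subset i A)).trans
    (bestVal_le_succ_stages hg ha ha1 _ _ _)

end nonneg

/-- Positions in excess of the number of stages are useless. -/
theorem bestVal_min_positions : ∀ (m κ : ℕ) (A : Finset ι),
    bestVal gain acc adm m κ A = bestVal gain acc adm m (min κ m) A := by
  intro m
  induction m with
  | zero => simp
  | succ m ih =>
    intro κ A
    cases κ with
    | zero => simp
    | succ κ =>
      rw [Nat.add_min_add_right]
      rw [bestVal, bestVal]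
      have h : ∀ B, bestVal gain acc adm m (κ + 1) B = bestVal gain acc adm m (min κ m + 1) B := by
        intro B
        rw [ih (κ + 1), ih (min κ m + 1)]
        congr 1
        omega
      simp only [h, ih κ]

/-- Stages in excess of the number of available applicants are useless. -/
theorem bestVal_min_stages (hadm : ∀ A, adm A ⊆ A) : ∀ (m κ : ℕ) (A : Finset ι),
    bestVal gain acc adm m κ A = bestVal gain acc adm (min m A.card) κ A := by
  intro m
  induction m with
  | zero => simp
  | succ m ih =>
    intro κ A
    rcases (adm A).eq_empty_or_nonempty with he | hne
    · rw [bestVal_of_empty he, bestVal_of_empty he]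
    cases κ with
    | zero => simp
    | succ κ =>
      obtain ⟨i, hi⟩ := hne
      have hc : 0 < A.card := Finset.card_pos.2 ⟨i, hadm A hi⟩
      obtain ⟨a, hca⟩ := Nat.exists_eq_add_of_lt hc
      have hc' : A.card = a + 1 := by omega
      rw [hc', Nat.add_min_add_right, bestVal, bestVal, dif_pos ⟨i, hi⟩, dif_pos ⟨i, hi⟩]
      refine Finset.sup'_congr _ rfl fun j hj => ?_
      have : (A.erase j).card = a := by rw [Finset.card_erase_of_mem (hadm A hj), hc']; rfl
      rw [ih κ, ih (κ + 1), this]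

end bestVal

/-- No policy is better than the optimal value of the unrestricted recursion. -/
theorem Policy.value_le_bestVal {I : Instance} (H : Policy I) :
    ∀ (m κ : ℕ) (A : Finset (Fin I.n)), m ≤ I.T → κ ≤ I.k →
      H.value m κ A ≤ bestVal (fun i => I.p i * I.v i) I.p id m κ A := by
  intro m
  induction m with
  | zero => intros; simp [Policy.value]
  | succ m ih =>
    intro κ A hm hκ
    simp only [Policy.value]
    split_ifs with h
    · exact bestVal_nonneg (fun i => mul_nonneg (I.p_nonneg i) (I.v_nonneg i)) I.p_nonneg I.p_le_one
        _ _ _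
    · push Not at h
      obtain ⟨κ, rfl⟩ := Nat.exists_eq_succ_of_ne_zero h.1
      have hmem := H.pick_mem (I.T - m) (κ + 1) A (by omega) (by omega) (by omega) hκ
        h.2
      refine le_trans ?_ (le_bestVal (i := H.pick (I.T - m) (κ + 1) A) hmem)
      have h1 : 0 ≤ 1 - I.p (H.pick (I.T - m) (κ + 1) A) := by linarith [I.p_le_one (H.pick (I.T - m) (κ + 1) A)]
      have h2 := I.p_nonneg (H.pick (I.T - m) (κ + 1) A)
      rw [mul_add]
      gcongr
      · exact ih _ _ (by omega) (by omega)
      · exact ih _ _ (by omega) (by omega)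

/-! ### Class-ordered offers -/

section heads

variable {ι : Type*} [DecidableEq ι]

open Classical in
/-- The applicants of `A` that are `kept` and come first, in the order given by `rank`, among the
applicants of `A` of their class. -/
noncomputable def heads (kept : ι → Prop) (cls rank : ι → ℕ) (A : Finset ι) : Finset ι :=
  A.filter fun i => kept i ∧ ∀ j ∈ A, cls j = cls i → rank i ≤ rank j

variable {kept : ι → Prop} {cls rank : ι → ℕ}

omit [DecidableEq ι] in
theorem mem_heads {A : Finset ι} {i : ι} : i ∈ heads kept cls rank A ↔
    i ∈ A ∧ kept i ∧ ∀ j ∈ A, cls j = cls i → rank i ≤ rank j := by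
  simp [heads]

omit [DecidableEq ι] in
theorem heads_subset (A : Finset ι) : heads kept cls rank A ⊆ A := by
  intro i hi
  exact (mem_heads.1 hi).1

/-- If `gain` and `acc` depend only on the class, then the optimal value depends only on the numbers
of available applicants of each class, capped at the number of stages. -/
theorem bestVal_le_of_counts {gain acc : ι → ℝ} (hg : ∀ i, 0 ≤ gain i) (ha : ∀ i, 0 ≤ acc i)
    (ha1 : ∀ i, acc i ≤ 1) (hgc : ∀ i j, cls i = cls j → gain i = gain j)
    (hac : ∀ i j, cls i = cls j → acc i = acc j) : ∀ (m κ : ℕ) (A B : Finset ι),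
      (∀ c, min m (A.filter (cls · = c)).card ≤ (B.filter (cls · = c)).card) →
      bestVal gain acc id m κ A ≤ bestVal gain acc id m κ B := by
  intro m
  induction m with
  | zero => simp
  | succ m ih =>
    intro κ A B h
    cases κ with
    | zero => simp
    | succ κ =>
      refine bestVal_le (bestVal_nonneg hg ha ha1 _ _ _) fun i hi => ?_
      have hiA : i ∈ A.filter (cls · = cls i) := by simpa using hi
      have hpos : 0 < (B.filter (cls · = cls i)).card := by
        have := h (cls i)
        have := Finset.card_pos.2 ⟨i, hiA⟩
        omega
      obtain ⟨j, hj⟩ := Finset.card_pos.1 hpos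
      have hjB : j ∈ B ∧ cls j = cls i := by simpa using hj
      refine le_trans ?_ (le_bestVal (i := j) hjB.1)
      rw [hgc j i hjB.2, hac j i hjB.2]
      have hcount : ∀ c, min m ((A.erase i).filter (cls · = c)).card ≤
          ((B.erase j).filter (cls · = c)).card := by
        intro c
        have hc := h c
        rw [Finset.filter_erase, Finset.filter_erase, Finset.card_erase_eq_ite,
          Finset.card_erase_eq_ite]
        by_cases hcc : cls i = c
        · subst hcc
          rw [if_pos hiA, if_pos hj]
          omega
        · rw [if_neg (by simp [hcc]), if_neg (by simp [hjB.2, hcc])]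
          omega
      have h1 : 0 ≤ 1 - acc i := by linarith [ha1 i]
      gcongr
      · exact ha i
      · exact ih _ _ _ hcount
      · exact ih _ _ _ hcount

/-- Rounding loses little: every `kept` applicant has a rounded gain of at least the fraction `c` of
its expected reward and a rounded acceptance probability that is not larger, and the others are
negligible, because of their small expected reward or because of their small value. -/
theorem mul_bestVal_le {p v gain acc : ι → ℝ} {c η ξ : ℝ} {good : ι → Prop}
    (hp : ∀ i, 0 ≤ p i) (hp1 : ∀ i, p i ≤ 1) (hv : ∀ i, 0 ≤ v i)
    (hg : ∀ i, 0 ≤ gain i) (ha : ∀ i, 0 ≤ acc i) (hap : ∀ i, acc i ≤ p i)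
    (hc1 : c ≤ 1) (hη : 0 ≤ η) (hξ : 0 ≤ ξ) [DecidablePred good]
    (hgood : ∀ i, good i → c * (p i * v i) ≤ gain i)
    (hbad : ∀ i, ¬ good i → p i * v i ≤ η ∨ v i ≤ ξ) : ∀ (m κ : ℕ) (A : Finset ι),
      c * bestVal (fun i => p i * v i) p id m κ A ≤
        bestVal gain acc id m κ (A.filter good) + m * η + κ * ξ := by
  have ha1 : ∀ i, acc i ≤ 1 := fun i => (hap i).trans (hp1 i)
  intro m
  induction m with
  | zero =>
    intro κ A
    rw [bestVal_zero_stages, bestVal_zero_stages, mul_zero, zero_add]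
    positivity
  | succ m ih =>
    intro κ A
    cases κ with
    | zero =>
      rw [bestVal_zero_positions, bestVal_zero_positions, mul_zero, zero_add]
      positivity
    | succ κ =>
      rcases (id A).eq_empty_or_nonempty with he | hne
      · rw [bestVal_of_empty he]
        have := bestVal_nonneg (adm := id) hg ha ha1 (m + 1) (κ + 1) (A.filter good)
        rw [mul_zero]
        positivity
      obtain ⟨i, hi, e⟩ := exists_bestVal_eq (gain := fun i => p i * v i) (acc := p) hne m κ
      rw [e]
      set U0 := bestVal gain acc id m (κ + 1) ((A.erase i).filter good) with hU0
      set U1 := bestVal gain acc id m κ ((A.erase i).filter good) with hU1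
      have h01 : U1 ≤ U0 := bestVal_le_succ_positions hg ha ha1 _ _ _
      have i1 := ih κ (A.erase i)
      have i0 := ih (κ + 1) (A.erase i)
      have hpi := hp i
      have hqi : 0 ≤ 1 - p i := by linarith [hp1 i]
      push_cast at i0 ⊢
      have key : c * (p i * v i + p i * bestVal (fun i => p i * v i) p id m κ (A.erase i) +
          (1 - p i) * bestVal (fun i => p i * v i) p id m (κ + 1) (A.erase i)) ≤
          c * (p i * v i) + p i * (U1 + m * η + κ * ξ) +
            (1 - p i) * (U0 + m * η + (κ + 1) * ξ) := by
        have a1 := mul_le_mul_of_nonneg_left i1 hpi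
        have a0 := mul_le_mul_of_nonneg_left i0 hqi
        linarith
      refine key.trans ?_
      have hpU : p i * U1 ≤ p i * U0 := mul_le_mul_of_nonneg_left h01 hpi
      have hpξ : 0 ≤ p i * ξ := mul_nonneg hpi hξ
      by_cases hgi : good i
      · have hmem : i ∈ id (A.filter good) := by simpa using ⟨hi, hgi⟩
        have hstep := le_bestVal (gain := gain) (acc := acc) (m := m) (κ := κ) hmem
        rw [show (A.filter good).erase i = (A.erase i).filter good from
          (Finset.filter_erase ..).symm] at hstep
        rw [← hU0, ← hU1] at hstep
        have hacc := mul_le_mul_of_nonneg_right (hap i) (sub_nonneg.2 h01)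
        have := hgood i hgi
        linarith
      · have hstep : U0 ≤ bestVal gain acc id (m + 1) (κ + 1) (A.filter good) := by
          rw [hU0, Finset.filter_erase]
          exact bestVal_erase_le hg ha ha1 _ _ _ _
        have hw : 0 ≤ p i * v i := mul_nonneg hpi (hv i)
        have hcw : c * (p i * v i) ≤ p i * v i := by nlinarith
        rcases hbad i hgi with hb | hb
        · linarith
        · have : p i * v i ≤ p i * ξ := mul_le_mul_of_nonneg_left hb hpi
          linarith

/-- Conversely, an optimal class-ordered policy for the true instance does nearly as well as an
optimal policy for the rounded one. There, the `high` applicants are sure gains that take no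
position; in the true instance, the chance that one of them takes a position is at most `h`. -/
theorem mul_bestVal_le_heads {p v gain acc : ι → ℝ} {good high : ι → Prop} [DecidablePred good]
    (hp : ∀ i, 0 ≤ p i) (hp1 : ∀ i, p i ≤ 1) (hv : ∀ i, 0 ≤ v i)
    (hg : ∀ i, 0 ≤ gain i) (ha : ∀ i, 0 ≤ acc i) (hap : ∀ i, acc i ≤ p i)
    (hgc : ∀ i j, cls i = cls j → gain i = gain j)
    (hac : ∀ i j, cls i = cls j → acc i = acc j)
    (hgk : ∀ i, good i → kept i)
    (hdown : ∀ i j, cls i = cls j → rank i ≤ rank j → good j → good i)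
    (hhigh : ∀ i, good i → high i → acc i = 0 ∧ gain i ≤ p i * v i)
    (hmid : ∀ i, good i → ¬ high i → 0 < acc i ∧ ∃ v', v' ≤ v i ∧ gain i = acc i * v') :
    ∀ (m κ : ℕ) (A : Finset ι) (h : ℝ), h ≤ 1 →
      (∀ S ⊆ A, (∀ i ∈ S, good i ∧ high i) → S.card ≤ m → ∑ i ∈ S, p i ≤ h) →
      (1 - h) * bestVal gain acc id m κ (A.filter good) ≤
        bestVal (fun i => p i * v i) p (heads kept cls rank) m κ A := by
  have ha1 : ∀ i, acc i ≤ 1 := fun i => (hap i).trans (hp1 i)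
  have hw : ∀ i, 0 ≤ p i * v i := fun i => mul_nonneg (hp i) (hv i)
  intro m
  induction m with
  | zero => simp
  | succ m ih =>
    intro κ A h h1 hS
    cases κ with
    | zero => simp
    | succ κ =>
      rcases (id (A.filter good)).eq_empty_or_nonempty with he | hne
      · rw [bestVal_of_empty he, mul_zero]
        exact bestVal_nonneg hw hp hp1 _ _ _
      obtain ⟨i₀, hi₀, e₀⟩ := exists_bestVal_eq (gain := gain) (acc := acc) hne m κ
      have hi₀' : i₀ ∈ A ∧ good i₀ := by simpa using hi₀
      -- The head of the class of the optimal choice is an optimal choice too.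
      obtain ⟨i, hi, hmin⟩ := Finset.exists_min_image (A.filter (cls · = cls i₀)) rank
        ⟨i₀, by simpa using hi₀'.1⟩
      have hi' : i ∈ A ∧ cls i = cls i₀ := by simpa using hi
      have hgi : good i := hdown i i₀ hi'.2 (hmin i₀ (by simpa using hi₀'.1)) hi₀'.2
      have hhead : i ∈ heads kept cls rank A := by
        refine mem_heads.2 ⟨hi'.1, hgk i hgi, fun j hj hc => hmin j ?_⟩
        simp [hj, hc, hi'.2]
      have hiF : i ∈ A.filter good := by simpa using ⟨hi'.1, hgi⟩
      have hcounts : ∀ c, (((A.filter good).erase i₀).filter (cls · = c)).card =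
          (((A.filter good).erase i).filter (cls · = c)).card := by
        intro c
        rw [Finset.filter_erase, Finset.filter_erase, Finset.card_erase_eq_ite,
          Finset.card_erase_eq_ite]
        by_cases hcc : cls i₀ = c
        · rw [if_pos (by simp [hcc, hi₀']), if_pos (by simp [hi'.2, hcc, hi', hgi])]
        · rw [if_neg (by simp [hcc]), if_neg (by simp [hi'.2, hcc])]
      have hswap : ∀ κ', bestVal gain acc id m κ' ((A.filter good).erase i₀) =
          bestVal gain acc id m κ' ((A.erase i).filter good) := by
        intro κ'
        rw [Finset.filter_erase]
        refine le_antisymm (bestVal_le_of_counts (cls := cls) hg ha ha1 hgc hac _ _ _ _ fun c => ?_)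
          (bestVal_le_of_counts (cls := cls) hg ha ha1 hgc hac _ _ _ _ fun c => ?_)
        · rw [hcounts]; exact min_le_right _ _
        · rw [hcounts]; exact min_le_right _ _
      have hfirst : bestVal gain acc id m (κ + 1) ((A.erase i).filter good) ≤
          bestVal gain acc id (m + 1) (κ + 1) (A.filter good) := by
        rw [Finset.filter_erase]
        exact bestVal_erase_le hg ha ha1 _ _ _ _
      rw [e₀, hswap, hswap, hgc i₀ i hi'.2.symm, hac i₀ i hi'.2.symm] at hfirst ⊢
      refine le_trans ?_ (le_bestVal hhead)
      set U0 := bestVal gain acc id m (κ + 1) ((A.erase i).filter good)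
      set U1 := bestVal gain acc id m κ ((A.erase i).filter good)
      have hU0 : 0 ≤ U0 := bestVal_nonneg hg ha ha1 _ _ _
      have hU1 : 0 ≤ U1 := bestVal_nonneg hg ha ha1 _ _ _
      have hU01 : U1 ≤ U0 := bestVal_le_succ_positions hg ha ha1 _ _ _
      have hpi := hp i
      have hqi : 0 ≤ 1 - p i := by linarith [hp1 i]
      by_cases hh : high i
      · obtain ⟨hacc, hgain⟩ := hhigh i hgi hh
        have hS' : ∀ S ⊆ A.erase i, (∀ i ∈ S, good i ∧ high i) → S.card ≤ m →
            ∑ i ∈ S, p i ≤ h - p i := by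
          intro S hSA hSg hSc
          have hiS : i ∉ S := fun hx => Finset.notMem_erase i A (hSA hx)
          have := hS (insert i S) (Finset.insert_subset hi'.1 (hSA.trans (Finset.erase_subset _ _)))
            (by simpa using ⟨⟨hgi, hh⟩, hSg⟩) (by rw [Finset.card_insert_of_notMem hiS]; omega)
          rw [Finset.sum_insert hiS] at this
          linarith
        have i0 := ih (κ + 1) (A.erase i) (h - p i) (by linarith) hS'
        have hW1 : 0 ≤ bestVal (fun i => p i * v i) p (heads kept cls rank) m κ (A.erase i) :=
          bestVal_nonneg hw hp hp1 _ _ _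
        have hh0 : p i ≤ h := by
          have := hS' ∅ (by simp) (by simp) (by simp)
          simp only [Finset.sum_empty] at this
          linarith
        rw [hacc]
        have a0 := mul_le_mul_of_nonneg_left i0 hqi
        have a1 := mul_nonneg hpi hW1
        have a2 : (1 - h) * gain i ≤ p i * v i := by nlinarith [hg i]
        have a3 : (1 - h) * U0 ≤ (1 - p i) * ((1 - (h - p i)) * U0) := by
          have : 0 ≤ p i * (h - p i) * U0 := by
            have := sub_nonneg.2 hh0
            positivity
          nlinarith
        linarith
      · obtain ⟨hacc, v', hv', hgain⟩ := hmid i hgi hh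
        have hS' : ∀ S ⊆ A.erase i, (∀ i ∈ S, good i ∧ high i) → S.card ≤ m →
            ∑ i ∈ S, p i ≤ h := fun S hSA hSg hSc =>
          hS S (hSA.trans (Finset.erase_subset _ _)) hSg (by omega)
        have i0 := ih (κ + 1) (A.erase i) h h1 hS'
        have i1 := ih κ (A.erase i) h h1 hS'
        have hh0 : 0 ≤ h := by simpa using hS' ∅ (by simp) (by simp) (by simp)
        have a0 := mul_le_mul_of_nonneg_left i0 hqi
        have a1 := mul_le_mul_of_nonneg_left i1 hpi
        -- As `i` is an optimal choice, an acceptance is worth at least as much as a rejection.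
        have hge : 0 ≤ v' + U1 - U0 := by
          rw [hgain] at hfirst
          have : 0 ≤ acc i * (v' + U1 - U0) := by linarith
          exact nonneg_of_mul_nonneg_right this hacc
        have a2 : gain i + acc i * U1 + (1 - acc i) * U0 ≤
            p i * v i + p i * U1 + (1 - p i) * U0 := by
          have b1 := mul_le_mul_of_nonneg_right (hap i) hge
          have b2 := mul_le_mul_of_nonneg_left hv' hpi
          rw [hgain]
          linarith
        have a3 := mul_le_mul_of_nonneg_left a2 (sub_nonneg.2 h1)
        have a4 : (1 - h) * (p i * v i) ≤ p i * v i := by nlinarith [hw i]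
        linarith

end heads

section bounds

variable {ι : Type*} [DecidableEq ι] {p v : ι → ℝ}

/-- Offering to applicants of value at least `X` until one accepts. -/
theorem mul_div_le_bestVal (hp : ∀ i, 0 ≤ p i) (hp1 : ∀ i, p i ≤ 1) (hv : ∀ i, 0 ≤ v i) {X : ℝ}
    (hX : 0 ≤ X) : ∀ (m κ : ℕ) (A S : Finset ι), S ⊆ A → S.card ≤ m → 1 ≤ κ → (∀ i ∈ S, X ≤ v i) →
      X * ((∑ i ∈ S, p i) / (1 + ∑ i ∈ S, p i)) ≤
        bestVal (fun i => p i * v i) p id m κ A := by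
  have hw : ∀ i, 0 ≤ p i * v i := fun i => mul_nonneg (hp i) (hv i)
  intro m
  induction m with
  | zero =>
    intro κ A S _ hc _ _
    have : S = ∅ := by simpa using hc
    simp [this]
  | succ m ih =>
    intro κ A S hSA hc hκ hS
    obtain ⟨κ, rfl⟩ := Nat.exists_eq_add_of_le' hκ
    rcases S.eq_empty_or_nonempty with rfl | ⟨i, hi⟩
    · simpa using bestVal_nonneg hw hp hp1 _ _ _
    refine le_trans ?_ (le_bestVal (i := i) (hSA hi))
    have hcard : (S.erase i).card ≤ m := by
      rw [Finset.card_erase_of_mem hi]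
      omega
    have h0 := ih (κ + 1) (A.erase i) (S.erase i) (Finset.erase_subset_erase i hSA) hcard hκ
      fun j hj => hS j (Finset.mem_of_mem_erase hj)
    have hsum : ∑ j ∈ S, p j = p i + ∑ j ∈ S.erase i, p j := (Finset.add_sum_erase S p hi).symm
    have hs : 0 ≤ ∑ j ∈ S.erase i, p j := Finset.sum_nonneg fun j _ => hp j
    rw [hsum]
    set s := ∑ j ∈ S.erase i, p j
    have hpi := hp i
    have hqi : 0 ≤ 1 - p i := by linarith [hp1 i]
    have hW1 : 0 ≤ bestVal (fun i => p i * v i) p id m κ (A.erase i) := bestVal_nonneg hw hp hp1 _ _ _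
    have a0 := mul_le_mul_of_nonneg_left h0 hqi
    have a1 := mul_le_mul_of_nonneg_left (hS i hi) hpi
    have a2 : X * ((p i + s) / (1 + (p i + s))) ≤ p i * X + (1 - p i) * (X * (s / (1 + s))) := by
      have : p i * X + (1 - p i) * (X * (s / (1 + s))) = X * ((p i + s) / (1 + s)) := by
        field_simp
        ring
      rw [this]
      gcongr
      linarith
    have a3 := mul_nonneg hpi hW1
    linarith

/-- The probabilities `x i` with which an optimal policy makes an offer to `i`. -/
theorem exists_offer_probabilities (hp : ∀ i, 0 ≤ p i) (hp1 : ∀ i, p i ≤ 1) :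
    ∀ (m κ : ℕ) (A : Finset ι), ∃ x : ι → ℝ, (∀ i, 0 ≤ x i) ∧ (∀ i, x i ≤ 1) ∧
      (∑ i ∈ A, x i ≤ m) ∧ (∑ i ∈ A, p i * x i ≤ κ) ∧
      bestVal (fun i => p i * v i) p id m κ A ≤ ∑ i ∈ A, p i * v i * x i := by
  intro m
  induction m with
  | zero => exact fun κ A => ⟨0, by simp⟩
  | succ m ih =>
    intro κ A
    cases κ with
    | zero =>
      refine ⟨0, by simp, by simp, ?_, by simp, by simp⟩
      simp only [Pi.zero_apply, Finset.sum_const_zero]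
      positivity
    | succ κ =>
      rcases (id A).eq_empty_or_nonempty with he | hne
      · refine ⟨0, by simp, by simp, ?_, ?_, ?_⟩
        · simp only [Pi.zero_apply, Finset.sum_const_zero]
          positivity
        · simp only [Pi.zero_apply, mul_zero, Finset.sum_const_zero]
          positivity
        · rw [bestVal_of_empty he]
          simp
      obtain ⟨i, hi, e⟩ := exists_bestVal_eq (gain := fun i => p i * v i) (acc := p) hne m κ
      obtain ⟨x, hx0, hx1, hxm, hxκ, hxw⟩ := ih κ (A.erase i)
      obtain ⟨y, hy0, hy1, hym, hyκ, hyw⟩ := ih (κ + 1) (A.erase i)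
      have hpi := hp i
      have hqi : 0 ≤ 1 - p i := by linarith [hp1 i]
      have hsum : ∀ f : ι → ℝ, ∑ j ∈ A, f j * (if j = i then 1 else p i * x j + (1 - p i) * y j) =
          f i + (p i * ∑ j ∈ A.erase i, f j * x j + (1 - p i) * ∑ j ∈ A.erase i, f j * y j) := by
        intro f
        rw [← Finset.add_sum_erase A _ hi, if_pos rfl, mul_one, Finset.mul_sum, Finset.mul_sum,
          ← Finset.sum_add_distrib]
        congr 1
        refine Finset.sum_congr rfl fun j hj => ?_
        rw [if_neg (Finset.ne_of_mem_erase hj)]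
        ring
      refine ⟨fun j => if j = i then 1 else p i * x j + (1 - p i) * y j, fun j => ?_, fun j => ?_,
        ?_, ?_, ?_⟩
      · dsimp only
        have := hx0 j
        have := hy0 j
        split_ifs <;> positivity
      · dsimp only
        split_ifs
        · exact le_rfl
        · nlinarith [hx1 j, hy1 j]
      · have := hsum fun _ => 1
        simp only [one_mul] at this
        rw [this]
        push_cast
        nlinarith
      · rw [hsum p]
        push_cast at hyκ ⊢
        nlinarith
      · rw [e, hsum]
        have a1 := mul_le_mul_of_nonneg_left hxw hpi
        have a0 := mul_le_mul_of_nonneg_left hyw hqi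
        linarith

end bounds

/-! ### Many positions: from fractional to class-ordered offers -/

section rounding

variable {ι : Type*} [DecidableEq ι]

theorem exp_mul_le_one_add {θ a : ℝ} (ha : 0 ≤ a) (ha1 : a ≤ 1) :
    Real.exp (θ * a) ≤ 1 + a * (Real.exp θ - 1) := by
  have h := convexOn_exp.2 (Set.mem_univ 0) (Set.mem_univ θ) (sub_nonneg.2 ha1) ha
    (by ring)
  simp only [smul_eq_mul, mul_zero, zero_add, Real.exp_zero, mul_one] at h
  rw [mul_comm θ a]
  linarith

/-- The averaging step of the rounding of a fractional selection: the expected value of the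
penalised objective after the inclusion of `i` with probability `y`. -/
theorem averaging_step {θ a y w f F E : ℝ} (hθ : 0 ≤ θ) (ha : 0 ≤ a) (ha1 : a ≤ 1) (hy : 0 ≤ y)
    (hw : 0 ≤ w) (hf : 0 ≤ f) (hF : 0 ≤ F) (hE : 0 ≤ E) :
    y * ((f + w + Real.exp θ * F) * (Real.exp (θ * a) * E)) +
        (1 - y) * ((f + Real.exp θ * F) * E) ≤
      (f + Real.exp θ * (w * y + F)) * (Real.exp ((Real.exp θ - 1) * (a * y)) * E) := by
  set e := Real.exp θ with he
  set ea := Real.exp (θ * a) with hea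
  have he1 : 1 ≤ e := Real.one_le_exp hθ
  have h1 : ea ≤ 1 + a * (e - 1) := exp_mul_le_one_add ha ha1
  have h2 : (e - 1) * (a * y) + 1 ≤ Real.exp ((e - 1) * (a * y)) := Real.add_one_le_exp _
  have h3 : ea ≤ e := by nlinarith
  have hone : 1 ≤ Real.exp ((e - 1) * (a * y)) :=
    Real.one_le_exp (mul_nonneg (by linarith) (mul_nonneg ha hy))
  set G := Real.exp ((e - 1) * (a * y)) with hG
  have hfF : 0 ≤ f + e * F := by positivity
  have b1 : (f + e * F) * (1 + y * (ea - 1)) ≤ (f + e * F) * G := by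
    refine mul_le_mul_of_nonneg_left ?_ hfF
    nlinarith
  have b2 : y * w * ea ≤ e * (w * y) * G := by
    have hyw : 0 ≤ y * w := mul_nonneg hy hw
    calc y * w * ea ≤ y * w * e := mul_le_mul_of_nonneg_left h3 hyw
      _ = e * (w * y) * 1 := by ring
      _ ≤ e * (w * y) * G := by
        refine mul_le_mul_of_nonneg_left hone ?_
        have : 0 ≤ w * y := mul_nonneg hw hy
        positivity
  have b3 : (f + e * F) * (1 + y * (ea - 1)) + y * w * ea ≤ (f + e * (w * y + F)) * G := by
    linarith
  have b4 := mul_le_mul_of_nonneg_right b3 hE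
  linarith

/-- Derandomised rounding of a fractional selection `y`: some set `S` does at least as well, for the
objective `∑ w` penalised by exponential weights of its size and of its total probability, as a
random set that contains each `i` independently with probability `y i`. -/
theorem exists_rounding {θ : ℝ} (hθ : 0 ≤ θ) {p w y : ι → ℝ} (hp : ∀ i, 0 ≤ p i)
    (hp1 : ∀ i, p i ≤ 1) (hw : ∀ i, 0 ≤ w i) (hy : ∀ i, 0 ≤ y i) (hy1 : ∀ i, y i ≤ 1)
    (A : Finset ι) : ∀ (f c d : ℝ), 0 ≤ f → 0 ≤ c → 0 ≤ d → ∃ S ⊆ A,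
      (f + ∑ i ∈ A, w i * y i) - (f + Real.exp θ * ∑ i ∈ A, w i * y i) *
          (c * Real.exp ((Real.exp θ - 1) * ∑ i ∈ A, y i) +
            d * Real.exp ((Real.exp θ - 1) * ∑ i ∈ A, p i * y i)) ≤
        (f + ∑ i ∈ S, w i) *
          (1 - (c * Real.exp (θ * S.card) + d * Real.exp (θ * ∑ i ∈ S, p i))) := by
  induction A using Finset.induction_on with
  | empty =>
    intro f c d _ _ _
    refine ⟨∅, subset_rfl, ?_⟩
    simp
    linarith
  | insert i A hi ih =>
    intro f c d hf hc hd
    obtain ⟨S₁, hS₁, h₁⟩ := ih (f + w i) (c * Real.exp θ) (d * Real.exp (θ * p i))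
      (add_nonneg hf (hw i)) (by positivity) (by positivity)
    obtain ⟨S₀, hS₀, h₀⟩ := ih f c d hf hc hd
    have hiS : i ∉ S₁ := fun h => hi (hS₁ h)
    rw [Finset.sum_insert hi, Finset.sum_insert hi, Finset.sum_insert hi]
    set F := ∑ j ∈ A, w j * y j with hF
    have hF0 : 0 ≤ F := Finset.sum_nonneg fun j _ => mul_nonneg (hw j) (hy j)
    set a := Real.exp ((Real.exp θ - 1) * ∑ j ∈ A, y j) with ha
    set b := Real.exp ((Real.exp θ - 1) * ∑ j ∈ A, p j * y j) with hb
    have e1 : Real.exp ((Real.exp θ - 1) * (y i + ∑ j ∈ A, y j)) =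
        Real.exp ((Real.exp θ - 1) * (1 * y i)) * a := by
      rw [ha, ← Real.exp_add]
      congr 1
      ring
    have e2 : Real.exp ((Real.exp θ - 1) * (p i * y i + ∑ j ∈ A, p j * y j)) =
        Real.exp ((Real.exp θ - 1) * (p i * y i)) * b := by
      rw [hb, ← Real.exp_add]
      congr 1
      ring
    rw [e1, e2]
    have s1 := averaging_step (E := c * a) hθ zero_le_one le_rfl (hy i) (hw i) hf hF0
      (by positivity)
    have s2 := averaging_step (E := d * b) hθ (hp i) (hp1 i) (hy i) (hw i) hf hF0
      (by positivity)
    rw [mul_one] at s1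
    have hy0 := hy i
    have hq : 0 ≤ 1 - y i := sub_nonneg.2 (hy1 i)
    have havg : (f + (w i * y i + F)) - (f + Real.exp θ * (w i * y i + F)) *
        (c * (Real.exp ((Real.exp θ - 1) * (1 * y i)) * a) +
          d * (Real.exp ((Real.exp θ - 1) * (p i * y i)) * b)) ≤
        y i * ((f + w i + ∑ j ∈ S₁, w j) * (1 - (c * Real.exp θ * Real.exp (θ * S₁.card) +
          d * Real.exp (θ * p i) * Real.exp (θ * ∑ j ∈ S₁, p j)))) +
        (1 - y i) * ((f + ∑ j ∈ S₀, w j) *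
          (1 - (c * Real.exp (θ * S₀.card) + d * Real.exp (θ * ∑ j ∈ S₀, p j)))) := by
      have t1 := mul_le_mul_of_nonneg_left h₁ hy0
      have t0 := mul_le_mul_of_nonneg_left h₀ hq
      linarith
    by_cases hbest : (f + (w i * y i + F)) - (f + Real.exp θ * (w i * y i + F)) *
        (c * (Real.exp ((Real.exp θ - 1) * (1 * y i)) * a) +
          d * (Real.exp ((Real.exp θ - 1) * (p i * y i)) * b)) ≤
        (f + w i + ∑ j ∈ S₁, w j) * (1 - (c * Real.exp θ * Real.exp (θ * S₁.card) +
          d * Real.exp (θ * p i) * Real.exp (θ * ∑ j ∈ S₁, p j)))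
    · refine ⟨insert i S₁, Finset.insert_subset_insert i hS₁, hbest.trans_eq ?_⟩
      rw [Finset.sum_insert hiS, Finset.sum_insert hiS, Finset.card_insert_of_notMem hiS]
      push_cast
      rw [mul_add θ _ 1, mul_one, mul_add, Real.exp_add, Real.exp_add]
      ring
    · refine ⟨S₀, hS₀.trans (Finset.subset_insert i A), ?_⟩
      push Not at hbest
      by_contra hlt
      push Not at hlt
      have hmono : ∀ x₁ x₀ t : ℝ, x₁ < t → x₀ < t → y i * x₁ + (1 - y i) * x₀ < t := by
        intro x₁ x₀ t h1 h0
        rcases hy0.eq_or_lt with h | h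
        · rw [← h]; linarith
        · nlinarith
      exact absurd havg (not_le.2 (hmono _ _ _ hbest hlt))

/-- Replacing members of `S` by earlier members of their classes makes `S` closed under
predecessors; this changes neither its size nor its total rounded reward `u`, and does not increase
its total probability. -/
theorem exists_down_closed [Fintype ι] {cls rank : ι → ℕ} {kept : ι → Prop} {p u : ι → ℝ}
    (hpr : ∀ i j, cls i = cls j → rank i ≤ rank j → p i ≤ p j)
    (hu : ∀ i j, cls i = cls j → u i = u j)
    (hk : ∀ i j, cls i = cls j → kept i → kept j) (S : Finset ι) (hS : ∀ i ∈ S, kept i) :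
    ∃ S' : Finset ι, (∀ i ∈ S', kept i) ∧ S'.card = S.card ∧ ∑ i ∈ S', u i = ∑ i ∈ S, u i ∧
      ∑ i ∈ S', p i ≤ ∑ i ∈ S, p i ∧
      ∀ i ∈ S', ∀ j, cls j = cls i → rank j < rank i → j ∈ S' := by
  classical
  obtain ⟨S', hS', hmin⟩ := Finset.exists_min_image
    ((univ : Finset (Finset ι)).filter fun S' => (∀ i ∈ S', kept i) ∧ S'.card = S.card ∧
      ∑ i ∈ S', u i = ∑ i ∈ S, u i ∧ ∑ i ∈ S', p i ≤ ∑ i ∈ S, p i)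
    (fun S' => ∑ i ∈ S', rank i) ⟨S, by simpa using hS⟩
  simp only [Finset.mem_filter, Finset.mem_univ, true_and] at hS' hmin
  obtain ⟨h1, h2, h3, h4⟩ := hS'
  refine ⟨S', h1, h2, h3, h4, fun i hi j hc hr => ?_⟩
  by_contra hj
  have hje : j ∉ S'.erase i := fun h => hj (Finset.mem_of_mem_erase h)
  have hsum : ∀ f : ι → ℝ, ∑ x ∈ insert j (S'.erase i), f x + f i = ∑ x ∈ S', f x + f j := by
    intro f
    rw [Finset.sum_insert hje, ← Finset.add_sum_erase S' f hi]
    ring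
  have hsumN : ∑ x ∈ insert j (S'.erase i), rank x + rank i = ∑ x ∈ S', rank x + rank j := by
    rw [Finset.sum_insert hje, ← Finset.add_sum_erase S' rank hi]
    ring
  have := hmin (insert j (S'.erase i)) ⟨?_, ?_, ?_, ?_⟩
  · omega
  · intro x hx
    rcases Finset.mem_insert.1 hx with rfl | hx
    · exact hk i x hc.symm (h1 i hi)
    · exact h1 x (Finset.mem_of_mem_erase hx)
  · rw [Finset.card_insert_of_notMem hje, Finset.card_erase_of_mem hi, ← h2]
    have := Finset.card_pos.2 ⟨i, hi⟩
    omega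
  · have := hsum u
    rw [hu j i hc] at this
    linarith
  · have := hsum p
    have := hpr j i hc hr.le
    linarith

/-- Offering to the members of a set `S` of small total probability: the exponential term bounds
the probability that the positions run out. -/
theorem sum_mul_le_bestVal_heads {cls rank : ι → ℕ} {kept : ι → Prop} {p v : ι → ℝ}
    (hp : ∀ i, 0 ≤ p i) (hp1 : ∀ i, p i ≤ 1) (hv : ∀ i, 0 ≤ v i) {θ : ℝ} (hθ : 0 ≤ θ) :
    ∀ (m κ : ℕ) (A S : Finset ι), S ⊆ A → (∀ i ∈ S, kept i) →
      (∀ i ∈ S, ∀ j ∈ A, cls j = cls i → rank j < rank i → j ∈ S) → S.card ≤ m →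
      (∑ i ∈ S, p i * v i) * (1 - Real.exp ((Real.exp θ - 1) * ∑ i ∈ S, p i - θ * κ)) ≤
        bestVal (fun i => p i * v i) p (heads kept cls rank) m κ A := by
  have hw : ∀ i, 0 ≤ p i * v i := fun i => mul_nonneg (hp i) (hv i)
  have he1 : 1 ≤ Real.exp θ := Real.one_le_exp hθ
  intro m
  induction m with
  | zero =>
    intro κ A S _ _ _ hc
    have : S = ∅ := by simpa using hc
    simp [this]
  | succ m ih =>
    intro κ A S hSA hk hd hc
    have hf : 0 ≤ ∑ i ∈ S, p i * v i := Finset.sum_nonneg fun i _ => hw i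
    have hs : 0 ≤ ∑ i ∈ S, p i := Finset.sum_nonneg fun i _ => hp i
    cases κ with
    | zero =>
      rw [bestVal_zero_positions]
      refine mul_nonpos_of_nonneg_of_nonpos hf ?_
      have : 1 ≤ Real.exp ((Real.exp θ - 1) * ∑ i ∈ S, p i - θ * (0 : ℕ)) := by
        refine Real.one_le_exp ?_
        simp only [Nat.cast_zero, mul_zero, sub_zero]
        exact mul_nonneg (by linarith) hs
      linarith
    | succ κ =>
      rcases S.eq_empty_or_nonempty with rfl | hne
      · simpa using bestVal_nonneg hw hp hp1 _ _ _
      obtain ⟨i, hi, hmin⟩ := Finset.exists_min_image S rank hne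
      have hhead : i ∈ heads kept cls rank A := by
        refine mem_heads.2 ⟨hSA hi, hk i hi, fun j hj hcj => ?_⟩
        by_contra hlt
        push Not at hlt
        exact absurd (hmin j (hd i hi j hj hcj hlt)) (not_le.2 hlt)
      have hd' : ∀ x ∈ S.erase i, ∀ j ∈ A.erase i, cls j = cls x → rank j < rank x →
          j ∈ S.erase i := fun x hx j hj hcj hr =>
        Finset.mem_erase.2 ⟨Finset.ne_of_mem_erase hj,
          hd x (Finset.mem_of_mem_erase hx) j (Finset.mem_of_mem_erase hj) hcj hr⟩
      have hcard : (S.erase i).card ≤ m := by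
        rw [Finset.card_erase_of_mem hi]
        omega
      have hk' : ∀ x ∈ S.erase i, kept x := fun x hx => hk x (Finset.mem_of_mem_erase hx)
      have h1 := ih κ (A.erase i) (S.erase i) (Finset.erase_subset_erase i hSA) hk' hd' hcard
      have h0 := ih (κ + 1) (A.erase i) (S.erase i) (Finset.erase_subset_erase i hSA) hk' hd' hcard
      refine le_trans ?_ (le_bestVal hhead)
      rw [← Finset.add_sum_erase S p hi, ← Finset.add_sum_erase S (fun i => p i * v i) hi]
      have hfe : 0 ≤ ∑ j ∈ S.erase i, p j * v j := Finset.sum_nonneg fun i _ => hw i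
      set f := ∑ j ∈ S.erase i, p j * v j
      set s := ∑ j ∈ S.erase i, p j
      have hpi := hp i
      have hqi : 0 ≤ 1 - p i := by linarith [hp1 i]
      -- The exponential term is a supermartingale.
      have hφ : p i * Real.exp ((Real.exp θ - 1) * s - θ * κ) +
          (1 - p i) * Real.exp ((Real.exp θ - 1) * s - θ * (κ + 1 : ℕ)) ≤
          Real.exp ((Real.exp θ - 1) * (p i + s) - θ * (κ + 1 : ℕ)) := by
        have e1 : Real.exp ((Real.exp θ - 1) * s - θ * κ) = Real.exp θ *
            Real.exp ((Real.exp θ - 1) * s - θ * (κ + 1 : ℕ)) := by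
          rw [← Real.exp_add]
          congr 1
          push_cast
          ring
        have e2 : Real.exp ((Real.exp θ - 1) * (p i + s) - θ * (κ + 1 : ℕ)) =
            Real.exp ((Real.exp θ - 1) * p i) *
            Real.exp ((Real.exp θ - 1) * s - θ * (κ + 1 : ℕ)) := by
          rw [← Real.exp_add]
          congr 1
          ring
        rw [e1, e2]
        have := Real.add_one_le_exp ((Real.exp θ - 1) * p i)
        have h3 := mul_le_mul_of_nonneg_right this
          (Real.exp_pos ((Real.exp θ - 1) * s - θ * (κ + 1 : ℕ))).le
        linarith
      have a1 := mul_le_mul_of_nonneg_left h1 hpi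
      have a0 := mul_le_mul_of_nonneg_left h0 hqi
      have a2 := mul_le_mul_of_nonneg_left hφ hfe
      have a3 : 0 ≤ p i * v i * Real.exp ((Real.exp θ - 1) * (p i + s) - θ * (κ + 1 : ℕ)) :=
        mul_nonneg (hw i) (Real.exp_pos _).le
      linarith

end rounding

/-! ### Geometric levels, classes and ranks -/

/-- The number of those of the thresholds `X, X β, …, X β ^ (len - 1)` that are at least `z`. -/
noncomputable def level (X β : ℝ) (len : ℕ) (z : ℝ) : ℕ :=
  ((range len).filter fun s => z ≤ X * β ^ s).card

section level

variable {X β : ℝ} {len : ℕ} {z : ℝ}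

theorem level_le : level X β len z ≤ len :=
  (Finset.card_filter_le (range len) fun s => z ≤ X * β ^ s).trans (by rw [Finset.card_range])

theorem level_succ : level X β (len + 1) z =
    level X β len z + if z ≤ X * β ^ len then 1 else 0 := by
  unfold level
  rw [Finset.range_add_one, Finset.filter_insert]
  split_ifs
  · rw [Finset.card_insert_of_notMem (by simp)]
  · rfl

theorem filter_le_threshold_eq (hX : 0 ≤ X) (hβ : 0 ≤ β) (hβ1 : β ≤ 1) :
    ((range len).filter fun s => z ≤ X * β ^ s) = range (level X β len z) := by
  have hsub : ((range len).filter fun s => z ≤ X * β ^ s) ⊆ range (level X β len z) := by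
    intro s hs
    simp only [Finset.mem_filter, Finset.mem_range] at hs
    have : range (s + 1) ⊆ (range len).filter fun s => z ≤ X * β ^ s := by
      intro r hr
      simp only [Finset.mem_filter, Finset.mem_range] at hr ⊢
      exact ⟨by omega, hs.2.trans
        (mul_le_mul_of_nonneg_left (pow_le_pow_of_le_one hβ hβ1 (by omega)) hX)⟩
    have := Finset.card_le_card this
    simp only [Finset.card_range] at this
    exact Finset.mem_range.2 this
  exact Finset.eq_of_subset_of_card_le hsub (by rw [Finset.card_range]; rfl)

theorem threshold_lt (hX : 0 ≤ X) (hβ : 0 ≤ β) (hβ1 : β ≤ 1) (h : level X β len z < len) :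
    X * β ^ level X β len z < z := by
  by_contra hle
  push Not at hle
  have : level X β len z ∈ (range len).filter fun s => z ≤ X * β ^ s := by simp [h, hle]
  rw [filter_le_threshold_eq hX hβ hβ1] at this
  simp at this

theorem le_threshold (hX : 0 ≤ X) (hβ : 0 ≤ β) (hβ1 : β ≤ 1) {s : ℕ} (hs : s < level X β len z) :
    z ≤ X * β ^ s := by
  have : s ∈ range (level X β len z) := Finset.mem_range.2 hs
  rw [← filter_le_threshold_eq hX hβ hβ1] at this
  exact (Finset.mem_filter.1 this).2

end level

/-- The class of an applicant with probability `p` and value `v`: the level of the expected reward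
`p * v` relative to `M`, combined with the level of `v` relative to `X`. There are `V` levels of
values. The classes from `L * V` on consist of applicants with negligible expected reward. -/
noncomputable def classOf (M X β : ℝ) (L V : ℕ) (p v : ℝ) : ℕ :=
  V * level (M * β) β L (p * v) + level X β (V - 1) v

/-- The position of an applicant in its class, in order of increasing acceptance probability. -/
noncomputable def rankIn {n : ℕ} (cls : Fin n → ℕ) (p : Fin n → ℝ) (i : Fin n) : ℕ :=
  (univ.filter fun j => cls j = cls i ∧ (p j < p i ∨ (p j = p i ∧ j < i))).card

section rankIn

variable {n : ℕ} {cls : Fin n → ℕ} {p : Fin n → ℝ}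

theorem rankIn_lt_iff {i j : Fin n} (h : cls j = cls i) :
    rankIn cls p j < rankIn cls p i ↔ (p j < p i ∨ (p j = p i ∧ j < i)) := by
  have key : ∀ i j : Fin n, cls j = cls i → (p j < p i ∨ (p j = p i ∧ j < i)) →
      rankIn cls p j < rankIn cls p i := by
    intro i j h hlt
    refine Finset.card_lt_card ⟨fun x hx => ?_, fun hsub => ?_⟩
    · simp only [Finset.mem_filter, Finset.mem_univ, true_and] at hx ⊢
      refine ⟨hx.1.trans h, ?_⟩
      rcases hx.2 with h1 | h1 <;> rcases hlt with h2 | h2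
      · exact Or.inl (h1.trans h2)
      · exact Or.inl (h2.1 ▸ h1)
      · exact Or.inl (h1.1 ▸ h2)
      · exact Or.inr ⟨h1.1.trans h2.1, h1.2.trans h2.2⟩
    · have := hsub (Finset.mem_filter.2 ⟨Finset.mem_univ j, h, hlt⟩)
      simp at this
  refine ⟨fun hr => ?_, key i j h⟩
  by_contra hn
  push Not at hn
  rcases hn.1.lt_or_eq with h1 | h1
  · exact absurd (key j i h.symm (Or.inl h1)) (by omega)
  · rcases (hn.2 h1.symm).lt_or_eq with h2 | h2
    · exact absurd (key j i h.symm (Or.inr ⟨h1, h2⟩)) (by omega)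
    · subst h2
      omega

theorem rankIn_inj {i j : Fin n} (h : cls j = cls i) (hr : rankIn cls p j = rankIn cls p i) :
    j = i := by
  have h1 := mt (rankIn_lt_iff (p := p) h).2 (by omega)
  have h2 := mt (rankIn_lt_iff (p := p) h.symm).2 (by omega)
  push Not at h1 h2
  have := le_antisymm h1.1 h2.1
  exact le_antisymm (h2.2 this) (h1.2 this.symm)

theorem le_of_rankIn_le {i j : Fin n} (h : cls i = cls j)
    (hr : rankIn cls p i ≤ rankIn cls p j) : p i ≤ p j := by
  by_contra hlt
  push Not at hlt
  exact absurd ((rankIn_lt_iff (p := p) h.symm).2 (Or.inl hlt)) (by omega)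

theorem rankIn_eq_card (i : Fin n) : rankIn cls p i =
    (univ.filter fun j => cls j = cls i ∧ rankIn cls p j < rankIn cls p i).card := by
  conv_lhs => rw [rankIn]
  congr 1
  ext j
  simp only [Finset.mem_filter, Finset.mem_univ, true_and]
  constructor
  · exact fun h => ⟨h.1, (rankIn_lt_iff h.1).2 h.2⟩
  · exact fun h => ⟨h.1, (rankIn_lt_iff h.1).1 h.2⟩

/-- At least `m` members of a class, or all of them, have a rank below `m`. -/
theorem min_card_le_card_rankIn_lt (m c : ℕ) : min m (univ.filter fun i => cls i = c).card ≤
    (univ.filter fun i => cls i = c ∧ rankIn cls p i < m).card := by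
  by_cases hall : ∀ i, cls i = c → rankIn cls p i < m
  · refine (min_le_right _ _).trans (Finset.card_le_card fun i hi => ?_)
    simp only [Finset.mem_filter, Finset.mem_univ, true_and] at hi ⊢
    exact ⟨hi, hall i hi⟩
  · push Not at hall
    obtain ⟨i₀, hi₀⟩ := hall
    obtain ⟨i, hi, hmin⟩ := Finset.exists_min_image
      (univ.filter fun i => cls i = c ∧ m ≤ rankIn cls p i) (rankIn cls p) ⟨i₀, by simpa using hi₀⟩
    simp only [Finset.mem_filter, Finset.mem_univ, true_and] at hi hmin
    refine (min_le_left _ _).trans (hi.2.trans ?_)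
    rw [rankIn_eq_card i]
    refine Finset.card_le_card fun j hj => ?_
    simp only [Finset.mem_filter, Finset.mem_univ, true_and] at hj ⊢
    refine ⟨hj.1.trans hi.1, ?_⟩
    by_contra hm
    push Not at hm
    exact absurd (hmin j ⟨hj.1.trans hi.1, hm⟩) (by omega)

/-- The members of a set that is closed under predecessors have ranks below its size. -/
theorem rankIn_lt_card {S : Finset (Fin n)} {i : Fin n} (hi : i ∈ S)
    (hS : ∀ j, cls j = cls i → rankIn cls p j < rankIn cls p i → j ∈ S) :
    rankIn cls p i < S.card := by
  have hsub : (univ.filter fun j => cls j = cls i ∧ rankIn cls p j < rankIn cls p i) ⊆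
      S.erase i := by
    intro j hj
    simp only [Finset.mem_filter, Finset.mem_univ, true_and] at hj
    refine Finset.mem_erase.2 ⟨?_, hS j hj.1 hj.2⟩
    rintro rfl
    omega
  have := Finset.card_le_card hsub
  rw [← rankIn_eq_card, Finset.card_erase_of_mem hi] at this
  have := Finset.card_pos.2 ⟨i, hi⟩
  omega

end rankIn

/-! ### Class-ordered policies are nearly optimal -/

section approximation

variable {n : ℕ} {p v : Fin n → ℝ}

/-- The best reward of a class-ordered policy, when only the first `m` applicants of each class are
retained. -/
noncomputable def classVal (p v : Fin n → ℝ) (cls : Fin n → ℕ) (D cap m κ : ℕ)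
    (A : Finset (Fin n)) : ℝ :=
  bestVal (fun i => p i * v i) p
    (heads (fun i => cls i < D ∧ rankIn cls p i < cap) cls (rankIn cls p)) m κ A

theorem classOf_lt_iff {M X β : ℝ} {L V : ℕ} {p v : ℝ} (hV : 1 ≤ V) :
    classOf M X β L V p v < L * V ↔ level (M * β) β L (p * v) < L := by
  unfold classOf
  have hb : level X β (V - 1) v < V := lt_of_le_of_lt level_le (by omega)
  constructor
  · intro h
    by_contra hn
    push Not at hn
    have := Nat.mul_le_mul_left V hn
    rw [mul_comm L V] at h
    omega
  · intro h
    have := Nat.mul_le_mul_left V (Nat.succ_le_of_lt h)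
    rw [Nat.succ_eq_add_one, mul_add, mul_one] at this
    rw [mul_comm L V]
    omega

theorem levels_eq_of_classOf_eq {M X β : ℝ} {L V : ℕ} {p v p' v' : ℝ} (hV : 1 ≤ V)
    (h : classOf M X β L V p v = classOf M X β L V p' v') :
    level (M * β) β L (p * v) = level (M * β) β L (p' * v') ∧
      level X β (V - 1) v = level X β (V - 1) v' := by
  unfold classOf at h
  have hb : level X β (V - 1) v < V := lt_of_le_of_lt level_le (by omega)
  have hb' : level X β (V - 1) v' < V := lt_of_le_of_lt level_le (by omega)
  have hd := congrArg (· / V) h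
  have hm := congrArg (· % V) h
  simp only [Nat.mul_add_div hV, Nat.div_eq_of_lt hb, Nat.div_eq_of_lt hb', add_zero] at hd
  simp only [Nat.mul_add_mod, Nat.mod_eq_of_lt hb, Nat.mod_eq_of_lt hb'] at hm
  exact ⟨hd, hm⟩

theorem bestVal_le_mul_max (hp : ∀ i, 0 ≤ p i) (hp1 : ∀ i, p i ≤ 1) (hv : ∀ i, 0 ≤ v i) {M : ℝ}
    (hM : ∀ i, p i * v i ≤ M) (hM0 : 0 ≤ M) (m κ : ℕ) (A : Finset (Fin n)) :
    bestVal (fun i => p i * v i) p id m κ A ≤ m * M := by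
  have h := mul_bestVal_le (gain := fun _ => 0) (acc := fun _ => 0) (c := 1) (η := M) (ξ := 0)
    (good := fun _ => False) hp hp1 hv (fun _ => le_rfl) (fun _ => le_rfl) hp le_rfl hM0 le_rfl
    (by simp) (fun i _ => Or.inl (hM i)) m κ A
  have he : bestVal (fun _ : Fin n => (0 : ℝ)) (fun _ => 0) id m κ ∅ = 0 := bestVal_of_empty rfl
  rw [Finset.filter_false, he] at h
  linarith

theorem le_bestVal_of_mem (hp : ∀ i, 0 ≤ p i) (hp1 : ∀ i, p i ≤ 1) (hv : ∀ i, 0 ≤ v i)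
    {adm : Finset (Fin n) → Finset (Fin n)} {A : Finset (Fin n)} {i : Fin n} (hi : i ∈ adm A)
    {m κ : ℕ} (hm : 1 ≤ m) (hκ : 1 ≤ κ) :
    p i * v i ≤ bestVal (fun i => p i * v i) p adm m κ A := by
  obtain ⟨m, rfl⟩ := Nat.exists_eq_add_of_le' hm
  obtain ⟨κ, rfl⟩ := Nat.exists_eq_add_of_le' hκ
  refine le_trans ?_ (le_bestVal hi)
  have hw : ∀ i, 0 ≤ p i * v i := fun i => mul_nonneg (hp i) (hv i)
  have h1 := mul_nonneg (hp i) (bestVal_nonneg (adm := adm) hw hp hp1 m κ (A.erase i))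
  have h2 := mul_nonneg (sub_nonneg.2 (hp1 i))
    (bestVal_nonneg (adm := adm) hw hp hp1 m (κ + 1) (A.erase i))
  linarith

/-- With a single stage, one class of the applicants of nearly maximal expected reward suffices. -/
theorem mul_bestVal_le_classVal_one_stage (hp : ∀ i, 0 ≤ p i) (hp1 : ∀ i, p i ≤ 1)
    (hv : ∀ i, 0 ≤ v i) {M X ε : ℝ} (hM : ∀ i, p i * v i ≤ M) (hM' : M = 0 ∨ ∃ i, p i * v i = M)
    (hM0 : 0 ≤ M) (hε : 0 < ε) (hε1 : ε < 1) (κ : ℕ) :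
    (1 - ε) * bestVal (fun i => p i * v i) p id 1 κ univ ≤
      classVal p v (fun i => classOf M X (1 - ε) 1 1 (p i) (v i)) 1 1 1 κ univ := by
  have hw : ∀ i, 0 ≤ p i * v i := fun i => mul_nonneg (hp i) (hv i)
  have hup := bestVal_le_mul_max hp hp1 hv hM hM0 1 κ univ
  rw [Nat.cast_one, one_mul] at hup
  have hc0 : 0 ≤ classVal p v (fun i => classOf M X (1 - ε) 1 1 (p i) (v i)) 1 1 1 κ univ :=
    bestVal_nonneg hw hp hp1 _ _ _
  have h1ε : 0 < 1 - ε := by linarith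
  rcases hM0.eq_or_lt with h | hMpos
  · rw [← h] at hup
    nlinarith
  rcases Nat.eq_zero_or_pos κ with rfl | hκ
  · simpa using hc0
  obtain ⟨i, hi⟩ := hM'.resolve_left hMpos.ne'
  set cls := fun i => classOf M X (1 - ε) 1 1 (p i) (v i) with hcls
  have hci : cls i = 0 := by
    have hlt : M * (1 - ε) < M := by nlinarith
    simp [hcls, classOf, level, hi, hlt]
  obtain ⟨j, hj, hmin⟩ := Finset.exists_min_image (univ.filter (cls · = 0)) (rankIn cls p)
    ⟨i, by simpa using hci⟩
  have hcj : cls j = 0 := by simpa using hj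
  have hr : rankIn cls p j = 0 := by
    by_contra hne
    have h1 := rankIn_eq_card (cls := cls) (p := p) j
    have : 0 < rankIn cls p j := Nat.pos_of_ne_zero hne
    rw [h1, Finset.card_pos] at this
    obtain ⟨x, hx⟩ := this
    simp only [Finset.mem_filter, Finset.mem_univ, true_and] at hx
    exact absurd (hmin x (by simpa [hcj] using hx.1)) (by omega)
  have hhead : j ∈ heads (fun i => cls i < 1 ∧ rankIn cls p i < 1) cls (rankIn cls p) univ :=
    mem_heads.2 ⟨Finset.mem_univ j, ⟨by omega, by omega⟩, by omega⟩
  refine le_trans ?_ (le_bestVal_of_mem hp hp1 hv hhead le_rfl hκ)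
  have hlt : M * (1 - ε) < p j * v j := by
    by_contra hle
    push Not at hle
    simp [hcls, classOf, level] at hcj
    linarith
  nlinarith

theorem one_sub_inv_pow_le {q : ℕ} (hq : 1 ≤ q) (s : ℕ) :
    (1 - 1 / (q : ℝ)) ^ (q * s) ≤ (1 / 2) ^ s := by
  have hq0 : (0 : ℝ) < q := by exact_mod_cast hq
  have hq1 : 1 / (q : ℝ) ≤ 1 := by
    rw [div_le_one hq0]
    exact_mod_cast hq
  rw [pow_mul]
  refine pow_le_pow_left₀ (pow_nonneg (by linarith) q) ?_ s
  have h := one_add_mul_le_pow (a := 1 / (q : ℝ)) (by linarith [one_div_pos.2 hq0]) q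
  have h2 : (2 : ℝ) ≤ (1 + 1 / (q : ℝ)) ^ q := by
    refine le_trans (le_of_eq ?_) h
    field_simp
    norm_num
  have h3 : (1 - 1 / (q : ℝ)) ^ q * (1 + 1 / (q : ℝ)) ^ q ≤ 1 := by
    rw [← mul_pow]
    refine pow_le_one₀ ?_ ?_
    · have := one_div_pos.2 hq0
      exact mul_nonneg (by linarith) (by linarith)
    · nlinarith [sq_nonneg (1 / (q : ℝ))]
  have h4 : 0 ≤ (1 - 1 / (q : ℝ)) ^ q := pow_nonneg (by linarith) q
  nlinarith

end approximation

section regimes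

variable {n : ℕ} {p v : Fin n → ℝ}

/-- Few positions: if `G` is the optimal value up to a factor of two, then values above `G q` belong
to sure gains, and values far below `G` are negligible. -/
theorem mul_bestVal_le_classVal_of_few (hp : ∀ i, 0 ≤ p i) (hp1 : ∀ i, p i ≤ 1)
    (hv : ∀ i, 0 ≤ v i) {M G : ℝ} {q t m κ : ℕ} (hM : ∀ i, p i * v i ≤ M)
    (hMG : M ≤ G) (hM0 : 0 < M) (hq : 16 ≤ q) (ht : m ≤ 2 ^ t) (hκ : 1 ≤ κ)
    (hκq : κ < q ^ 4) (hG1 : G ≤ bestVal (fun i => p i * v i) p id m κ univ)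
    (hG2 : bestVal (fun i => p i * v i) p id m κ univ ≤ 2 * G) :
    (1 - 8 / (q : ℝ)) * bestVal (fun i => p i * v i) p id m κ univ ≤
      classVal p v (fun i => classOf M (G * q) (1 - 1 / (q : ℝ)) (q * (t + q)) (q ^ 3 + 2) (p i)
        (v i)) (q * (t + q) * (q ^ 3 + 2)) m m κ univ := by
  set W := bestVal (fun i => p i * v i) p id m κ univ with hW
  set β := 1 - 1 / (q : ℝ) with hβ
  set L := q * (t + q) with hL
  set V := q ^ 3 + 2 with hV
  set X := G * q with hX
  set cls := fun i => classOf M X β L V (p i) (v i) with hcls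
  have hq16 : (16 : ℝ) ≤ q := by exact_mod_cast hq
  have hq0 : (0 : ℝ) < q := by linarith
  have hδ0 : 0 < 1 / (q : ℝ) := by positivity
  have hδ1 : 1 / (q : ℝ) ≤ 1 / 16 := one_div_le_one_div_of_le (by norm_num) hq16
  have hqδ : (q : ℝ) * (1 / q) = 1 := by field_simp
  have h8 : 8 / (q : ℝ) = 8 * (1 / q) := by ring
  rw [h8]
  set δ := 1 / (q : ℝ) with hδ
  have hβ0 : 0 < β := by rw [hβ]; linarith
  have hβ1 : β ≤ 1 := by rw [hβ]; linarith
  have hG0 : 0 < G := hM0.trans_le hMG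
  have hX0 : 0 < X := by positivity
  have hMβ : 0 ≤ M * β := by positivity
  have hV1 : 1 ≤ V := by omega
  have hw : ∀ i, 0 ≤ p i * v i := fun i => mul_nonneg (hp i) (hv i)
  let a : Fin n → ℕ := fun i => level (M * β) β L (p i * v i)
  let b : Fin n → ℕ := fun i => level X β (V - 1) (v i)
  have hab : ∀ i j, cls i = cls j → a i = a j ∧ b i = b j := fun i j h =>
    levels_eq_of_classOf_eq hV1 h
  have hclsD : ∀ i, cls i < L * V ↔ a i < L := fun i => classOf_lt_iff hV1
  have ha_le : ∀ i, p i * v i ≤ M * β ^ a i := by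
    intro i
    rcases Nat.eq_zero_or_pos (a i) with h | h
    · rw [h, pow_zero, mul_one]
      exact hM i
    · have := le_threshold hMβ hβ0.le hβ1 (show a i - 1 < a i by omega)
      rwa [mul_assoc, ← pow_succ', Nat.sub_add_cancel h] at this
  have ha_lt : ∀ i, a i < L → M * β ^ (a i + 1) < p i * v i := by
    intro i h
    have := threshold_lt hMβ hβ0.le hβ1 h
    rwa [mul_assoc, ← pow_succ'] at this
  have hb_lt : ∀ i, b i < V - 1 → X * β ^ b i < v i := fun i h =>
    threshold_lt hX0.le hβ0.le hβ1 h
  have hb_le : ∀ i, b i ≠ 0 → v i ≤ X * β ^ (b i - 1) := fun i h =>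
    le_threshold hX0.le hβ0.le hβ1 (show b i - 1 < b i by omega)
  let good₀ : Fin n → Prop := fun i => a i < L ∧ b i < V - 1
  let good : Fin n → Prop := fun i => good₀ i ∧ rankIn cls p i < m
  let gain : Fin n → ℝ := fun i => if a i < L ∧ b i < V - 1 then
    (if b i = 0 then M * β ^ (a i + 1) else M * β ^ (a i + 2)) else 0
  let acc : Fin n → ℝ := fun i => if a i < L ∧ b i < V - 1 then
    (if b i = 0 then 0 else M * β ^ (a i + 2) / (X * β ^ b i)) else 0
  have hg : ∀ i, 0 ≤ gain i := by
    intro i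
    simp only [gain]
    split_ifs <;> positivity
  have hac0 : ∀ i, 0 ≤ acc i := by
    intro i
    simp only [acc]
    split_ifs <;> positivity
  have hap : ∀ i, acc i ≤ p i := by
    intro i
    simp only [acc]
    split_ifs with h1 h2
    · exact hp i
    · rw [div_le_iff₀ (by positivity)]
      have e1 := ha_lt i h1.1
      have e2 := hb_le i h2
      have e3 : M * β ^ (a i + 2) ≤ p i * v i * β := by
        rw [pow_succ, ← mul_assoc]
        exact mul_le_mul_of_nonneg_right e1.le hβ0.le
      have e4 : v i * β ≤ X * β ^ b i := by
        calc v i * β ≤ X * β ^ (b i - 1) * β := mul_le_mul_of_nonneg_right e2 hβ0.le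
          _ = X * β ^ b i := by rw [mul_assoc, ← pow_succ, Nat.sub_add_cancel (by omega)]
      calc M * β ^ (a i + 2) ≤ p i * (v i * β) := by linarith
        _ ≤ p i * (X * β ^ b i) := mul_le_mul_of_nonneg_left e4 (hp i)
    · exact hp i
  have hac1 : ∀ i, acc i ≤ 1 := fun i => (hap i).trans (hp1 i)
  have hgc : ∀ i j, cls i = cls j → gain i = gain j := by
    intro i j h
    simp only [gain, (hab i j h).1, (hab i j h).2]
  have hacc : ∀ i j, cls i = cls j → acc i = acc j := by
    intro i j h
    simp only [acc, (hab i j h).1, (hab i j h).2]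
  classical
  -- Negligible applicants and rounding.
  have hup := mul_bestVal_le (p := p) (v := v) (gain := gain) (acc := acc) (c := β ^ 2)
    (η := M * β ^ L) (ξ := X * β ^ (V - 2)) (good := good₀) hp hp1 hv hg hac0 hap
    (pow_le_one₀ hβ0.le hβ1) (by positivity) (by positivity)
    (fun i hi => by
      have hi' : a i < L ∧ b i < V - 1 := hi
      have e := mul_le_mul_of_nonneg_left (ha_le i) (pow_nonneg hβ0.le 2)
      simp only [gain, if_pos hi']
      split_ifs
      · calc β ^ 2 * (p i * v i) ≤ β ^ 2 * (M * β ^ a i) := e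
          _ = M * β ^ (a i + 1) * β := by ring
          _ ≤ M * β ^ (a i + 1) * 1 := mul_le_mul_of_nonneg_left hβ1 (by positivity)
          _ = M * β ^ (a i + 1) := mul_one _
      · calc β ^ 2 * (p i * v i) ≤ β ^ 2 * (M * β ^ a i) := e
          _ = M * β ^ (a i + 2) := by ring)
    (fun i hi => by
      have hi' : ¬ (a i < L ∧ b i < V - 1) := hi
      have haL : a i ≤ L := level_le
      have hbV : b i ≤ V - 1 := level_le
      by_cases h : a i < L
      · right
        have hb : b i = V - 1 := by
          by_contra hne
          exact hi' ⟨h, by omega⟩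
        have := hb_le i (by omega)
        rwa [hb, show V - 1 - 1 = V - 2 by omega] at this
      · left
        have := ha_le i
        rwa [show a i = L by omega] at this) m κ univ
  -- Only the first `m` applicants of a class matter.
  have hcap : bestVal gain acc id m κ (univ.filter good₀) ≤
      bestVal gain acc id m κ (univ.filter good) := by
    refine bestVal_le_of_counts (cls := cls) hg hac0 hac1 hgc hacc m κ _ _ fun c => ?_
    by_cases hc : ∃ i, cls i = c ∧ good₀ i
    · obtain ⟨i, hi, hgi⟩ := hc
      have hall : ∀ j, cls j = c → good₀ j := by
        intro j hj
        obtain ⟨h1, h2⟩ := hab j i (hj.trans hi.symm)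
        show a j < L ∧ b j < V - 1
        rw [h1, h2]
        exact hgi
      have e1 : (univ.filter good₀).filter (cls · = c) = univ.filter (cls · = c) := by
        ext j
        simp only [Finset.mem_filter, Finset.mem_univ, true_and]
        exact ⟨fun h => h.2, fun h => ⟨hall j h, h⟩⟩
      have e2 : (univ.filter good).filter (cls · = c) =
          univ.filter fun j => cls j = c ∧ rankIn cls p j < m := by
        ext j
        simp only [Finset.mem_filter, Finset.mem_univ, true_and]
        exact ⟨fun h => ⟨h.2, h.1.2⟩, fun h => ⟨⟨hall j h.1, h.2⟩, h.1⟩⟩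
      rw [e1, e2]
      exact min_card_le_card_rankIn_lt m c
    · have e1 : (univ.filter good₀).filter (cls · = c) = ∅ := by
        ext j
        simp only [Finset.mem_filter, Finset.mem_univ, true_and, Finset.notMem_empty, iff_false]
        exact fun h => hc ⟨j, h.2, h.1⟩
      rw [e1]
      simp
  -- Applicants of very large value are rarely accepted.
  have hlow := mul_bestVal_le_heads (p := p) (v := v) (gain := gain) (acc := acc) (good := good)
    (high := fun i => b i = 0) (kept := fun i => cls i < L * V ∧ rankIn cls p i < m) (cls := cls)
    (rank := rankIn cls p) hp hp1 hv hg hac0 hap hgc hacc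
    (fun i hi => ⟨(hclsD i).2 hi.1.1, hi.2⟩)
    (fun i j hc hr hj => by
      refine ⟨?_, hr.trans_lt hj.2⟩
      show a i < L ∧ b i < V - 1
      rw [(hab i j hc).1, (hab i j hc).2]
      exact hj.1)
    (fun i hi hb => by
      have hi' : a i < L ∧ b i < V - 1 := hi.1
      have hb' : b i = 0 := hb
      simp only [acc, gain, if_pos hi', if_pos hb']
      exact ⟨trivial, (ha_lt i hi'.1).le⟩)
    (fun i hi hb => by
      have hi' : a i < L ∧ b i < V - 1 := hi.1
      have hb' : ¬ b i = 0 := hb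
      simp only [acc, gain, if_pos hi', if_neg hb']
      refine ⟨by positivity, X * β ^ b i, (hb_lt i hi'.2).le, ?_⟩
      field_simp)
    m κ univ (4 * δ) (by linarith)
    (fun S _ hS hc => by
      have h1 := mul_div_le_bestVal hp hp1 hv hX0.le m κ univ S (Finset.subset_univ S) hc hκ
        (fun i hi => by
          have hb : b i = 0 := (hS i hi).2
          have := hb_lt i (hS i hi).1.1.2
          rw [hb, pow_zero, mul_one] at this
          exact this.le)
      have hs : 0 ≤ ∑ i ∈ S, p i := Finset.sum_nonneg fun i _ => hp i
      set h := ∑ i ∈ S, p i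
      have h2 : G * (q * (h / (1 + h))) ≤ G * 2 := by
        calc G * (q * (h / (1 + h))) = X * (h / (1 + h)) := by rw [hX]; ring
          _ ≤ G * 2 := by linarith
      have h3 := le_of_mul_le_mul_left h2 hG0
      rw [← mul_div_assoc, div_le_iff₀ (by positivity)] at h3
      have h4 : h * q ≤ 4 := by nlinarith
      calc h = h * q * δ := by rw [mul_assoc, hqδ, mul_one]
        _ ≤ 4 * δ := mul_le_mul_of_nonneg_right h4 hδ0.le)
  -- The error terms.
  have hq2 : (q : ℝ) ≤ 2 ^ q := by exact_mod_cast Nat.lt_two_pow_self.le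
  have herr1 : m * (M * β ^ L) ≤ δ * W := by
    have e1 : β ^ L ≤ (1 / 2) ^ (t + q) := one_sub_inv_pow_le (by omega) _
    have e2 : (m : ℝ) ≤ 2 ^ t := by exact_mod_cast ht
    have e3 : (m : ℝ) * β ^ L ≤ δ := by
      calc (m : ℝ) * β ^ L ≤ 2 ^ t * (1 / 2) ^ (t + q) := by gcongr
        _ = 1 / 2 ^ q := by rw [pow_add, ← mul_assoc, ← mul_pow, one_div_pow]; norm_num
        _ ≤ δ := one_div_le_one_div_of_le hq0 hq2
    calc m * (M * β ^ L) = m * β ^ L * M := by ring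
      _ ≤ δ * M := mul_le_mul_of_nonneg_right e3 hM0.le
      _ ≤ δ * W := mul_le_mul_of_nonneg_left (hMG.trans hG1) hδ0.le
  have herr2 : κ * (X * β ^ (V - 2)) ≤ δ * W := by
    have e1 : β ^ (q * q ^ 2) ≤ (1 / 2) ^ (q ^ 2) := one_sub_inv_pow_le (by omega) _
    have e2 : (κ : ℝ) ≤ q ^ 4 := by exact_mod_cast hκq.le
    have e3 : (q : ℝ) ^ 6 ≤ 2 ^ q ^ 2 := by
      calc (q : ℝ) ^ 6 ≤ q ^ q := pow_le_pow_right₀ (by linarith) (by omega)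
        _ ≤ (2 ^ q) ^ q := pow_le_pow_left₀ hq0.le hq2 q
        _ = 2 ^ q ^ 2 := by rw [← pow_mul, sq]
    have e4 : (κ : ℝ) * q * β ^ (V - 2) ≤ δ := by
      rw [show V - 2 = q * q ^ 2 by rw [hV]; simp; ring]
      calc (κ : ℝ) * q * β ^ (q * q ^ 2) ≤ q ^ 4 * q * (1 / 2) ^ (q ^ 2) := by gcongr
        _ = q ^ 6 * (1 / 2 ^ (q ^ 2)) * δ := by
          rw [one_div_pow, show (q : ℝ) ^ 6 = q ^ 4 * q * q by ring]
          calc _ = (q : ℝ) ^ 4 * q * (1 / 2 ^ q ^ 2) * 1 := by ring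
            _ = _ := by rw [← hqδ]; ring
        _ ≤ 2 ^ q ^ 2 * (1 / 2 ^ (q ^ 2)) * δ := by gcongr
        _ = δ := by field_simp
    calc κ * (X * β ^ (V - 2)) = κ * q * β ^ (V - 2) * G := by rw [hX]; ring
      _ ≤ δ * G := mul_le_mul_of_nonneg_right e4 hG0.le
      _ ≤ δ * W := mul_le_mul_of_nonneg_left hG1 hδ0.le
  have hW0 : 0 ≤ W := hG0.le.trans hG1
  show _ ≤ bestVal (fun i => p i * v i) p
    (heads (fun i => cls i < L * V ∧ rankIn cls p i < m) cls (rankIn cls p)) m κ univ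
  refine le_trans ?_ hlow
  have hU : (β ^ 2 - 2 * δ) * W ≤ bestVal gain acc id m κ (univ.filter good) := by
    linarith
  have h4 : 0 ≤ 1 - 4 * δ := by linarith
  refine le_trans ?_ (mul_le_mul_of_nonneg_left hU h4)
  have : (1 - 8 * δ) ≤ (1 - 4 * δ) * (β ^ 2 - 2 * δ) := by
    rw [hβ]
    nlinarith
  calc (1 - 8 * δ) * W ≤ (1 - 4 * δ) * (β ^ 2 - 2 * δ) * W := mul_le_mul_of_nonneg_right this hW0
    _ = _ := by ring

theorem exp_sub_one_le {θ : ℝ} (h0 : 0 ≤ θ) (h1 : θ ≤ 1) : Real.exp θ - 1 ≤ θ * (1 + θ) := by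
  have := Real.abs_exp_sub_one_sub_id_le (x := θ) (by rwa [abs_of_nonneg h0])
  have := (abs_le.1 this).2
  nlinarith

/-- The exponential bounds that are small when there are at least `q ^ 4` positions and stages. -/
theorem exp_neg_le {q N : ℕ} (hq : 16 ≤ q) (hN : q ^ 4 ≤ N) {x : ℝ}
    (hx : x ≤ -((N : ℝ) * (1 / q) ^ 2 / 4)) : Real.exp x ≤ 1 / (4 * q) := by
  have hq16 : (16 : ℝ) ≤ q := by exact_mod_cast hq
  have hq0 : (0 : ℝ) < q := by linarith
  have hN' : (q : ℝ) ^ 4 ≤ N := by exact_mod_cast hN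
  have h1 : (q : ℝ) ^ 2 / 4 ≤ N * (1 / q) ^ 2 / 4 := by
    have : (q : ℝ) ^ 2 = q ^ 4 * (1 / q) ^ 2 := by field_simp
    rw [this]
    gcongr
  have h2 : x ≤ -(4 * q : ℝ) := by nlinarith
  calc Real.exp x ≤ Real.exp (-(4 * q : ℝ)) := Real.exp_le_exp.2 h2
    _ = 1 / Real.exp (4 * q) := by rw [Real.exp_neg, one_div]
    _ ≤ 1 / (4 * q) := by
      refine one_div_le_one_div_of_le (by positivity) ?_
      linarith [Real.add_one_le_exp (4 * q : ℝ)]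

theorem many_error_bound {δ W f f' φ : ℝ} (hδ : 0 < δ) (hδ1 : δ ≤ 1 / 16) (hW : 0 ≤ W)
    (hf : (1 - δ) * ((1 - 2 * δ) * W) - δ * W ≤ f) (hf' : (1 - δ) * f ≤ f') (hφ : φ ≤ δ) :
    (1 - 8 * δ) * W ≤ f' * (1 - φ) := by
  have e1 : (1 - 4 * δ) * W ≤ f := by
    have : 0 ≤ δ * δ * W := by positivity
    linarith
  have e2 : (1 - δ) * ((1 - 4 * δ) * W) ≤ f' :=
    (mul_le_mul_of_nonneg_left e1 (by linarith)).trans hf'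
  have e3 : 0 ≤ (1 - δ) * ((1 - 4 * δ) * W) :=
    mul_nonneg (by linarith) (mul_nonneg (by linarith) hW)
  have e4 : (1 - δ) * ((1 - 4 * δ) * W) * (1 - δ) ≤ f' * (1 - φ) :=
    mul_le_mul e2 (by linarith) (by linarith) (e3.trans e2)
  have e5 : 1 - 8 * δ ≤ (1 - δ) * (1 - 4 * δ) * (1 - δ) := by
    nlinarith [mul_nonneg (sq_nonneg δ) (by linarith : 0 ≤ 9 - 4 * δ)]
  have e6 := mul_le_mul_of_nonneg_right e5 hW
  linarith

set_option maxHeartbeats 1000000 in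
/-- Many positions and stages: a fixed set of applicants, offered in any order, is good enough. -/
theorem mul_bestVal_le_classVal_of_many (hp : ∀ i, 0 ≤ p i) (hp1 : ∀ i, p i ≤ 1)
    (hv : ∀ i, 0 ≤ v i) {M X : ℝ} {q t m κ : ℕ} (hM : ∀ i, p i * v i ≤ M)
    (hM0 : 0 < M) (hMW : M ≤ bestVal (fun i => p i * v i) p id m κ univ)
    (hq : 16 ≤ q) (ht : m ≤ 2 ^ t) (hκ : q ^ 4 ≤ κ) (hm : q ^ 4 ≤ m) :
    (1 - 8 / (q : ℝ)) * bestVal (fun i => p i * v i) p id m κ univ ≤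
      classVal p v (fun i => classOf M X (1 - 1 / (q : ℝ)) (q * (t + q)) (q ^ 3 + 2) (p i)
        (v i)) (q * (t + q) * (q ^ 3 + 2)) m m κ univ := by
  set W := bestVal (fun i => p i * v i) p id m κ univ with hW
  set β := 1 - 1 / (q : ℝ) with hβ
  set L := q * (t + q) with hL
  set V := q ^ 3 + 2 with hV
  set cls := fun i => classOf M X β L V (p i) (v i) with hcls
  have hq16 : (16 : ℝ) ≤ q := by exact_mod_cast hq
  have hq0 : (0 : ℝ) < q := by linarith
  have hδ0 : 0 < 1 / (q : ℝ) := by positivity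
  have hδ1 : 1 / (q : ℝ) ≤ 1 / 16 := one_div_le_one_div_of_le (by norm_num) hq16
  have h8 : 8 / (q : ℝ) = 8 * (1 / q) := by ring
  have hN := fun {N : ℕ} (h : q ^ 4 ≤ N) {x : ℝ} => exp_neg_le (x := x) hq h
  have hinv : 1 / (4 * q : ℝ) = 1 / q / 4 := by field_simp
  rw [h8]
  simp only [hinv] at hN
  set δ := 1 / (q : ℝ) with hδ
  have hβ0 : 0 < β := by rw [hβ]; linarith
  have hβ1 : β ≤ 1 := by rw [hβ]; linarith
  have hMβ : 0 ≤ M * β := by positivity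
  have hV1 : 1 ≤ V := by omega
  have hw : ∀ i, 0 ≤ p i * v i := fun i => mul_nonneg (hp i) (hv i)
  have hW0 : 0 < W := hM0.trans_le hMW
  let a : Fin n → ℕ := fun i => level (M * β) β L (p i * v i)
  have hab : ∀ i j, cls i = cls j → a i = a j := fun i j h => (levels_eq_of_classOf_eq hV1 h).1
  have hclsD : ∀ i, cls i < L * V ↔ a i < L := fun i => classOf_lt_iff hV1
  have ha_le : ∀ i, p i * v i ≤ M * β ^ a i := by
    intro i
    rcases Nat.eq_zero_or_pos (a i) with h | h
    · rw [h, pow_zero, mul_one]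
      exact hM i
    · have := le_threshold hMβ hβ0.le hβ1 (show a i - 1 < a i by omega)
      rwa [mul_assoc, ← pow_succ', Nat.sub_add_cancel h] at this
  have ha_lt : ∀ i, a i < L → M * β ^ (a i + 1) < p i * v i := by
    intro i h
    have := threshold_lt hMβ hβ0.le hβ1 h
    rwa [mul_assoc, ← pow_succ'] at this
  have hm0 : (0 : ℝ) ≤ m := Nat.cast_nonneg m
  have hκ0 : (0 : ℝ) ≤ κ := Nat.cast_nonneg κ
  -- Choice of the parameter of the exponential weights.
  set θ := δ / 2 with hθ
  have hθ0 : 0 < θ := by positivity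
  have hθ1 : θ ≤ 1 := by rw [hθ]; linarith
  have hexp := exp_sub_one_le hθ0.le hθ1
  have hexp0 : 0 ≤ Real.exp θ - 1 := by linarith [Real.one_le_exp hθ0.le]
  have hexp2 : Real.exp θ ≤ 2 := by nlinarith
  obtain ⟨x, hx0, hx1, hxm, hxκ, hxW⟩ := exists_offer_probabilities (p := p) (v := v) hp hp1 m κ univ
  have h2δ : 0 ≤ 1 - 2 * δ := by linarith
  obtain ⟨S, -, hS⟩ := exists_rounding (θ := θ) (w := fun i => p i * v i)
    (y := fun i => (1 - 2 * δ) * x i) hθ0.le hp hp1 hw (fun i => mul_nonneg h2δ (hx0 i))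
    (fun i => by nlinarith [hx0 i, hx1 i]) univ 0 (Real.exp (-(θ * m)))
    (Real.exp (-(θ * ((1 - δ) * κ)))) le_rfl (Real.exp_pos _).le (Real.exp_pos _).le
  simp only [zero_add, ← Real.exp_add] at hS
  have pull : ∀ f : Fin n → ℝ, ∑ i, f i * ((1 - 2 * δ) * x i) = (1 - 2 * δ) * ∑ i, f i * x i := by
    intro f
    rw [Finset.mul_sum]
    exact Finset.sum_congr rfl fun i _ => by ring
  have pull1 : ∑ i, (1 - 2 * δ) * x i = (1 - 2 * δ) * ∑ i, x i := by rw [Finset.mul_sum]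
  rw [pull p, pull fun i => p i * v i, pull1] at hS
  have hexpo : ∀ N y a b : ℝ, 0 ≤ N → y ≤ N → 0 ≤ a → a + δ ≤ b → b ≤ 1 →
      -(θ * ((1 - a) * N)) + (Real.exp θ - 1) * ((1 - b) * y) ≤ -(N * δ ^ 2 / 4) := by
    intro N y a b hN0 hy ha hab hb
    have hb0 : 0 ≤ 1 - b := by linarith
    have e1 : (Real.exp θ - 1) * ((1 - b) * y) ≤ (Real.exp θ - 1) * ((1 - b) * N) := by gcongr
    have e2 : (Real.exp θ - 1) * ((1 - b) * N) ≤ θ * (1 + θ) * ((1 - b) * N) := by gcongr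
    have e3 : (1 + θ) * (1 - b) - (1 - a) ≤ -θ := by nlinarith
    have e4 := mul_le_mul_of_nonneg_left e3 (mul_nonneg hθ0.le hN0)
    have e5 : θ * N * -θ = -(N * δ ^ 2 / 4) := by rw [hθ]; ring
    linarith
  have b1 : Real.exp (-(θ * m) + (Real.exp θ - 1) * ((1 - 2 * δ) * ∑ i, x i)) ≤ δ / 4 := by
    refine hN hm ?_
    have := hexpo m (∑ i, x i) 0 (2 * δ) hm0 hxm le_rfl (by linarith) (by linarith)
    rwa [sub_zero, one_mul] at this
  have b2 : Real.exp (-(θ * ((1 - δ) * κ)) + (Real.exp θ - 1) *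
      ((1 - 2 * δ) * ∑ i, p i * x i)) ≤ δ / 4 :=
    hN hκ (hexpo κ _ δ (2 * δ) hκ0 hxκ hδ0.le (by linarith) (by linarith))
  set F := ∑ i, p i * v i * x i with hF
  have hF0 : 0 < F := hW0.trans_le hxW
  have hfS : 0 ≤ ∑ i ∈ S, p i * v i := Finset.sum_nonneg fun i _ => hw i
  have h12 : 0 < (1 - δ) * ((1 - 2 * δ) * F) :=
    mul_pos (by linarith) (mul_pos (by linarith) hF0)
  have hS1 : (1 - δ) * ((1 - 2 * δ) * F) ≤ (∑ i ∈ S, p i * v i) *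
      (1 - (Real.exp (-(θ * m) + θ * S.card) +
        Real.exp (-(θ * ((1 - δ) * κ)) + θ * ∑ i ∈ S, p i))) := by
    refine le_trans ?_ hS
    have e1 := mul_le_mul hexp2 (add_le_add b1 b2) (by positivity) (by norm_num)
    have e2 := mul_le_mul_of_nonneg_left e1 (mul_nonneg h2δ hF0.le)
    linarith
  have hφ1 := Real.exp_pos (-(θ * m) + θ * S.card)
  have hφ2 := Real.exp_pos (-(θ * ((1 - δ) * κ)) + θ * ∑ i ∈ S, p i)
  have hφ : 0 < 1 - (Real.exp (-(θ * m) + θ * S.card) +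
      Real.exp (-(θ * ((1 - δ) * κ)) + θ * ∑ i ∈ S, p i)) := by
    by_contra hn
    have := mul_nonpos_of_nonneg_of_nonpos hfS (not_lt.1 hn)
    linarith
  have hcard : S.card ≤ m := by
    have : -(θ * m) + θ * S.card < 0 := by
      rw [← Real.exp_lt_one_iff]
      linarith
    have h : (S.card : ℝ) < m := by
      by_contra hle
      have := mul_le_mul_of_nonneg_left (not_lt.1 hle) hθ0.le
      linarith
    exact_mod_cast h.le
  have hgS : ∑ i ∈ S, p i ≤ (1 - δ) * κ := by
    have : -(θ * ((1 - δ) * κ)) + θ * ∑ i ∈ S, p i < 0 := by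
      rw [← Real.exp_lt_one_iff]
      linarith
    by_contra hle
    have := mul_le_mul_of_nonneg_left (not_le.1 hle).le hθ0.le
    linarith
  have hfS1 : (1 - δ) * ((1 - 2 * δ) * W) ≤ ∑ i ∈ S, p i * v i := by
    have e1 : (1 - δ) * ((1 - 2 * δ) * W) ≤ (1 - δ) * ((1 - 2 * δ) * F) := by
      have : 0 ≤ 1 - δ := by linarith
      gcongr
    refine e1.trans (hS1.trans ?_)
    refine mul_le_of_le_one_right hfS ?_
    linarith
  -- Negligible applicants are dropped.
  classical
  have hsplit := Finset.sum_filter_add_sum_filter_not S (fun i => a i < L) (fun i => p i * v i)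
  have hdrop : ∑ i ∈ S.filter (fun i => ¬ a i < L), p i * v i ≤ δ * W := by
    have e0 : ∀ i ∈ S.filter (fun i => ¬ a i < L), p i * v i ≤ M * β ^ L := by
      intro i hi
      have haL : a i ≤ L := level_le
      have := ha_le i
      rwa [show a i = L from le_antisymm haL (not_lt.1 (Finset.mem_filter.1 hi).2)] at this
    have e1 := Finset.sum_le_card_nsmul _ _ _ e0
    rw [nsmul_eq_mul] at e1
    have e2 : ((S.filter fun i => ¬ a i < L).card : ℝ) ≤ m := by
      exact_mod_cast (Finset.card_filter_le _ _).trans hcard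
    have e3 : β ^ L ≤ (1 / 2) ^ (t + q) := one_sub_inv_pow_le (by omega) _
    have e4 : (m : ℝ) ≤ 2 ^ t := by exact_mod_cast ht
    have hq2 : (q : ℝ) ≤ 2 ^ q := by exact_mod_cast Nat.lt_two_pow_self.le
    have e5 : (m : ℝ) * β ^ L ≤ δ := by
      calc (m : ℝ) * β ^ L ≤ 2 ^ t * (1 / 2) ^ (t + q) := by gcongr
        _ = 1 / 2 ^ q := by rw [pow_add, ← mul_assoc, ← mul_pow, one_div_pow]; norm_num
        _ ≤ δ := one_div_le_one_div_of_le hq0 hq2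
    calc _ ≤ _ := e1
      _ ≤ m * (M * β ^ L) := by gcongr
      _ = m * β ^ L * M := by ring
      _ ≤ δ * M := mul_le_mul_of_nonneg_right e5 hM0.le
      _ ≤ δ * W := mul_le_mul_of_nonneg_left hMW hδ0.le
  -- Earlier members of the classes are preferred.
  obtain ⟨S', hk, hc', hu', hp', hd'⟩ := exists_down_closed (cls := cls) (rank := rankIn cls p)
    (kept := fun i => a i < L) (p := p) (u := fun i => M * β ^ (a i + 1))
    (fun i j hc hr => le_of_rankIn_le hc hr) (fun i j hc => by simp only [hab i j hc])
    (fun i j hc hi => by rw [← hab i j hc]; exact hi) (S.filter fun i => a i < L)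
    (fun i hi => (Finset.mem_filter.1 hi).2)
  have hc'm : S'.card ≤ m := hc'.trans_le ((Finset.card_filter_le _ _).trans hcard)
  have hg' : ∑ i ∈ S', p i ≤ (1 - δ) * κ :=
    hp'.trans ((Finset.sum_le_sum_of_subset_of_nonneg (Finset.filter_subset _ _)
      fun i _ _ => hp i).trans hgS)
  have hf' : β * ∑ i ∈ S.filter (fun i => a i < L), p i * v i ≤ ∑ i ∈ S', p i * v i := by
    calc β * ∑ i ∈ S.filter (fun i => a i < L), p i * v i
        ≤ ∑ i ∈ S.filter (fun i => a i < L), M * β ^ (a i + 1) := by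
          rw [Finset.mul_sum]
          refine Finset.sum_le_sum fun i _ => ?_
          rw [pow_succ]
          nlinarith [ha_le i]
      _ = ∑ i ∈ S', M * β ^ (a i + 1) := hu'.symm
      _ ≤ ∑ i ∈ S', p i * v i := Finset.sum_le_sum fun i hi => (ha_lt i (hk i hi)).le
  have hlist := sum_mul_le_bestVal_heads (p := p) (v := v) (cls := cls) (rank := rankIn cls p)
    (kept := fun i => cls i < L * V ∧ rankIn cls p i < m) hp hp1 hv hθ0.le m κ univ S'
    (Finset.subset_univ S')
    (fun i hi => ⟨(hclsD i).2 (hk i hi),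
      (rankIn_lt_card hi fun j hj hr => hd' i hi j hj hr).trans_le hc'm⟩)
    (fun i hi j _ hj hr => hd' i hi j hj hr) hc'm
  refine le_trans ?_ hlist
  have b3 : Real.exp ((Real.exp θ - 1) * ∑ i ∈ S', p i - θ * κ) ≤ δ / 4 := by
    refine hN hκ ?_
    have := hexpo κ κ 0 δ hκ0 le_rfl le_rfl (by linarith) (by linarith)
    rw [sub_zero, one_mul] at this
    have e := mul_le_mul_of_nonneg_left hg' hexp0
    linarith
  refine many_error_bound hδ0 hδ1 hW0.le (f := ∑ i ∈ S.filter (fun i => a i < L), p i * v i) ?_ hf' ?_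
  · linarith
  · linarith

/-- For one of the guesses `M 2 ^ g` of the optimal value, the best class-ordered policy is nearly
optimal. -/
theorem exists_guess (hp : ∀ i, 0 ≤ p i) (hp1 : ∀ i, p i ≤ 1) (hv : ∀ i, 0 ≤ v i) {M : ℝ}
    {q t m κ : ℕ} (hM : ∀ i, p i * v i ≤ M) (hM' : M = 0 ∨ ∃ i, p i * v i = M)
    (hM0 : 0 ≤ M) (hq : 16 ≤ q) (hm : 1 ≤ m) (hκm : κ ≤ m) (ht : m ≤ 2 ^ t) :
    ∃ g ≤ m, (1 - 8 / (q : ℝ)) * bestVal (fun i => p i * v i) p id m κ univ ≤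
      classVal p v (fun i => classOf M (M * q * 2 ^ g) (1 - 1 / (q : ℝ)) (q * (t + q)) (q ^ 3 + 2)
        (p i) (v i)) (q * (t + q) * (q ^ 3 + 2)) m m κ univ := by
  have hw : ∀ i, 0 ≤ p i * v i := fun i => mul_nonneg (hp i) (hv i)
  have hup := bestVal_le_mul_max hp hp1 hv hM hM0 m κ univ
  have hW0 := bestVal_nonneg (adm := id) hw hp hp1 m κ univ
  have hq0 : (0 : ℝ) < q := by
    have : 0 < q := by omega
    exact_mod_cast this
  set W := bestVal (fun i => p i * v i) p id m κ univ with hW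
  have htriv : W = 0 → ∃ g ≤ m, (1 - 8 / (q : ℝ)) * W ≤
      classVal p v (fun i => classOf M (M * q * 2 ^ g) (1 - 1 / (q : ℝ)) (q * (t + q)) (q ^ 3 + 2)
        (p i) (v i)) (q * (t + q) * (q ^ 3 + 2)) m m κ univ := by
    intro h
    refine ⟨0, Nat.zero_le m, ?_⟩
    rw [h, mul_zero]
    exact bestVal_nonneg hw hp hp1 _ _ _
  rcases Nat.eq_zero_or_pos κ with rfl | hκ
  · exact htriv (by rw [hW, bestVal_zero_positions])
  rcases hM0.eq_or_lt with h | hMpos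
  · refine htriv (le_antisymm ?_ hW0)
    rw [← h, mul_zero] at hup
    exact hup
  obtain ⟨i, hi⟩ := hM'.resolve_left hMpos.ne'
  have hMW : M ≤ W := by
    rw [← hi]
    exact le_bestVal_of_mem hp hp1 hv (adm := id) (Finset.mem_univ i) hm hκ
  have hlast : W ≤ M * 2 ^ (m + 1) := by
    have h2 : (m : ℝ) ≤ 2 ^ (m + 1) := by exact_mod_cast (Nat.lt_two_pow_self.le.trans
      (Nat.pow_le_pow_right (by norm_num) (Nat.le_succ m)))
    nlinarith
  -- The guess is the largest power of two times `M` that does not exceed the optimal value.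
  classical
  have hex : ∃ g, W ≤ M * 2 ^ (g + 1) := ⟨m, hlast⟩
  have hg2 := Nat.find_spec hex
  have hgm : Nat.find hex ≤ m := Nat.find_min' hex hlast
  set g := Nat.find hex with hg
  have hg1 : M * 2 ^ g ≤ W := by
    rcases Nat.eq_zero_or_pos g with h | h
    · rw [h, pow_zero, mul_one]
      exact hMW
    · have := Nat.find_min hex (m := g - 1) (by omega)
      push Not at this
      rw [Nat.sub_add_cancel h] at this
      exact this.le
  refine ⟨g, hgm, ?_⟩
  have h1g : (1 : ℝ) ≤ 2 ^ g := one_le_pow₀ (by norm_num)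
  by_cases hκq : κ < q ^ 4
  · rw [show M * q * 2 ^ g = M * 2 ^ g * q by ring]
    refine mul_bestVal_le_classVal_of_few hp hp1 hv hM ?_ hMpos hq ht hκ hκq hg1 ?_
    · nlinarith
    · rw [pow_succ] at hg2
      linarith
  · exact mul_bestVal_le_classVal_of_many hp hp1 hv hM hMpos hMW hq ht (by omega)
      (by omega)

end regimes

/-! ### Reasoning about programs -/

/-- Started in memory `s`, the program `P` halts after at most `B` steps in a memory with
property `Q`. -/
def Prog.Ensures (P : Prog) (s : Mem) (B : ℕ) (Q : Mem → Prop) : Prop :=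
  ∃ c s', Exec P s c s' ∧ c ≤ B ∧ Q s'

/-- The names of the arrays of natural numbers that a program writes to. -/
def Prog.natTargets : Prog → List ℕ
  | skip => []
  | setN a _ _ => [a]
  | setR _ _ _ => []
  | seq P Q => P.natTargets ++ Q.natTargets
  | ite _ P Q => P.natTargets ++ Q.natTargets
  | loop _ P => P.natTargets

/-- The names of the arrays of real numbers that a program writes to. -/
def Prog.realTargets : Prog → List ℕ
  | skip => []
  | setN _ _ _ => []
  | setR a _ _ => [a]
  | seq P Q => P.realTargets ++ Q.realTargets
  | ite _ P Q => P.realTargets ++ Q.realTargets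
  | loop _ P => P.realTargets

section mem

variable (s : Mem) (a j w : ℕ) (x : ℝ)

theorem Mem.putN_nat (a' j' : ℕ) :
    (s.putN a j w).nat a' j' = if a' = a ∧ j' = j then w else s.nat a' j' := by
  unfold Mem.putN
  by_cases h : a' = a
  · subst h
    by_cases h2 : j' = j
    · subst h2
      simp
    · simp [h2]
  · simp [h]

theorem Mem.putR_real (a' j' : ℕ) :
    (s.putR a j x).real a' j' = if a' = a ∧ j' = j then x else s.real a' j' := by
  unfold Mem.putR
  by_cases h : a' = a
  · subst h
    by_cases h2 : j' = j
    · subst h2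
      simp
    · simp [h2]
  · simp [h]

theorem Mem.putN_real : (s.putN a j w).real = s.real := rfl

theorem Mem.putR_nat : (s.putR a j x).nat = s.nat := rfl

theorem Mem.putN_nat_of_ne {a a' : ℕ} (h : a' ≠ a) : (s.putN a j w).nat a' = s.nat a' := by
  simp [Mem.putN, h]

theorem Mem.putR_real_of_ne {a a' : ℕ} (h : a' ≠ a) : (s.putR a j x).real a' = s.real a' := by
  simp [Mem.putR, h]

end mem

/-- The memories `s` and `s'` agree on all arrays that are not listed. -/
def Mem.AgreeOff (l r : List ℕ) (s s' : Mem) : Prop :=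
  (∀ a, a ∉ l → s'.nat a = s.nat a) ∧ (∀ a, a ∉ r → s'.real a = s.real a)

theorem Mem.AgreeOff.refl (l r : List ℕ) (s : Mem) : Mem.AgreeOff l r s s :=
  ⟨fun _ _ => rfl, fun _ _ => rfl⟩

theorem Mem.AgreeOff.trans {l r : List ℕ} {s s' s'' : Mem} (h : Mem.AgreeOff l r s s')
    (h' : Mem.AgreeOff l r s' s'') : Mem.AgreeOff l r s s'' :=
  ⟨fun a ha => (h'.1 a ha).trans (h.1 a ha), fun a ha => (h'.2 a ha).trans (h.2 a ha)⟩

theorem Mem.AgreeOff.mono {l l' r r' : List ℕ} {s s' : Mem} (h : Mem.AgreeOff l r s s')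
    (hl : l ⊆ l') (hr : r ⊆ r') : Mem.AgreeOff l' r' s s' :=
  ⟨fun a ha => h.1 a fun h => ha (hl h), fun a ha => h.2 a fun h => ha (hr h)⟩

theorem Exec.agreeOff {P : Prog} {s s' : Mem} {c : ℕ} (h : Exec P s c s') :
    Mem.AgreeOff P.natTargets P.realTargets s s' := by
  induction h with
  | skip => exact Mem.AgreeOff.refl _ _ _
  | setN s a j e =>
    refine ⟨fun b hb => Mem.putN_nat_of_ne _ _ _ (by simpa [Prog.natTargets] using hb),
      fun b hb => rfl⟩
  | setR s a j e =>
    refine ⟨fun b hb => rfl,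
      fun b hb => Mem.putR_real_of_ne _ _ _ (by simpa [Prog.realTargets] using hb)⟩
  | seq _ _ ih1 ih2 =>
    exact (ih1.mono (List.subset_append_left _ _) (List.subset_append_left _ _)).trans
      (ih2.mono (List.subset_append_right _ _) (List.subset_append_right _ _))
  | ite_pos _ _ ih =>
    exact ih.mono (List.subset_append_left _ _) (List.subset_append_left _ _)
  | ite_neg _ _ ih =>
    exact ih.mono (List.subset_append_right _ _) (List.subset_append_right _ _)
  | loop_done _ => exact Mem.AgreeOff.refl _ _ _
  | loop_step _ _ _ ih1 ih2 => exact Mem.AgreeOff.trans ih1 ih2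

namespace Prog.Ensures

variable {P P' : Prog} {s : Mem} {B B' : ℕ} {Q Q' : Mem → Prop}

theorem mono (h : P.Ensures s B Q) (hB : B ≤ B') (hQ : ∀ s', Q s' → Q' s') :
    P.Ensures s B' Q' := by
  obtain ⟨c, s', he, hc, hq⟩ := h
  exact ⟨c, s', he, hc.trans hB, hQ s' hq⟩

theorem mono_bound (h : P.Ensures s B Q) (hB : B ≤ B') : P.Ensures s B' Q :=
  h.mono hB fun _ h => h

/-- A program leaves the arrays alone that it does not write to. -/
theorem frame (h : P.Ensures s B Q) :
    P.Ensures s B fun s' => Q s' ∧ Mem.AgreeOff P.natTargets P.realTargets s s' := by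
  obtain ⟨c, s', he, hc, hq⟩ := h
  exact ⟨c, s', he, hc, hq, he.agreeOff⟩

theorem skip (h : Q s) : Prog.skip.Ensures s 1 Q := ⟨1, s, Exec.skip s, le_rfl, h⟩

theorem setN {a : ℕ} {j e : NExp} (h : Q (s.putN a (j.eval s) (e.eval s)))
    (hB : j.cost + e.cost + 1 ≤ B) : (Prog.setN a j e).Ensures s B Q :=
  ⟨_, _, Exec.setN s a j e, hB, h⟩

theorem setR {a : ℕ} {j : NExp} {e : RExp} (h : Q (s.putR a (j.eval s) (e.eval s)))
    (hB : j.cost + e.cost + 1 ≤ B) : (Prog.setR a j e).Ensures s B Q :=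
  ⟨_, _, Exec.setR s a j e, hB, h⟩

theorem seq (h : P.Ensures s B fun s' => P'.Ensures s' B' Q) :
    (Prog.seq P P').Ensures s (B + B') Q := by
  obtain ⟨c, s', he, hc, c', s'', he', hc', hq⟩ := h
  exact ⟨c + c', s'', Exec.seq he he', by omega, hq⟩

theorem ite {b : Test} (h1 : b.holds s → P.Ensures s B Q) (h2 : ¬ b.holds s → P'.Ensures s B Q) :
    (Prog.ite b P P').Ensures s (b.cost + B) Q := by
  by_cases hb : b.holds s
  · obtain ⟨c, s', he, hc, hq⟩ := h1 hb
    exact ⟨_, s', Exec.ite_pos hb he, by omega, hq⟩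
  · obtain ⟨c, s', he, hc, hq⟩ := h2 hb
    exact ⟨_, s', Exec.ite_neg hb he, by omega, hq⟩

/-- A loop that is left after exactly `N` rounds. -/
theorem loop {b : Test} {N : ℕ} (Inv : ℕ → Mem → Prop) (h0 : Inv 0 s)
    (step : ∀ j < N, ∀ s', Inv j s' → b.holds s' ∧ P.Ensures s' B (Inv (j + 1)))
    (last : ∀ s', Inv N s' → ¬ b.holds s') :
    (Prog.loop b P).Ensures s (N * (b.cost + B) + b.cost) (Inv N) := by
  have key : ∀ r j s, j + r = N → Inv j s →
      (Prog.loop b P).Ensures s (r * (b.cost + B) + b.cost) (Inv N) := by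
    intro r
    induction r with
    | zero =>
      intro j s hj hs
      obtain rfl : j = N := by omega
      exact ⟨_, s, Exec.loop_done (last s hs), by omega, hs⟩
    | succ r ih =>
      intro j s hj hs
      obtain ⟨hb, c, s', he, hc, hs'⟩ := step j (by omega) s hs
      obtain ⟨c', s'', he', hc', hs''⟩ := ih (j + 1) s' (by omega) hs'
      refine ⟨_, s'', Exec.loop_step hb he he', ?_, hs''⟩
      have : (r + 1) * (b.cost + B) = r * (b.cost + B) + (b.cost + B) := by ring
      omega
  exact key N 0 s (by omega) h0

theorem seq_of {B₁ B₂ : ℕ} {Q₁ : Mem → Prop} (h : P.Ensures s B₁ Q₁) (hB : B₁ + B₂ ≤ B)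
    (h' : ∀ s', Mem.AgreeOff P.natTargets P.realTargets s s' → Q₁ s' → P'.Ensures s' B₂ Q) :
    (Prog.seq P P').Ensures s B Q :=
  (seq (h.frame.mono le_rfl fun s' hs' => h' s' hs'.2 hs'.1)).mono_bound hB

theorem setN_seq {a : ℕ} {j e : NExp} {B₂ : ℕ} (hB : j.cost + e.cost + 1 + B₂ ≤ B)
    (h : P.Ensures (s.putN a (j.eval s) (e.eval s)) B₂ Q) :
    (Prog.seq (Prog.setN a j e) P).Ensures s B Q :=
  (seq (setN (Q := fun s' => P.Ensures s' B₂ Q) h le_rfl)).mono_bound hB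

theorem setR_seq {a : ℕ} {j : NExp} {e : RExp} {B₂ : ℕ} (hB : j.cost + e.cost + 1 + B₂ ≤ B)
    (h : P.Ensures (s.putR a (j.eval s) (e.eval s)) B₂ Q) :
    (Prog.seq (Prog.setR a j e) P).Ensures s B Q :=
  (seq (setR (Q := fun s' => P.Ensures s' B₂ Q) h le_rfl)).mono_bound hB

theorem ite_of {b : Test} {B₁ : ℕ} (hB : b.cost + B₁ ≤ B) (h1 : b.holds s → P.Ensures s B₁ Q)
    (h2 : ¬ b.holds s → P'.Ensures s B₁ Q) : (Prog.ite b P P').Ensures s B Q :=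
  (ite h1 h2).mono_bound hB

end Prog.Ensures

/-- The scalar variable that is stored at entry `0` of the array `a` of natural numbers. -/
def NExp.var (a : ℕ) : NExp := NExp.get a (NExp.const 0)

/-- The scalar variable that is stored at entry `0` of the array `a` of real numbers. -/
def RExp.var (a : ℕ) : RExp := RExp.get a (NExp.const 0)

/-- Assignment to a scalar variable. -/
def Prog.letN (a : ℕ) (e : NExp) : Prog := Prog.setN a (NExp.const 0) e

/-- Assignment to a scalar variable. -/
def Prog.letR (a : ℕ) (e : RExp) : Prog := Prog.setR a (NExp.const 0) e

/-- Run `P` for the values `0, 1, …` of the scalar variable `i` that are less than the value of the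
scalar variable `b`. -/
def Prog.forLoop (i b : ℕ) (P : Prog) : Prog :=
  Prog.seq (Prog.letN i (NExp.const 0))
    (Prog.loop (Test.neg (Test.leN (NExp.var b) (NExp.var i)))
      (Prog.seq P (Prog.letN i (NExp.add (NExp.var i) (NExp.const 1)))))

theorem Prog.Ensures.forLoop {i b : ℕ} {P : Prog} {s : Mem} {N B : ℕ} (Inv : ℕ → Mem → Prop)
    (hi : i ∉ P.natTargets) (hb : b ∉ i :: P.natTargets) (hN : s.nat b 0 = N)
    (h0 : Inv 0 (s.putN i 0 0))
    (step : ∀ j < N, ∀ s', Mem.AgreeOff (i :: P.natTargets) P.realTargets s s' → s'.nat i 0 = j →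
      Inv j s' → P.Ensures s' B fun s'' => Inv (j + 1) (s''.putN i 0 (j + 1))) :
    (Prog.forLoop i b P).Ensures s (N * (B + 12) + 12) fun s' => Inv N s' := by
  have hbi : b ≠ i := fun h => hb (by simp [h])
  have hbP : b ∉ P.natTargets := fun h => hb (by simp [h])
  have e0 : (Prog.letN i (NExp.const 0)).Ensures s 3 fun s' => s' = s.putN i 0 0 :=
    Prog.Ensures.setN rfl le_rfl
  have agree0 : Mem.AgreeOff (i :: P.natTargets) P.realTargets s (s.putN i 0 0) :=
    ⟨fun a ha => Mem.putN_nat_of_ne _ _ _ fun h => ha (by simp [h]), fun a _ => rfl⟩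
  refine Prog.Ensures.mono_bound (Prog.Ensures.seq (B' := N * (6 + (B + 6)) + 6) (e0.mono le_rfl ?_))
    (by nlinarith)
  rintro _ rfl
  refine Prog.Ensures.mono (Prog.Ensures.loop (N := N) (B := B + 6)
    (fun j s' => Mem.AgreeOff (i :: P.natTargets) P.realTargets s s' ∧ s'.nat i 0 = j ∧ Inv j s')
    ⟨agree0, by simp [Mem.putN_nat], h0⟩ ?_ ?_) le_rfl fun s' h => h.2.2
  · rintro j hj s' ⟨hag, hij, hinv⟩
    refine ⟨?_, ?_⟩
    · simp only [Test.holds, NExp.var, NExp.eval, hag.1 b hb, hN, hij]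
      omega
    · refine Prog.Ensures.seq ((step j hj s' hag hij hinv).frame.mono le_rfl ?_)
      rintro s'' ⟨hinv', hag'⟩
      have hij' : s''.nat i 0 = j := by rw [hag'.1 i hi, hij]
      refine Prog.Ensures.setN ?_ le_rfl
      simp only [NExp.var, NExp.eval, hij']
      refine ⟨hag.trans (Mem.AgreeOff.trans (hag'.mono (by simp) (by simp)) ⟨fun a ha => ?_,
        fun a _ => rfl⟩), by simp [Mem.putN_nat], hinv'⟩
      exact Mem.putN_nat_of_ne _ _ _ fun h => ha (by simp [h])
  · rintro s' ⟨hag, hij, -⟩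
    simp only [Test.holds, NExp.var, NExp.eval, hag.1 b hb, hN, hij]
    omega

/-- Multiplication of natural numbers by repeated addition: `dst := x * y`, with the counter `i`. -/
def Prog.mulN (dst i x y : ℕ) : Prog :=
  Prog.seq (Prog.letN dst (NExp.const 0))
    (Prog.forLoop i y (Prog.letN dst (NExp.add (NExp.var dst) (NExp.var x))))

theorem Prog.Ensures.mulN {dst i x y : ℕ} {s : Mem} (h1 : dst ≠ i) (h2 : x ≠ dst) (h3 : x ≠ i)
    (h4 : y ≠ dst) (h5 : y ≠ i) :
    (Prog.mulN dst i x y).Ensures s (s.nat y 0 * 20 + 20) fun s' =>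
      s'.nat dst 0 = s.nat x 0 * s.nat y 0 := by
  refine Prog.Ensures.mono_bound (Prog.Ensures.seq (B := 3) (B' := s.nat y 0 * (8 + 12) + 12)
    (Prog.Ensures.setN ?_ le_rfl)) (by omega)
  refine Prog.Ensures.forLoop (fun j s' => s'.nat dst 0 = s.nat x 0 * j)
    (by simpa [Prog.natTargets, Prog.letN] using h1.symm)
    (by simp [Prog.natTargets, Prog.letN, h4, h5]) ?_ ?_ ?_
  · simp [NExp.eval, Mem.putN_nat, h4]
  · simp [NExp.eval, Mem.putN_nat, h1]
  · intro j _ s' hag _ hinv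
    have hx : s'.nat x 0 = s.nat x 0 := by
      rw [hag.1 x (by simp [Prog.natTargets, Prog.letN, h2, h3])]
      simp [NExp.eval, Mem.putN_nat, h2]
    refine Prog.Ensures.setN ?_ (by simp [NExp.cost, NExp.var])
    simp [NExp.eval, NExp.var, Mem.putN_nat, hinv, hx, h1, mul_add]

/-! ### The program -/

-- The names of the arrays of natural numbers; those up to `nRej` are fixed by the input and the
-- output.
local notation "nN" => (0 : ℕ)
local notation "nK" => (1 : ℕ)
local notation "nT" => (2 : ℕ)
local notation "nRoot" => (3 : ℕ)
local notation "nApp" => (4 : ℕ)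
local notation "nAcc" => (5 : ℕ)
local notation "nRej" => (6 : ℕ)
local notation "nM" => (7 : ℕ)
local notation "nR" => (8 : ℕ)
local notation "nQ" => (9 : ℕ)
local notation "nLog" => (10 : ℕ)
local notation "nPow" => (11 : ℕ)
local notation "nL" => (12 : ℕ)
local notation "nV" => (13 : ℕ)
local notation "nD" => (14 : ℕ)
local notation "nC" => (15 : ℕ)
local notation "nStr" => (16 : ℕ)
local notation "nDtwo" => (17 : ℕ)
local notation "nSize" => (18 : ℕ)
local notation "nKcap" => (19 : ℕ)
local notation "nI" => (20 : ℕ)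
local notation "nJ" => (21 : ℕ)
local notation "nCls" => (22 : ℕ)
local notation "nTab" => (23 : ℕ)
local notation "nRet" => (24 : ℕ)
local notation "nRank" => (25 : ℕ)
local notation "nAddr" => (26 : ℕ)
local notation "nCnt" => (27 : ℕ)
local notation "nDig" => (28 : ℕ)
local notation "nCtr" => (29 : ℕ)
local notation "nU" => (30 : ℕ)
local notation "nG" => (31 : ℕ)
local notation "nVone" => (32 : ℕ)
local notation "nS" => (33 : ℕ)
local notation "nUrej" => (34 : ℕ)
local notation "nDR" => (35 : ℕ)
local notation "nTmp" => (36 : ℕ)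
local notation "nDone" => (37 : ℕ)
local notation "nX" => (38 : ℕ)
local notation "nOne" => (39 : ℕ)

-- The names of the arrays of real numbers; those up to `rEps` are fixed by the input.
local notation "rV" => (0 : ℕ)
local notation "rP" => (1 : ℕ)
local notation "rEps" => (2 : ℕ)
local notation "rM" => (3 : ℕ)
local notation "rBeta" => (4 : ℕ)
local notation "rX" => (5 : ℕ)
local notation "rBest" => (6 : ℕ)
local notation "rBestX" => (7 : ℕ)
local notation "rThr" => (8 : ℕ)
local notation "rZ" => (9 : ℕ)
local notation "rVal" => (10 : ℕ)
local notation "rW" => (11 : ℕ)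

open Prog in
/-- Adds to `dst`, for each of the thresholds `rThr * β ^ s` with `s` less than `len` that is at
least `rW`, the number `inc`. -/
def countLevels (dst inc len : ℕ) : Prog :=
  forLoop nS len
    (seq
      (ite (Test.leR (RExp.var rW) (RExp.var rThr))
        (letN dst (NExp.add (NExp.var dst) (NExp.var inc))) skip)
      (letR rThr (RExp.mul (RExp.var rThr) (RExp.var rBeta))))

open Prog in
/-- Computes the classes of all applicants. -/
def classify : Prog :=
  forLoop nI nN
    (seq (letN nTmp (NExp.const 0))
    (seq (letR rThr (RExp.mul (RExp.var rM) (RExp.var rBeta)))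
    (seq (letR rW (RExp.mul (RExp.get rP (NExp.var nI)) (RExp.get rV (NExp.var nI))))
    (seq (countLevels nTmp nV nL)
    (seq (letR rThr (RExp.var rX))
    (seq (letR rW (RExp.get rV (NExp.var nI)))
    (seq (countLevels nTmp nOne nVone)
      (setN nCls (NExp.var nI) (NExp.var nTmp)))))))))

open Prog in
/-- Computes in `nRank` the rank of the applicant `nI`. -/
def computeRank : Prog :=
  seq (letN nRank (NExp.const 0))
    (forLoop nJ nN
      (ite (Test.leN (NExp.get nCls (NExp.var nJ)) (NExp.get nCls (NExp.var nI)))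
        (ite (Test.leN (NExp.get nCls (NExp.var nI)) (NExp.get nCls (NExp.var nJ)))
          (ite (Test.leR (RExp.get rP (NExp.var nI)) (RExp.get rP (NExp.var nJ)))
            (ite (Test.leR (RExp.get rP (NExp.var nJ)) (RExp.get rP (NExp.var nI)))
              (ite (Test.leN (NExp.var nI) (NExp.var nJ)) skip
                (letN nRank (NExp.add (NExp.var nRank) (NExp.const 1))))
              skip)
            (letN nRank (NExp.add (NExp.var nRank) (NExp.const 1))))
          skip)
        skip))

open Prog in
/-- Enters the retained applicants into the table: entry `j R + e` names, plus one, the member of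
the class `j` that is the next one to receive an offer when the digit of `j` is `e`. -/
def fillTable : Prog :=
  forLoop nI nN
    (seq (setN nRet (NExp.var nI) (NExp.const 0))
    (seq computeRank
    (seq (letN nTmp (NExp.get nCls (NExp.var nI)))
      (ite (Test.leN (NExp.var nD) (NExp.var nTmp)) skip
        (ite (Test.leN (NExp.var nM) (NExp.var nRank)) skip
          (seq (letN nAddr (NExp.sub (NExp.var nM) (NExp.var nRank)))
          (seq (forLoop nS nTmp (letN nAddr (NExp.add (NExp.var nAddr) (NExp.var nR))))
          (seq (setN nTab (NExp.var nAddr) (NExp.add (NExp.var nI) (NExp.const 1)))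
            (setN nRet (NExp.var nI) (NExp.const 1))))))))))

open Prog in
/-- Appends to the diagram a chain of nodes that offers to all other applicants. -/
def writeChain : Prog :=
  seq (letN nCnt (NExp.var nSize))
    (forLoop nI nN
      (ite (Test.leN (NExp.get nRet (NExp.var nI)) (NExp.const 0))
        (seq (setN nApp (NExp.var nCnt) (NExp.var nI))
        (seq (setN nAcc (NExp.var nCnt) (NExp.add (NExp.var nCnt) (NExp.const 1)))
        (seq (setN nRej (NExp.var nCnt) (NExp.add (NExp.var nCnt) (NExp.const 1)))
          (letN nCnt (NExp.add (NExp.var nCnt) (NExp.const 1))))))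
        skip))

open Prog in
/-- Determines the best offer in the state `nU`, one class at a time. -/
def chooseOffer : Prog :=
  seq (letN nAddr (NExp.const 0))
    (forLoop nJ nD
      (seq (letN nX (NExp.get nTab (NExp.add (NExp.var nAddr)
          (NExp.get nDig (NExp.add (NExp.var nJ) (NExp.const 2))))))
      (seq
        (ite (Test.leN (NExp.var nX) (NExp.const 0)) skip
          (seq (letN nX (NExp.sub (NExp.var nX) (NExp.const 1)))
          (seq (letN nUrej (NExp.sub (NExp.sub (NExp.var nU)
              (NExp.get nStr (NExp.add (NExp.var nJ) (NExp.const 2)))) (NExp.var nR)))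
          (seq (letR rZ (RExp.add
              (RExp.mul (RExp.get rP (NExp.var nX)) (RExp.add (RExp.get rV (NExp.var nX))
                (RExp.get rVal (NExp.sub (NExp.var nUrej) (NExp.const 1)))))
              (RExp.mul (RExp.sub (RExp.ofNat (NExp.const 1)) (RExp.get rP (NExp.var nX)))
                (RExp.get rVal (NExp.var nUrej)))))
            (ite (Test.leR (RExp.get rVal (NExp.var nU)) (RExp.var rZ))
              (seq (setR rVal (NExp.var nU) (RExp.var rZ))
              (seq (setN nApp (NExp.var nU) (NExp.var nX))
              (seq (setN nAcc (NExp.var nU) (NExp.sub (NExp.var nUrej) (NExp.const 1)))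
                (setN nRej (NExp.var nU) (NExp.var nUrej)))))
              skip)))))
        (letN nAddr (NExp.add (NExp.var nAddr) (NExp.var nR))))))

open Prog in
/-- Adds one to the number whose digits are kept in `nDig`; `nCtr` keeps its remainders. -/
def countUp : Prog :=
  forLoop nJ nDtwo
    (seq (setN nCtr (NExp.var nJ) (NExp.add (NExp.get nCtr (NExp.var nJ)) (NExp.const 1)))
      (ite (Test.leN (NExp.get nStr (NExp.var nJ)) (NExp.get nCtr (NExp.var nJ)))
        (seq (setN nCtr (NExp.var nJ) (NExp.const 0))
        (seq (setN nDig (NExp.var nJ) (NExp.add (NExp.get nDig (NExp.var nJ)) (NExp.const 1)))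
          (ite (Test.leN (NExp.var nR) (NExp.get nDig (NExp.var nJ)))
            (setN nDig (NExp.var nJ) (NExp.const 0)) skip)))
        skip))

open Prog in
/-- The dynamic program over all states, in order of increasing numbers. -/
def solveStates : Prog :=
  seq
    (forLoop nJ nDtwo
      (seq (setN nDig (NExp.var nJ) (NExp.const 0)) (setN nCtr (NExp.var nJ) (NExp.const 0))))
    (forLoop nU nSize
      (seq (setR rVal (NExp.var nU) (RExp.ofNat (NExp.const 0)))
      (seq (setN nApp (NExp.var nU) (NExp.get nApp (NExp.var nSize)))
      (seq (setN nAcc (NExp.var nU) (NExp.add (NExp.var nSize) (NExp.const 1)))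
      (seq (setN nRej (NExp.var nU) (NExp.add (NExp.var nSize) (NExp.const 1)))
      (seq
        (ite (Test.leN (NExp.get nDig (NExp.const 0)) (NExp.const 0)) skip
          (ite (Test.leN (NExp.get nDig (NExp.const 1)) (NExp.const 0)) skip chooseOffer))
        countUp))))))

open Prog in
/-- Computes the diagram for the threshold `rX` of the levels of values. -/
def solve : Prog :=
  seq classify
  (seq (forLoop nJ nDR (setN nTab (NExp.var nJ) (NExp.const 0)))
  (seq fillTable
  (seq writeChain
    solveStates)))

open Prog in
/-- Computes the largest expected reward of a single offer. -/
def computeMax : Prog :=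
  seq (letR rM (RExp.ofNat (NExp.const 0)))
    (forLoop nI nN
      (ite (Test.leR (RExp.var rM)
          (RExp.mul (RExp.get rP (NExp.var nI)) (RExp.get rV (NExp.var nI))))
        (letR rM (RExp.mul (RExp.get rP (NExp.var nI)) (RExp.get rV (NExp.var nI))))
        skip))

open Prog in
/-- The parameters in the trivial cases of a single stage or of `ε ≥ 1`. -/
def trivialParams : Prog :=
  seq (letR rBeta (RExp.sub (RExp.ofNat (NExp.const 1)) (RExp.var rEps)))
  (seq (letN nL (NExp.const 1))
  (seq (letN nV (NExp.const 1))
    (letR rX (RExp.ofNat (NExp.const 0)))))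

open Prog in
/-- The numbers of levels of expected rewards and of values, their ratio, and the first guess. -/
def mainParams : Prog :=
  seq (letN nQ (NExp.const 0))
  (seq (loop (Test.neg (Test.leR (RExp.ofNat (NExp.const 16))
        (RExp.mul (RExp.ofNat (NExp.var nQ)) (RExp.var rEps))))
      (letN nQ (NExp.add (NExp.var nQ) (NExp.const 1))))
  (seq (letN nLog (NExp.const 0))
  (seq (letN nPow (NExp.const 1))
  (seq (loop (Test.neg (Test.leN (NExp.var nM) (NExp.var nPow)))
      (seq (letN nLog (NExp.add (NExp.var nLog) (NExp.const 1)))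
        (letN nPow (NExp.add (NExp.var nPow) (NExp.var nPow)))))
  (seq (letN nTmp (NExp.add (NExp.var nLog) (NExp.var nQ)))
  (seq (mulN nL nC nQ nTmp)
  (seq (mulN nTmp nC nQ nQ)
  (seq (mulN nV nC nTmp nQ)
  (seq (letN nV (NExp.add (NExp.var nV) (NExp.const 2)))
  (seq (letR rBeta (RExp.sub (RExp.ofNat (NExp.const 1))
      (RExp.div (RExp.ofNat (NExp.const 1)) (RExp.ofNat (NExp.var nQ)))))
    (letR rX (RExp.mul (RExp.var rM) (RExp.ofNat (NExp.var nQ))))))))))))))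

open Prog in
/-- The number of classes, the sizes of the tables, and the strides of the digits. -/
def computeSizes : Prog :=
  seq (letN nOne (NExp.const 1))
  (seq (letN nVone (NExp.sub (NExp.var nV) (NExp.const 1)))
  (seq (mulN nD nC nL nV)
  (seq (letN nDone (NExp.add (NExp.var nD) (NExp.const 1)))
  (seq (letN nDtwo (NExp.add (NExp.var nD) (NExp.const 2)))
  (seq (mulN nDR nC nD nR)
  (seq (setN nStr (NExp.const 0) (NExp.const 1))
  (seq
    (forLoop nJ nDtwo
      (seq (letN nTmp (NExp.get nStr (NExp.var nJ)))
      (seq (mulN nSize nC nTmp nR)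
        (setN nStr (NExp.add (NExp.var nJ) (NExp.const 1)) (NExp.var nSize)))))
  (seq (letN nSize (NExp.get nStr (NExp.var nDtwo)))
  (seq (letN nRoot (NExp.var nKcap))
    (forLoop nJ nDone
      (forLoop nS nM
        (letN nRoot (NExp.add (NExp.var nRoot)
          (NExp.get nStr (NExp.add (NExp.var nJ) (NExp.const 1))))))))))))))))

open Prog in
/-- Tries the guesses and remembers the best one. -/
def tryGuesses : Prog :=
  seq (letR rBest (RExp.ofNat (NExp.const 0)))
  (seq (letR rBestX (RExp.var rX))
    (forLoop nG nR
      (seq solve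
      (seq
        (ite (Test.leR (RExp.var rBest) (RExp.get rVal (NExp.var nRoot)))
          (seq (letR rBest (RExp.get rVal (NExp.var nRoot))) (letR rBestX (RExp.var rX)))
          skip)
        (letR rX (RExp.add (RExp.var rX) (RExp.var rX)))))))

open Prog in
/-- The approximation scheme: capped numbers of stages and positions, parameters, and the dynamic
program for every guess and once more for the best guess. -/
def hiringProgram : Prog :=
  seq (letN nM (NExp.sub (NExp.var nN) (NExp.sub (NExp.var nN) (NExp.var nT))))
  (seq (letN nR (NExp.add (NExp.var nM) (NExp.const 1)))
  (seq (letN nKcap (NExp.sub (NExp.var nM) (NExp.sub (NExp.var nM) (NExp.var nK))))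
  (seq computeMax
  (seq
    (ite (Test.leN (NExp.var nT) (NExp.const 1)) trivialParams
      (ite (Test.leR (RExp.ofNat (NExp.const 1)) (RExp.var rEps)) trivialParams mainParams))
  (seq computeSizes
  (seq tryGuesses
  (seq (letR rX (RExp.var rBestX))
    solve)))))))

/-- The quantities that stay fixed while `solve` is run: the caps `m` of the number of stages and
`kcap` of the number of positions, the numbers `L` and `V` of levels, the largest expected reward
`M` of an offer, and the ratio `β` of successive thresholds. -/
structure Params where
  m : ℕ
  kcap : ℕ
  L : ℕ
  V : ℕ
  M : ℝ
  β : ℝ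

/-- The number of classes. -/
def Params.D (c : Params) : ℕ := c.L * c.V

/-- The base of the digits of the state numbers. -/
def Params.R (c : Params) : ℕ := c.m + 1

/-- The number of states. -/
def Params.size (c : Params) : ℕ := c.R ^ (c.D + 2)

/-- The memory holds the instance and the parameters where `solve` expects them. -/
structure Ready (I : Instance) (c : Params) (s : Mem) : Prop where
  n_eq : s.nat nN 0 = I.n
  m_eq : s.nat nM 0 = c.m
  r_eq : s.nat nR 0 = c.R
  l_eq : s.nat nL 0 = c.L
  v_eq : s.nat nV 0 = c.V
  vone_eq : s.nat nVone 0 = c.V - 1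
  one_eq : s.nat nOne 0 = 1
  d_eq : s.nat nD 0 = c.D
  dtwo_eq : s.nat nDtwo 0 = c.D + 2
  dr_eq : s.nat nDR 0 = c.D * c.R
  size_eq : s.nat nSize 0 = c.size
  str_eq : ∀ j ≤ c.D + 2, s.nat nStr j = c.R ^ j
  val_eq : ∀ i : Fin I.n, s.real rV i = I.v i
  prob_eq : ∀ i : Fin I.n, s.real rP i = I.p i
  max_eq : s.real rM 0 = c.M
  beta_eq : s.real rBeta 0 = c.β

theorem Ready.of_agree {I : Instance} {c : Params} {s s' : Mem} {l r : List ℕ} (h : Ready I c s)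
    (ha : Mem.AgreeOff l r s s')
    (hl : ∀ a ∈ [nN, nM, nR, nL, nV, nVone, nOne, nD, nDtwo, nDR, nSize, nStr], a ∉ l)
    (hr : ∀ a ∈ [rV, rP, rM, rBeta], a ∉ r) : Ready I c s' := by
  have e : ∀ a ∈ [nN, nM, nR, nL, nV, nVone, nOne, nD, nDtwo, nDR, nSize, nStr],
    s'.nat a = s.nat a := fun a h => ha.1 a (hl a h)
  have f : ∀ a ∈ [rV, rP, rM, rBeta], s'.real a = s.real a := fun a h => ha.2 a (hr a h)
  simp only [List.forall_mem_cons] at e f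
  obtain ⟨e1, e2, e3, e4, e5, e6, e7, e8, e9, e10, e11, e12, -⟩ := e
  obtain ⟨f1, f2, f3, f4, -⟩ := f
  constructor
  · rw [e1]; exact h.n_eq
  · rw [e2]; exact h.m_eq
  · rw [e3]; exact h.r_eq
  · rw [e4]; exact h.l_eq
  · rw [e5]; exact h.v_eq
  · rw [e6]; exact h.vone_eq
  · rw [e7]; exact h.one_eq
  · rw [e8]; exact h.d_eq
  · rw [e9]; exact h.dtwo_eq
  · rw [e10]; exact h.dr_eq
  · rw [e11]; exact h.size_eq
  · rw [e12]; exact h.str_eq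
  · rw [f1]; exact h.val_eq
  · rw [f2]; exact h.prob_eq
  · rw [f3]; exact h.max_eq
  · rw [f4]; exact h.beta_eq

/-- The class of an applicant, for the threshold `X` of the levels of values. -/
noncomputable def Params.cls (c : Params) (I : Instance) (X : ℝ) (i : Fin I.n) : ℕ :=
  classOf c.M X c.β c.L c.V (I.p i) (I.v i)

/-! ### The blocks of the program -/

attribute [local simp] NExp.eval NExp.cost NExp.var RExp.eval RExp.cost RExp.var Test.holds Test.cost
  Mem.putN_nat Mem.putN_real Mem.putR_nat Mem.putR_real Prog.natTargets Prog.realTargets Prog.letN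
  Prog.letR

theorem countLevels_ensures {dst inc len : ℕ} {s : Mem} {X β w : ℝ} {b l o : ℕ}
    (h1 : dst ≠ nS) (h2 : inc ≠ dst) (h3 : inc ≠ nS) (h4 : len ≠ dst) (h5 : len ≠ nS)
    (hthr : s.real rThr 0 = X) (hβ : s.real rBeta 0 = β) (hw : s.real rW 0 = w)
    (hd : s.nat dst 0 = b) (hinc : s.nat inc 0 = o) (hlen : s.nat len 0 = l) :
    (countLevels dst inc len).Ensures s (l * 50 + 50) fun s' =>
      s'.nat dst 0 = b + o * level X β l w := by
  refine Prog.Ensures.mono (Prog.Ensures.forLoop (B := 38) (fun j s' => s'.real rThr 0 = X * β ^ j ∧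
    s'.nat dst 0 = b + o * level X β j w) ?_ ?_ hlen ?_ ?_) (by omega) fun s' h => h.2
  · simpa [Prog.natTargets, Prog.letN, Prog.letR] using h1.symm
  · simp [Prog.natTargets, Prog.letN, Prog.letR, h4, h5]
  · simp [Mem.putN_real, Mem.putN_nat, hthr, hd, h1, level]
  · rintro j hj s' hag _ ⟨e1, e2⟩
    have hβ' : s'.real rBeta 0 = β := by
      rw [hag.2 _ (by simp [Prog.realTargets, Prog.letN, Prog.letR]), hβ]
    have hw' : s'.real rW 0 = w := by
      rw [hag.2 _ (by simp [Prog.realTargets, Prog.letN, Prog.letR]), hw]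
    have hinc' : s'.nat inc 0 = o := by
      rw [hag.1 _ (by simp [Prog.natTargets, Prog.letN, Prog.letR, h2, h3]), hinc]
    refine Prog.Ensures.mono_bound (Prog.Ensures.seq (B := 15) (B' := 10)
      (Prog.Ensures.mono_bound (Prog.Ensures.ite (B := 9) (fun hb => ?_) fun hb => ?_)
        (by simp [Test.cost, RExp.cost, RExp.var, NExp.cost]))) (by omega)
    · refine Prog.Ensures.setN (Prog.Ensures.setR ?_ (by simp [RExp.cost, RExp.var, NExp.cost]))
        (by simp [NExp.cost, NExp.var])
      simp only [Test.holds, RExp.eval, RExp.var, NExp.eval, e1, hw'] at hb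
      simp [Mem.putN_real, Mem.putN_nat, Mem.putR_nat, Mem.putR_real, RExp.eval, NExp.eval, RExp.var,
        NExp.var, e1, e2, hβ', hinc', h1, level_succ, hb, pow_succ, mul_assoc, mul_add, add_assoc]
    · refine Prog.Ensures.mono_bound (Prog.Ensures.skip
        (Prog.Ensures.setR ?_ (by simp [RExp.cost, RExp.var, NExp.cost]))) (by omega)
      simp only [Test.holds, RExp.eval, RExp.var, NExp.eval, e1, hw'] at hb
      simp [Mem.putN_real, Mem.putN_nat, Mem.putR_nat, Mem.putR_real, RExp.eval, NExp.eval, RExp.var,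
        e1, e2, hβ', h1, level_succ, hb, pow_succ, mul_assoc]

theorem classify_ensures {I : Instance} {c : Params} {s : Mem} {X : ℝ} (h : Ready I c s)
    (hX : s.real rX 0 = X) :
    classify.Ensures s (I.n * (c.L * 50 + c.V * 50 + 300) + 12) fun s' =>
      ∀ i : Fin I.n, s'.nat nCls i = c.cls I X i := by
  refine Prog.Ensures.mono (Prog.Ensures.forLoop (B := c.L * 50 + c.V * 50 + 288)
    (fun j s' => ∀ i : Fin I.n, (i : ℕ) < j → s'.nat nCls i = c.cls I X i)
    (by decide) (by decide) h.n_eq (by simp) ?_) le_rfl fun s' h i => h i i.2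
  intro j hj s' hag hij hinv
  have hr : Ready I c s' := h.of_agree hag (by decide) (by decide)
  have hX' : s'.real rX 0 = X := by rw [hag.2 _ (by decide), hX]
  have hp := hr.prob_eq ⟨j, hj⟩
  have hv := hr.val_eq ⟨j, hj⟩
  simp only at hp hv
  refine Prog.Ensures.setN_seq (B₂ := c.L * 50 + c.V * 50 + 270) (by simp; omega) ?_
  refine Prog.Ensures.setR_seq (B₂ := c.L * 50 + c.V * 50 + 260) (by simp; omega) ?_
  refine Prog.Ensures.setR_seq (B₂ := c.L * 50 + c.V * 50 + 240) (by simp; omega) ?_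
  refine Prog.Ensures.seq_of (B₁ := c.L * 50 + 50) (B₂ := c.V * 50 + 150)
    (countLevels_ensures (X := c.M * c.β) (β := c.β) (w := I.p ⟨j, hj⟩ * I.v ⟨j, hj⟩) (b := 0)
      (l := c.L) (o := c.V) (by decide) (by decide) (by decide) (by decide) (by decide)
      ?_ ?_ ?_ ?_ ?_ ?_) (by omega) ?_
  · simp [hr.max_eq, hr.beta_eq]
  · simp [hr.beta_eq]
  · simp [hij, hp, hv]
  · simp
  · simp [hr.v_eq]
  · simp [hr.l_eq]
  intro s₁ hag₁ hc₁
  refine Prog.Ensures.setR_seq (B₂ := c.V * 50 + 130) (by simp; omega) ?_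
  refine Prog.Ensures.setR_seq (B₂ := c.V * 50 + 110) (by simp; omega) ?_
  have e1 : ∀ a, a ≠ nTmp → a ≠ nS → s₁.nat a = s'.nat a := by
    intro a h1 h2
    rw [hag₁.1 a (by simp [countLevels, Prog.forLoop, h1, h2])]
    simp only [Mem.putR_nat, Mem.putN_nat_of_ne _ _ _ h1]
  have e2 : ∀ a, a ≠ rThr → a ≠ rW → s₁.real a = s'.real a := by
    intro a h1 h2
    rw [hag₁.2 a (by simp [countLevels, Prog.forLoop, h1])]
    simp only [Mem.putR_real_of_ne _ _ _ h1, Mem.putR_real_of_ne _ _ _ h2, Mem.putN_real]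
  refine Prog.Ensures.seq_of (B₁ := c.V * 50 + 50) (B₂ := 40)
    ((countLevels_ensures (X := X) (β := c.β) (w := I.v ⟨j, hj⟩)
      (b := 0 + c.V * level (c.M * c.β) c.β c.L (I.p ⟨j, hj⟩ * I.v ⟨j, hj⟩))
      (l := c.V - 1) (o := 1) (by decide) (by decide) (by decide) (by decide) (by decide)
      ?_ ?_ ?_ ?_ ?_ ?_).mono_bound (by omega)) (by omega) ?_
  · simp [e2, hX']
  · simp [e2, hr.beta_eq]
  · simp [e1, e2, hij, hv]
  · simp [hc₁]
  · simp [e1, hr.one_eq]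
  · simp [e1, hr.vone_eq]
  intro s₂ hag₂ hc₂
  have e3 : ∀ a, a ≠ nTmp → a ≠ nS → s₂.nat a = s'.nat a := by
    intro a h1 h2
    rw [hag₂.1 a (by simp [countLevels, Prog.forLoop, h1, h2])]
    simp only [Mem.putR_nat, e1 a h1 h2]
  refine Prog.Ensures.setN ?_ (by simp)
  intro i hi
  simp only [Mem.putN_nat, NExp.var, NExp.eval, hc₂, e3 nI (by decide) (by decide), hij]
  by_cases hij' : (i : ℕ) = j
  · obtain rfl : i = ⟨j, hj⟩ := Fin.ext hij'
    simp [Params.cls, classOf]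
  · simp [hij', e3, hinv i (by omega)]

/-- The rank loop counts the predecessors of the applicant `nI` in its class. -/
theorem computeRank_ensures {I : Instance} {c : Params} {s : Mem} {cls : Fin I.n → ℕ} {i : Fin I.n}
    (h : Ready I c s) (hcls : ∀ j : Fin I.n, s.nat nCls j = cls j) (hi : s.nat nI 0 = i) :
    computeRank.Ensures s (I.n * 70 + 20) fun s' => s'.nat nRank 0 = rankIn cls I.p i := by
  refine Prog.Ensures.setN_seq (B₂ := I.n * 70 + 12) (by simp; omega) ?_
  refine Prog.Ensures.mono (Prog.Ensures.forLoop (B := 58) (N := I.n)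
    (fun j s' => s'.nat nRank 0 = ((univ.filter fun x : Fin I.n => (x : ℕ) < j).filter fun x =>
      cls x = cls i ∧ (I.p x < I.p i ∨ (I.p x = I.p i ∧ x < i))).card)
    (by decide) (by decide) (by simp [h.n_eq]) (by simp) ?_) le_rfl fun s' h' => ?_
  · intro j hj s' hag hij hinv
    have hr : Ready I c s' := Ready.of_agree (l := nRank :: nJ :: [nRank, nRank])
      (r := []) h (by
        refine ⟨fun a ha => ?_, fun a ha => ?_⟩
        · rw [hag.1 a (by simp at ha ⊢; tauto)]
          simp at ha
          simp only [Mem.putN_nat_of_ne _ _ _ ha.1]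
        · rw [hag.2 a (by simp)]
          rfl) (by decide) (by decide)
    have hcls' : ∀ x : Fin I.n, s'.nat nCls x = cls x := by
      intro x
      rw [hag.1 _ (by decide)]
      simp [hcls]
    have hi' : s'.nat nI 0 = i := by
      rw [hag.1 _ (by decide)]
      simp [hi]
    have hp := hr.prob_eq ⟨j, hj⟩
    have hpi := hr.prob_eq i
    have hc := hcls' ⟨j, hj⟩
    have hci := hcls' i
    simp only at hp hpi hc hci
    -- The new index is counted exactly if it precedes `i`.
    have hset : (univ.filter fun x : Fin I.n => (x : ℕ) < j + 1) =
        insert ⟨j, hj⟩ (univ.filter fun x : Fin I.n => (x : ℕ) < j) := by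
      ext x
      simp only [Finset.mem_filter, Finset.mem_univ, true_and, Finset.mem_insert, Fin.ext_iff]
      omega
    have hnot : (⟨j, hj⟩ : Fin I.n) ∉ ((univ.filter fun x : Fin I.n => (x : ℕ) < j).filter fun x =>
      cls x = cls i ∧ (I.p x < I.p i ∨ (I.p x = I.p i ∧ x < i))) := by simp
    simp only [hset, Finset.filter_insert]
    have hlt : (⟨j, hj⟩ : Fin I.n) < i ↔ j < i := Iff.rfl
    by_cases hall : cls ⟨j, hj⟩ = cls i ∧ (I.p ⟨j, hj⟩ < I.p i ∨ (I.p ⟨j, hj⟩ = I.p i ∧ (⟨j, hj⟩ : Fin I.n) < i))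
    · rw [if_pos hall, Finset.card_insert_of_notMem hnot, ← hinv]
      rw [hlt] at hall
      refine Prog.Ensures.ite_of (B₁ := 50) (by simp) (fun h1 => ?_) fun h1 => ?_
      · refine Prog.Ensures.ite_of (B₁ := 40) (by simp) (fun h2 => ?_) fun h2 => ?_
        · refine Prog.Ensures.ite_of (B₁ := 30) (by simp) (fun h3 => ?_) fun h3 => ?_
          · refine Prog.Ensures.ite_of (B₁ := 20) (by simp) (fun h4 => ?_) fun h4 => ?_
            · refine Prog.Ensures.ite_of (B₁ := 10) (by simp) (fun h5 => ?_) fun h5 => ?_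
              · simp [hij, hi', hp, hpi] at h3 h4 h5
                rcases hall.2 with h | h
                · linarith
                · omega
              · exact Prog.Ensures.setN (by simp) (by simp)
            · simp [hij, hi', hp, hpi] at h3 h4
              rcases hall.2 with h | h <;> linarith
          · exact Prog.Ensures.setN (by simp) (by simp)
        · simp [hij, hi', hc, hci] at h2
          omega
      · simp [hij, hi', hc, hci] at h1
        omega
    · rw [if_neg hall, ← hinv]
      rw [hlt] at hall
      have hskip : Prog.skip.Ensures s' 10 fun s'' =>
          (s''.putN nJ 0 (j + 1)).nat nRank 0 = s'.nat nRank 0 :=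
        (Prog.Ensures.skip (by simp)).mono_bound (by omega)
      refine Prog.Ensures.ite_of (B₁ := 50) (by simp) (fun h1 => ?_) fun h1 => ?_
      · refine Prog.Ensures.ite_of (B₁ := 40) (by simp) (fun h2 => ?_) fun h2 => ?_
        · simp [hij, hi', hc, hci] at h1 h2
          have hcc := le_antisymm h1 h2
          refine Prog.Ensures.ite_of (B₁ := 30) (by simp) (fun h3 => ?_) fun h3 => ?_
          · refine Prog.Ensures.ite_of (B₁ := 20) (by simp) (fun h4 => ?_) fun h4 => ?_
            · refine Prog.Ensures.ite_of (B₁ := 10) (by simp) (fun h5 => ?_) fun h5 => ?_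
              · exact hskip
              · simp [hij, hi', hp, hpi] at h3 h4 h5
                exact absurd ⟨hcc, Or.inr ⟨le_antisymm h4 h3, h5⟩⟩ hall
            · exact hskip.mono_bound (by omega)
          · simp [hij, hi', hp, hpi] at h3
            exact absurd ⟨hcc, Or.inl h3⟩ hall
        · exact hskip.mono_bound (by omega)
      · exact hskip.mono_bound (by omega)
  · rw [h', rankIn]
    congr 1
    ext x
    simp

/-- The applicant takes part in the dynamic program: it is not negligible, and there are not too
many better ones in its class. -/
def Retained {n : ℕ} (cls rank : Fin n → ℕ) (D m : ℕ) (i : Fin n) : Prop :=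
  cls i < D ∧ rank i < m

theorem fillTable_ensures {I : Instance} {c : Params} {s : Mem} {cls : Fin I.n → ℕ}
    (h : Ready I c s) (hcls : ∀ j : Fin I.n, s.nat nCls j = cls j)
    (htab : ∀ x < c.D * c.R, s.nat nTab x = 0) :
    fillTable.Ensures s (I.n * (I.n * 70 + c.D * 30 + 200) + 12) fun s' =>
      (∀ i : Fin I.n, Retained cls (rankIn cls I.p) c.D c.m i →
        s'.nat nTab (cls i * c.R + (c.m - rankIn cls I.p i)) = i + 1 ∧ s'.nat nRet i = 1) ∧
      (∀ i : Fin I.n, ¬ Retained cls (rankIn cls I.p) c.D c.m i → s'.nat nRet i = 0) ∧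
      (∀ x < c.D * c.R, s'.nat nTab x ≠ 0 → ∃ i : Fin I.n,
        Retained cls (rankIn cls I.p) c.D c.m i ∧
          x = cls i * c.R + (c.m - rankIn cls I.p i) ∧ s'.nat nTab x = i + 1) := by
  set rank := rankIn cls I.p with hrank
  have hinj : ∀ i i' : Fin I.n, Retained cls rank c.D c.m i → Retained cls rank c.D c.m i' →
      cls i * c.R + (c.m - rank i) = cls i' * c.R + (c.m - rank i') → i = i' := by
    intro i i' hi hi' he
    have hR : 0 < c.R := Nat.succ_pos _
    have hlt : ∀ x, c.m - x < c.R := fun x => by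
      show _ < c.m + 1
      omega
    have hd := congrArg (· / c.R) he
    have hm := congrArg (· % c.R) he
    simp only [mul_comm _ c.R, Nat.mul_add_div hR, Nat.div_eq_of_lt (hlt _), add_zero] at hd
    simp only [mul_comm _ c.R, Nat.mul_add_mod, Nat.mod_eq_of_lt (hlt _)] at hm
    refine rankIn_inj (p := I.p) hd ?_
    have h1 : rank i < c.m := hi.2
    have h2 : rank i' < c.m := hi'.2
    show rank i = rank i'
    omega
  refine Prog.Ensures.mono (Prog.Ensures.forLoop (B := I.n * 70 + c.D * 30 + 188)
    (fun j s' =>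
      (∀ i : Fin I.n, (i : ℕ) < j → Retained cls rank c.D c.m i →
        s'.nat nTab (cls i * c.R + (c.m - rank i)) = i + 1 ∧ s'.nat nRet i = 1) ∧
      (∀ i : Fin I.n, (i : ℕ) < j → ¬ Retained cls rank c.D c.m i → s'.nat nRet i = 0) ∧
      (∀ x < c.D * c.R, s'.nat nTab x ≠ 0 → ∃ i : Fin I.n, (i : ℕ) < j ∧
        Retained cls rank c.D c.m i ∧
          x = cls i * c.R + (c.m - rank i) ∧ s'.nat nTab x = i + 1))
    (by decide) (by decide) h.n_eq ?_ ?_) le_rfl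
    fun s' h => ⟨fun i => h.1 i i.2, fun i => h.2.1 i i.2, fun x hx h0 => by
      obtain ⟨i, -, hi⟩ := h.2.2 x hx h0
      exact ⟨i, hi⟩⟩
  · refine ⟨by simp, by simp, fun x hx h0 => absurd ?_ h0⟩
    simp [htab x hx]
  intro j hj s' hag hij hinv
  have hr : Ready I c s' := h.of_agree hag (by decide) (by decide)
  have hcls' : ∀ x : Fin I.n, s'.nat nCls x = cls x := by
    intro x
    rw [hag.1 _ (by decide), hcls]
  refine Prog.Ensures.setN_seq (B₂ := I.n * 70 + c.D * 30 + 180) (by simp; omega) ?_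
  set s₁ := s'.putN nRet ((NExp.var nI).eval s') ((NExp.const 0).eval s') with hs₁
  have hr₁ : Ready I c s₁ := Ready.of_agree (l := [nRet]) (r := []) hr
    ⟨fun a ha => Mem.putN_nat_of_ne _ _ _ (by simpa using ha), fun a _ => rfl⟩
    (by decide) (by decide)
  refine Prog.Ensures.seq_of (B₁ := I.n * 70 + 20) (B₂ := c.D * 30 + 160)
    (computeRank_ensures (i := ⟨j, hj⟩) hr₁ (cls := cls) (fun x => by simp [hs₁, hcls' x])
      (by simp [hs₁, hij])) (by omega) ?_
  intro s₂ hag₂ hrk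
  have hr₂ : Ready I c s₂ := hr₁.of_agree hag₂ (by decide) (by decide)
  have e₂ : ∀ a, a ≠ nRank → a ≠ nJ → a ≠ nRet → s₂.nat a = s'.nat a := by
    intro a h1 h2 h3
    rw [hag₂.1 a (by simp [computeRank, Prog.forLoop, h1, h2]), hs₁, Mem.putN_nat_of_ne _ _ _ h3]
  have eret : ∀ x, s₂.nat nRet x = if x = j then 0 else s'.nat nRet x := by
    intro x
    rw [hag₂.1 _ (by decide), hs₁]
    simp [hij]
  refine Prog.Ensures.setN_seq (B₂ := c.D * 30 + 150) (by simp; omega) ?_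
  have hij₂ : s₂.nat nI 0 = j := by rw [e₂ _ (by decide) (by decide) (by decide), hij]
  have hcj : s₂.nat nCls j = cls ⟨j, hj⟩ := by
    rw [e₂ _ (by decide) (by decide) (by decide)]
    exact hcls' ⟨j, hj⟩
  have htab₂ : s₂.nat nTab = s'.nat nTab := e₂ _ (by decide) (by decide) (by decide)
  have hnotret : ¬ Retained cls rank c.D c.m ⟨j, hj⟩ → ∀ s₃ : Mem, s₃.nat nTab = s'.nat nTab →
      s₃.nat nRet = s₂.nat nRet → (∀ i : Fin I.n, (i : ℕ) < j + 1 → Retained cls rank c.D c.m i →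
        s₃.nat nTab (cls i * c.R + (c.m - rank i)) = i + 1 ∧ s₃.nat nRet i = 1) ∧
      (∀ i : Fin I.n, (i : ℕ) < j + 1 → ¬ Retained cls rank c.D c.m i → s₃.nat nRet i = 0) ∧
      (∀ x < c.D * c.R, s₃.nat nTab x ≠ 0 → ∃ i : Fin I.n, (i : ℕ) < j + 1 ∧
        Retained cls rank c.D c.m i ∧
          x = cls i * c.R + (c.m - rank i) ∧ s₃.nat nTab x = i + 1) := by
    intro hn s₃ h1 h2
    rw [h1, h2]
    refine ⟨fun i hi hri => ?_, fun i hi hri => ?_, fun x hx h0 => ?_⟩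
    · have hne : (i : ℕ) ≠ j := by
        rintro he
        obtain rfl : i = ⟨j, hj⟩ := Fin.ext he
        exact hn hri
      rw [eret, if_neg hne]
      exact hinv.1 i (by omega) hri
    · rw [eret]
      split_ifs with hne
      · rfl
      · exact hinv.2.1 i (by omega) hri
    · obtain ⟨i, hi, hri⟩ := hinv.2.2 x hx h0
      exact ⟨i, by omega, hri⟩
  refine Prog.Ensures.ite_of (B₁ := c.D * 30 + 140) (by simp; omega) (fun h1 => ?_) fun h1 => ?_
  · simp [hr₂.d_eq, hij₂, hcj] at h1
    refine (Prog.Ensures.skip (hnotret (fun h => ?_) _ ?_ ?_)).mono_bound (by omega)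
    · have := h.1
      omega
    · simp [Mem.putN_nat_of_ne, htab₂]
    · simp [Mem.putN_nat_of_ne]
  refine Prog.Ensures.ite_of (B₁ := c.D * 30 + 130) (by simp; omega) (fun h2 => ?_) fun h2 => ?_
  · simp [hr₂.m_eq, hrk] at h2
    refine (Prog.Ensures.skip (hnotret (fun h => ?_) _ ?_ ?_)).mono_bound (by omega)
    · have : rankIn cls I.p ⟨j, hj⟩ < c.m := h.2
      omega
    · simp [Mem.putN_nat_of_ne, htab₂]
    · simp [Mem.putN_nat_of_ne]
  simp [hr₂.d_eq, hij₂, hcj] at h1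
  simp [hr₂.m_eq, hrk] at h2
  have hret : Retained cls rank c.D c.m ⟨j, hj⟩ := ⟨h1, h2⟩
  refine Prog.Ensures.setN_seq (B₂ := c.D * 30 + 110) (by simp; omega) ?_
  refine Prog.Ensures.seq_of (B₁ := c.D * 30 + 12) (B₂ := 40)
    (Q₁ := fun s₃ => s₃.nat nAddr 0 = cls ⟨j, hj⟩ * c.R + (c.m - rank ⟨j, hj⟩))
    (Prog.Ensures.mono (Prog.Ensures.forLoop (B := 18) (N := cls ⟨j, hj⟩)
      (fun r s₃ => s₃.nat nAddr 0 = r * c.R + (c.m - rank ⟨j, hj⟩))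
      (by decide) (by decide) (by simp [hij₂, hcj]) (by simp [hr₂.m_eq, hrk, hrank]) ?_) (by nlinarith)
      fun s₃ h => h) (by omega) ?_
  · intro r hrlt s₃ hag₃ _ hinv₃
    have : s₃.nat nR 0 = c.R := by
      rw [hag₃.1 _ (by decide)]
      simp [hr₂.r_eq]
    refine Prog.Ensures.setN ?_ (by simp)
    simp [this, hinv₃]
    ring
  intro s₃ hag₃ haddr
  have e₃ : ∀ a, a ≠ nAddr → a ≠ nS → a ≠ nTmp → s₃.nat a = s₂.nat a := by
    intro a h1 h2 h3
    rw [hag₃.1 a (by simp [Prog.forLoop, h1, h2])]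
    simp only [Mem.putN_nat_of_ne _ _ _ h1, Mem.putN_nat_of_ne _ _ _ h3]
  have hij₃ : s₃.nat nI 0 = j := by rw [e₃ _ (by decide) (by decide) (by decide), hij₂]
  have htab₃ : s₃.nat nTab = s'.nat nTab := by
    rw [e₃ _ (by decide) (by decide) (by decide), htab₂]
  have hret₃ : s₃.nat nRet = s₂.nat nRet := e₃ _ (by decide) (by decide) (by decide)
  refine Prog.Ensures.setN_seq (B₂ := 20) (by simp) (Prog.Ensures.setN ?_ (by simp))
  have t₄ : ∀ x, (((s₃.putN nTab ((NExp.var nAddr).eval s₃) (((NExp.var nI).add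
      (NExp.const 1)).eval s₃)).putN nRet j 1).putN nI 0 (j + 1)).nat nTab x =
      if x = cls ⟨j, hj⟩ * c.R + (c.m - rank ⟨j, hj⟩) then j + 1 else s'.nat nTab x := by
    intro x
    simp [haddr, hij₃, htab₃]
  have r₄ : ∀ x, (((s₃.putN nTab ((NExp.var nAddr).eval s₃) (((NExp.var nI).add
      (NExp.const 1)).eval s₃)).putN nRet j 1).putN nI 0 (j + 1)).nat nRet x =
      if x = j then 1 else s'.nat nRet x := by
    intro x
    simp only [Mem.putN_nat, hret₃, eret]
    by_cases hx : x = j <;> simp [hx]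
  have hev : NExp.eval (s₃.putN nTab ((NExp.var nAddr).eval s₃) (((NExp.var nI).add
      (NExp.const 1)).eval s₃)) (NExp.var nI) = j := by
    simp [hij₃]
  have hev1 : NExp.eval (s₃.putN nTab ((NExp.var nAddr).eval s₃) (((NExp.var nI).add
      (NExp.const 1)).eval s₃)) (NExp.const 1) = 1 := rfl
  rw [hev, hev1]
  simp only [t₄, r₄]
  refine ⟨fun i hi hri => ?_, fun i hi hri => ?_, fun x hx h0 => ?_⟩
  · by_cases hne : (i : ℕ) = j
    · obtain rfl : i = ⟨j, hj⟩ := Fin.ext hne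
      simp
    · have hd : cls i * c.R + (c.m - rank i) ≠ cls ⟨j, hj⟩ * c.R + (c.m - rank ⟨j, hj⟩) := by
        intro he
        exact hne (congrArg Fin.val (hinj _ _ hri hret he))
      rw [if_neg hd, if_neg hne]
      exact hinv.1 i (by omega) hri
  · have hne : (i : ℕ) ≠ j := by
      rintro he
      obtain rfl : i = ⟨j, hj⟩ := Fin.ext he
      exact hri hret
    rw [if_neg hne]
    exact hinv.2.1 i (by omega) hri
  · split_ifs at h0 ⊢ with hx'
    · exact ⟨⟨j, hj⟩, by simp, hret, hx', rfl⟩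
    · obtain ⟨i, hi, hri⟩ := hinv.2.2 x hx h0
      exact ⟨i, by omega, hri⟩

/-- The chain offers, in the order of their indices, to all applicants that are not retained. -/
structure ChainOK {n : ℕ} (left : Fin n → Prop) (N : ℕ) (s : Mem) [DecidablePred left] : Prop where
  app_eq : ∀ i : Fin n, left i →
    s.nat nApp (N + (univ.filter fun j : Fin n => left j ∧ j < i).card) = i
  acc_eq : ∀ i : Fin n, left i →
    s.nat nAcc (N + (univ.filter fun j : Fin n => left j ∧ j < i).card) =
      N + (univ.filter fun j : Fin n => left j ∧ j < i).card + 1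
  rej_eq : ∀ i : Fin n, left i →
    s.nat nRej (N + (univ.filter fun j : Fin n => left j ∧ j < i).card) =
      N + (univ.filter fun j : Fin n => left j ∧ j < i).card + 1

theorem writeChain_ensures {I : Instance} {c : Params} {s : Mem} {left : Fin I.n → Prop}
    [DecidablePred left] (h : Ready I c s) (hret : ∀ i : Fin I.n, left i ↔ s.nat nRet i = 0) :
    writeChain.Ensures s (I.n * 62 + 20) fun s' => ChainOK left c.size s' := by
  have hbig : ∀ a b : Fin I.n, left a → a < b → (univ.filter fun x : Fin I.n => left x ∧ x < a).card <
      (univ.filter fun x : Fin I.n => left x ∧ x < b).card := by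
    intro a b ha hab
    refine Finset.card_lt_card ⟨fun x hx => ?_, fun hsub => ?_⟩
    · simp only [Finset.mem_filter, Finset.mem_univ, true_and] at hx ⊢
      exact ⟨hx.1, hx.2.trans hab⟩
    · have := hsub (Finset.mem_filter.2 ⟨Finset.mem_univ a, ha, hab⟩)
      simp at this
  refine Prog.Ensures.setN_seq (B₂ := I.n * 62 + 12) (by simp; omega) ?_
  refine Prog.Ensures.mono (Prog.Ensures.forLoop (B := 50) (N := I.n)
    (fun j s' =>
      s'.nat nCnt 0 = c.size + (univ.filter fun x : Fin I.n => left x ∧ (x : ℕ) < j).card ∧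
      ∀ i : Fin I.n, (i : ℕ) < j → left i →
        s'.nat nApp (c.size + (univ.filter fun x : Fin I.n => left x ∧ x < i).card) = i ∧
        s'.nat nAcc (c.size + (univ.filter fun x : Fin I.n => left x ∧ x < i).card) =
          c.size + (univ.filter fun x : Fin I.n => left x ∧ x < i).card + 1 ∧
        s'.nat nRej (c.size + (univ.filter fun x : Fin I.n => left x ∧ x < i).card) =
          c.size + (univ.filter fun x : Fin I.n => left x ∧ x < i).card + 1)
    (by decide) (by decide) (by simp [h.n_eq]) (by simp [h.size_eq]) ?_) le_rfl fun s' h' =>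
      ⟨fun i hi => (h'.2 i i.2 hi).1, fun i hi => (h'.2 i i.2 hi).2.1,
        fun i hi => (h'.2 i i.2 hi).2.2⟩
  rintro j hj s' hag hij ⟨hcnt, hinv⟩
  have hret' : left ⟨j, hj⟩ ↔ s'.nat nRet j = 0 := by
    rw [hret ⟨j, hj⟩, hag.1 _ (by decide)]
    simp
  have hset : (univ.filter fun x : Fin I.n => left x ∧ (x : ℕ) < j + 1) = if left ⟨j, hj⟩ then
      insert ⟨j, hj⟩ (univ.filter fun x : Fin I.n => left x ∧ (x : ℕ) < j) else
        univ.filter fun x : Fin I.n => left x ∧ (x : ℕ) < j := by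
    split_ifs with hl
    all_goals
      ext x
      simp only [Finset.mem_filter, Finset.mem_univ, true_and, Finset.mem_insert]
      by_cases hx : x = ⟨j, hj⟩
      · subst hx
        simp [hl]
      · have : (x : ℕ) ≠ j := fun e => hx (Fin.ext e)
        try simp only [hx, false_or]
        constructor <;> rintro ⟨h1, h2⟩ <;> exact ⟨h1, by omega⟩
  refine Prog.Ensures.ite_of (B₁ := 40) (by simp) (fun h1 => ?_) fun h1 => ?_
  · simp [hij] at h1
    have hl := hret'.2 h1
    have hjcnt : (univ.filter fun x : Fin I.n => left x ∧ x < ⟨j, hj⟩).card =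
        (univ.filter fun x : Fin I.n => left x ∧ (x : ℕ) < j).card := rfl
    refine Prog.Ensures.setN_seq (B₂ := 34) (by simp) ?_
    refine Prog.Ensures.setN_seq (B₂ := 24) (by simp) ?_
    refine Prog.Ensures.setN_seq (B₂ := 10) (by simp) ?_
    refine Prog.Ensures.setN ?_ (by simp)
    rw [hset, if_pos hl, Finset.card_insert_of_notMem (by simp)]
    refine ⟨by simp [hcnt]; omega, fun i hi hli => ?_⟩
    by_cases hne : i = ⟨j, hj⟩
    · subst hne
      simp [hcnt, hij, hjcnt]
    · have hlt : i < ⟨j, hj⟩ := lt_of_le_of_ne (Nat.lt_succ_iff.1 hi) hne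
      have := (hbig i ⟨j, hj⟩ hli hlt).ne
      rw [hjcnt] at this
      simp [hcnt, this]
      exact hinv i hlt hli
  · simp [hij] at h1
    have hl : ¬ left ⟨j, hj⟩ := fun h => h1 (hret'.1 h)
    refine (Prog.Ensures.skip ?_).mono_bound (by omega)
    rw [hset, if_neg hl]
    refine ⟨by simp [hcnt], fun i hi hli => ?_⟩
    have hne : (i : ℕ) ≠ j := by
      rintro he
      obtain rfl : i = ⟨j, hj⟩ := Fin.ext he
      exact hl hli
    simpa using hinv i (by omega) hli

/-! ### States as numbers -/

/-- The digit number `x` of `u` in base `R`. -/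
def digit (R u x : ℕ) : ℕ := u / R ^ x % R

section digit

variable {R u x y : ℕ}

theorem digit_lt (hR : 0 < R) : digit R u x < R := Nat.mod_lt _ hR

theorem pow_le_of_digit_pos (h : 1 ≤ digit R u x) : R ^ x ≤ u := by
  by_contra hlt
  push Not at hlt
  simp [digit, Nat.div_eq_of_lt hlt] at h

/-- Subtraction of `R ^ x` decreases the digit number `x` and changes no other digit. -/
theorem digit_sub_pow (hR : 0 < R) (h : 1 ≤ digit R u x) :
    digit R (u - R ^ x) y = if y = x then digit R u x - 1 else digit R u y := by
  have hle := pow_le_of_digit_pos h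
  unfold digit at h ⊢
  split_ifs with hxy
  · subst hxy
    have e : (u - R ^ y) / R ^ y = u / R ^ y - 1 := by
      have := Nat.sub_mul_div u (R ^ y) 1
      rwa [mul_one] at this
    rw [e]
    have hdm := Nat.div_add_mod (u / R ^ y) R
    have hlt := Nat.mod_lt (u / R ^ y) hR
    have e2 : u / R ^ y - 1 = R * (u / R ^ y / R) + (u / R ^ y % R - 1) := by omega
    rw [e2, Nat.mul_add_mod, Nat.mod_eq_of_lt (by omega)]
  · rcases Nat.lt_or_gt_of_ne hxy with hlt | hgt
    · obtain ⟨d, rfl⟩ := Nat.exists_eq_add_of_lt hlt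
      have e1 : R ^ (y + d + 1) = R ^ y * (R * R ^ d) := by ring
      rw [e1] at hle ⊢
      rw [Nat.sub_mul_div]
      have hle' : R * R ^ d ≤ u / R ^ y := by
        rw [Nat.le_div_iff_mul_le (pow_pos hR y)]
        linarith
      conv_rhs => rw [← Nat.sub_add_cancel hle']
      rw [Nat.add_mul_mod_self_left]
    · have hmod : R ^ x ≤ u % R ^ y := by
        have e : u / R ^ x % R = u % R ^ y / R ^ x % R := by
          obtain ⟨d, rfl⟩ := Nat.exists_eq_add_of_lt hgt
          have e1 : R ^ (x + d + 1) = R ^ x * (R * R ^ d) := by ring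
          rw [e1, Nat.mod_mul_right_div_self, Nat.mod_mul_right_mod]
        rw [e] at h
        by_contra hlt
        push Not at hlt
        simp [Nat.div_eq_of_lt hlt] at h
      have e : u - R ^ x = (u % R ^ y - R ^ x) + R ^ y * (u / R ^ y) := by
        have := Nat.mod_add_div u (R ^ y)
        omega
      have hlt : u % R ^ y - R ^ x < R ^ y :=
        lt_of_le_of_lt (Nat.sub_le _ _) (Nat.mod_lt _ (pow_pos hR y))
      rw [e, Nat.add_mul_div_left _ _ (pow_pos hR y), Nat.div_eq_of_lt hlt, zero_add]

theorem succ_mod_div {b : ℕ} (hb : 0 < b) :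
    ((u + 1) % b = if b ≤ u % b + 1 then 0 else u % b + 1) ∧
      (u + 1) / b = if b ≤ u % b + 1 then u / b + 1 else u / b := by
  have h := Nat.mod_add_div u b
  have hlt := Nat.mod_lt u hb
  split_ifs with hle
  · have e : u + 1 = 0 + b * (u / b + 1) := by
      rw [mul_add, mul_one]
      omega
    rw [e, Nat.add_mul_mod_self_left, Nat.add_mul_div_left _ _ hb]
    simp
  · have e : u + 1 = (u % b + 1) + b * (u / b) := by omega
    constructor
    · conv_lhs => rw [e]
      rw [Nat.add_mul_mod_self_left, Nat.mod_eq_of_lt (by omega)]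
    · conv_lhs => rw [e]
      rw [Nat.add_mul_div_left _ _ hb, Nat.div_eq_of_lt (by omega), zero_add]

end digit

section states

variable {n : ℕ} {p v : Fin n → ℝ} {cls : Fin n → ℕ} {D m u : ℕ}

open Classical in
/-- The applicants that are still available in the state number `u`: in each class, the retained
applicants are offered to in the order of their ranks, and `m` minus the digit of the class is the
number of those who have received an offer. -/
noncomputable def availableAt (p : Fin n → ℝ) (cls : Fin n → ℕ) (D m u : ℕ) : Finset (Fin n) :=
  univ.filter fun i => ¬ (Retained cls (rankIn cls p) D m i ∧
    rankIn cls p i + digit (m + 1) u (cls i + 2) < m)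

/-- The applicants that may receive the next offer when `A` is the available set. -/
noncomputable def candidates (p : Fin n → ℝ) (cls : Fin n → ℕ) (D m : ℕ) (A : Finset (Fin n)) :
    Finset (Fin n) :=
  heads (fun i => cls i < D ∧ rankIn cls p i < m) cls (rankIn cls p) A

theorem mem_availableAt {i : Fin n} : i ∈ availableAt p cls D m u ↔
    ¬ (Retained cls (rankIn cls p) D m i ∧
      rankIn cls p i + digit (m + 1) u (cls i + 2) < m) := by
  simp [availableAt]

/-- Every rank below the rank of a member of a class is the rank of a member of this class. -/
theorem exists_rankIn_eq (i : Fin n) {r : ℕ} (hr : r < rankIn cls p i) :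
    ∃ j, cls j = cls i ∧ rankIn cls p j = r := by
  have hinj : Set.InjOn (rankIn cls p)
      (univ.filter fun j => cls j = cls i ∧ rankIn cls p j < rankIn cls p i : Finset (Fin n)) := by
    intro a ha b hb hab
    simp only [Finset.coe_filter, Finset.mem_univ, true_and, Set.mem_ofPred_eq] at ha hb
    exact rankIn_inj (ha.1.trans hb.1.symm) hab
  have himg : (univ.filter fun j => cls j = cls i ∧ rankIn cls p j < rankIn cls p i).image
      (rankIn cls p) = range (rankIn cls p i) := by
    refine Finset.eq_of_subset_of_card_le (fun x hx => ?_) ?_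
    · simp only [Finset.mem_image, Finset.mem_filter, Finset.mem_univ, true_and] at hx
      obtain ⟨j, hj, rfl⟩ := hx
      exact Finset.mem_range.2 hj.2
    · rw [Finset.card_image_of_injOn hinj, Finset.card_range, ← rankIn_eq_card]
  have : r ∈ range (rankIn cls p i) := Finset.mem_range.2 hr
  rw [← himg] at this
  simp only [Finset.mem_image, Finset.mem_filter, Finset.mem_univ, true_and] at this
  obtain ⟨j, hj, hjr⟩ := this
  exact ⟨j, hj.1, hjr⟩

theorem mem_candidates_availableAt {i : Fin n} :
    i ∈ candidates p cls D m (availableAt p cls D m u) ↔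
      Retained cls (rankIn cls p) D m i ∧
        rankIn cls p i + digit (m + 1) u (cls i + 2) = m := by
  rw [candidates, mem_heads, mem_availableAt]
  constructor
  · rintro ⟨h1, h2, h3⟩
    refine ⟨h2, ?_⟩
    have hge : m ≤ rankIn cls p i + digit (m + 1) u (cls i + 2) := by
      by_contra hlt
      exact h1 ⟨h2, not_le.1 hlt⟩
    by_contra hne
    have hd : digit (m + 1) u (cls i + 2) ≤ m := Nat.lt_succ_iff.1 (digit_lt (Nat.succ_pos m))
    obtain ⟨j, hj, hjr⟩ := exists_rankIn_eq (cls := cls) (p := p) i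
      (r := m - digit (m + 1) u (cls i + 2)) (by omega)
    have := h3 j (mem_availableAt.2 fun h => by
      have := h.2
      rw [hj] at this
      omega) hj
    omega
  · rintro ⟨h1, h2⟩
    refine ⟨fun h => by omega, h1, fun j hj hc => ?_⟩
    by_contra hlt
    push Not at hlt
    refine mem_availableAt.1 hj ⟨⟨hc ▸ h1.1, hlt.trans h1.2⟩, ?_⟩
    rw [hc]
    omega

theorem candidate_unique {i j : Fin n}
    (hi : i ∈ candidates p cls D m (availableAt p cls D m u))
    (hj : j ∈ candidates p cls D m (availableAt p cls D m u)) (h : cls i = cls j) : i = j := by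
  rw [mem_candidates_availableAt] at hi hj
  refine rankIn_inj (p := p) h ?_
  have := hi.2
  have := hj.2
  rw [h] at *
  omega

/-- The number of the next state when the offer to `i` in the state `u` is rejected. When it is
accepted, the number is smaller by one. -/
def rejectState (cls : Fin n → ℕ) (m u : ℕ) (i : Fin n) : ℕ :=
  u - (m + 1) ^ (cls i + 2) - (m + 1)

theorem rejectState_lt {i : Fin n} (h1 : 1 ≤ digit (m + 1) u 1) : rejectState cls m u i < u := by
  have := pow_le_of_digit_pos h1
  rw [pow_one] at this
  unfold rejectState
  have := pow_pos (Nat.succ_pos m) (cls i + 2)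
  omega

section reject

variable {i : Fin n} (hi : i ∈ candidates p cls D m (availableAt p cls D m u))
  (h1 : 1 ≤ digit (m + 1) u 1)
include hi h1

theorem digit_rejectState (x : ℕ) : digit (m + 1) (rejectState cls m u i) x =
    if x = 1 then digit (m + 1) u 1 - 1 else
      if x = cls i + 2 then digit (m + 1) u x - 1 else digit (m + 1) u x := by
  have hc := mem_candidates_availableAt.1 hi
  have hr : rankIn cls p i < m := hc.1.2
  have hd : 1 ≤ digit (m + 1) u (cls i + 2) := by omega
  have e1 : digit (m + 1) (u - (m + 1) ^ (cls i + 2)) 1 = digit (m + 1) u 1 := by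
    rw [digit_sub_pow (Nat.succ_pos m) hd, if_neg (by omega)]
  have e := digit_sub_pow (y := x) (Nat.succ_pos m) (show 1 ≤ digit (m + 1)
    (u - (m + 1) ^ (cls i + 2)) 1 by omega)
  rw [pow_one] at e
  rw [rejectState, e, e1, digit_sub_pow (Nat.succ_pos m) hd]
  split_ifs with h2 h3
  · rfl
  · rw [h3]
  · rfl

theorem availableAt_rejectState :
    availableAt p cls D m (rejectState cls m u i) = (availableAt p cls D m u).erase i := by
  have hc := mem_candidates_availableAt.1 hi
  have hr : rankIn cls p i < m := hc.1.2
  ext x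
  rw [Finset.mem_erase, mem_availableAt, mem_availableAt, digit_rejectState hi h1,
    if_neg (by omega)]
  by_cases hx : x = i
  · subst hx
    rw [if_pos rfl]
    simp only [ne_eq, not_true_eq_false, false_and, iff_false, not_not]
    exact ⟨hc.1, by omega⟩
  · simp only [ne_eq, hx, not_false_eq_true, true_and]
    by_cases hcx : cls x = cls i
    · rw [if_pos (by omega), hcx]
      have hne : rankIn cls p x ≠ rankIn cls p i := fun h => hx (rankIn_inj hcx h)
      have : rankIn cls p x + (digit (m + 1) u (cls i + 2) - 1) < m ↔
          rankIn cls p x + digit (m + 1) u (cls i + 2) < m := by omega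
      rw [this]
    · rw [if_neg (by omega)]

end reject

theorem digit_sub_one (h0 : 1 ≤ digit (m + 1) u 0) (x : ℕ) :
    digit (m + 1) (u - 1) x = if x = 0 then digit (m + 1) u 0 - 1 else digit (m + 1) u x := by
  have := digit_sub_pow (y := x) (Nat.succ_pos m) h0
  rwa [pow_zero] at this

theorem availableAt_sub_one (h0 : 1 ≤ digit (m + 1) u 0) :
    availableAt p cls D m (u - 1) = availableAt p cls D m u := by
  ext x
  rw [mem_availableAt, mem_availableAt, digit_sub_one h0, if_neg (by omega)]

/-- The best reward of a class-ordered policy from the state number `u`: the digit number `0` is the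
number of positions and the digit number `1` is the number of stages. -/
noncomputable def stateVal (p v : Fin n → ℝ) (cls : Fin n → ℕ) (D m u : ℕ) : ℝ :=
  classVal p v cls D m (digit (m + 1) u 1) (digit (m + 1) u 0) (availableAt p cls D m u)

/-- The expected reward when the next offer, with `a` stages and `κ` positions left and available
set `A`, goes to `i`, and an optimal class-ordered policy takes over thereafter. -/
noncomputable def offerVal (p v : Fin n → ℝ) (cls : Fin n → ℕ) (D m a κ : ℕ) (A : Finset (Fin n))
    (i : Fin n) : ℝ :=
  p i * (v i + classVal p v cls D m (a - 1) (κ - 1) (A.erase i)) +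
    (1 - p i) * classVal p v cls D m (a - 1) κ (A.erase i)

theorem classVal_eq_zero {a κ : ℕ} {A : Finset (Fin n)}
    (h : a = 0 ∨ κ = 0 ∨ candidates p cls D m A = ∅) : classVal p v cls D m a κ A = 0 := by
  rcases h with rfl | rfl | h
  · exact bestVal_zero_stages _ _
  · exact bestVal_zero_positions _ _
  · exact bestVal_of_empty h

theorem offerVal_le {a κ : ℕ} (ha : 1 ≤ a) (hκ : 1 ≤ κ) {A : Finset (Fin n)} {i : Fin n}
    (hi : i ∈ candidates p cls D m A) :
    offerVal p v cls D m a κ A i ≤ classVal p v cls D m a κ A := by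
  obtain ⟨a, rfl⟩ := Nat.exists_eq_add_of_le' ha
  obtain ⟨κ, rfl⟩ := Nat.exists_eq_add_of_le' hκ
  refine le_trans (le_of_eq ?_) (le_bestVal hi)
  simp only [offerVal, classVal, Nat.add_sub_cancel]
  ring

theorem exists_offerVal_eq {a κ : ℕ} (ha : 1 ≤ a) (hκ : 1 ≤ κ) {A : Finset (Fin n)}
    (hne : (candidates p cls D m A).Nonempty) :
    ∃ i ∈ candidates p cls D m A, classVal p v cls D m a κ A = offerVal p v cls D m a κ A i := by
  obtain ⟨a, rfl⟩ := Nat.exists_eq_add_of_le' ha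
  obtain ⟨κ, rfl⟩ := Nat.exists_eq_add_of_le' hκ
  obtain ⟨i, hi, e⟩ := exists_bestVal_eq (gain := fun i => p i * v i) (acc := p) hne a κ
  refine ⟨i, hi, e.trans ?_⟩
  change p i * v i + p i * classVal p v cls D m a κ _ +
    (1 - p i) * classVal p v cls D m a (κ + 1) _ = _
  simp only [offerVal, Nat.add_sub_cancel]
  ring

/-- The applicant `i` is a best one to receive the next offer; ties are broken in favor of larger
classes, as in a loop over the classes that replaces the best offer so far by one that is as good. -/
def IsBestOffer (p v : Fin n → ℝ) (cls : Fin n → ℕ) (D m a κ : ℕ) (A : Finset (Fin n))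
    (i : Fin n) : Prop :=
  i ∈ candidates p cls D m A ∧ ∀ j ∈ candidates p cls D m A,
    offerVal p v cls D m a κ A j < offerVal p v cls D m a κ A i ∨
      (offerVal p v cls D m a κ A j = offerVal p v cls D m a κ A i ∧ cls j ≤ cls i)

theorem exists_isBestOffer (p v : Fin n → ℝ) (cls : Fin n → ℕ) (D m a κ : ℕ) (A : Finset (Fin n))
    (hne : (candidates p cls D m A).Nonempty) : ∃ i, IsBestOffer p v cls D m a κ A i := by
  obtain ⟨i, hi, h⟩ := Finset.exists_max_image (candidates p cls D m A)
    (fun i => toLex (offerVal p v cls D m a κ A i, cls i)) hne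
  refine ⟨i, hi, fun j hj => ?_⟩
  have := h j hj
  rwa [Prod.Lex.toLex_le_toLex] at this

theorem IsBestOffer.eq {a κ : ℕ} {i j : Fin n}
    (hi : IsBestOffer p v cls D m a κ (availableAt p cls D m u) i)
    (hj : IsBestOffer p v cls D m a κ (availableAt p cls D m u) j) : i = j := by
  refine candidate_unique hi.1 hj.1 ?_
  rcases hi.2 j hj.1 with h1 | h1 <;> rcases hj.2 i hi.1 with h2 | h2
  · exact absurd (h1.trans h2) (lt_irrefl _)
  · exact absurd h2.1 h1.ne'
  · exact absurd h1.1 h2.ne'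
  · exact le_antisymm h2.2 h1.2

theorem IsBestOffer.classVal_eq {a κ : ℕ} (ha : 1 ≤ a) (hκ : 1 ≤ κ) {A : Finset (Fin n)} {i : Fin n}
    (hi : IsBestOffer p v cls D m a κ A i) :
    classVal p v cls D m a κ A = offerVal p v cls D m a κ A i := by
  obtain ⟨j, hj, e⟩ := exists_offerVal_eq (v := v) ha hκ ⟨i, hi.1⟩
  refine le_antisymm ?_ (offerVal_le ha hκ hi.1)
  rw [e]
  rcases hi.2 j hj with h | h
  · exact h.le
  · exact h.1.le

theorem offerVal_nonneg (hp : ∀ i, 0 ≤ p i) (hp1 : ∀ i, p i ≤ 1) (hv : ∀ i, 0 ≤ v i) (a κ : ℕ)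
    (A : Finset (Fin n)) (i : Fin n) : 0 ≤ offerVal p v cls D m a κ A i := by
  have hw : ∀ i, 0 ≤ p i * v i := fun i => mul_nonneg (hp i) (hv i)
  have h0 : ∀ a κ A, 0 ≤ classVal p v cls D m a κ A := fun a κ A => bestVal_nonneg hw hp hp1 a κ A
  exact add_nonneg (mul_nonneg (hp i) (add_nonneg (hv i) (h0 _ _ _)))
    (mul_nonneg (sub_nonneg.2 (hp1 i)) (h0 _ _ _))

theorem offerVal_eq_stateVal {i : Fin n}
    (hi : i ∈ candidates p cls D m (availableAt p cls D m u)) (h0 : 1 ≤ digit (m + 1) u 0)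
    (h1 : 1 ≤ digit (m + 1) u 1) :
    offerVal p v cls D m (digit (m + 1) u 1) (digit (m + 1) u 0) (availableAt p cls D m u) i =
      p i * (v i + stateVal p v cls D m (rejectState cls m u i - 1)) +
        (1 - p i) * stateVal p v cls D m (rejectState cls m u i) := by
  have hd0 : digit (m + 1) (rejectState cls m u i) 0 = digit (m + 1) u 0 := by
    rw [digit_rejectState hi h1, if_neg (by omega), if_neg (by omega)]
  have hd1 : digit (m + 1) (rejectState cls m u i) 1 = digit (m + 1) u 1 - 1 := by
    rw [digit_rejectState hi h1, if_pos rfl]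
  have hs : 1 ≤ digit (m + 1) (rejectState cls m u i) 0 := by omega
  rw [offerVal, stateVal, stateVal, digit_sub_one hs, digit_sub_one hs, availableAt_sub_one hs,
    availableAt_rejectState hi h1, hd0, hd1]
  simp

end states

/-! ### The dynamic program -/

/-- The table names the candidate of each class for each value of its digit. -/
structure TableOK (I : Instance) (c : Params) (cls : Fin I.n → ℕ) (s : Mem) : Prop where
  entry : ∀ i : Fin I.n, Retained cls (rankIn cls I.p) c.D c.m i →
    s.nat nTab (cls i * c.R + (c.m - rankIn cls I.p i)) = i + 1
  of_ne : ∀ x < c.D * c.R, s.nat nTab x ≠ 0 → ∃ i : Fin I.n,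
    Retained cls (rankIn cls I.p) c.D c.m i ∧
      x = cls i * c.R + (c.m - rankIn cls I.p i) ∧ s.nat nTab x = i + 1

theorem TableOK.zero {I : Instance} {c : Params} {cls : Fin I.n → ℕ} {s : Mem} {u j : ℕ}
    (h : TableOK I c cls s) (h0 : s.nat nTab (j * c.R + digit c.R u (j + 2)) = 0)
    {i : Fin I.n} (hi : i ∈ candidates I.p cls c.D c.m (availableAt I.p cls c.D c.m u)) :
    cls i ≠ j := by
  rintro rfl
  rw [mem_candidates_availableAt] at hi
  have := h.entry i hi.1
  have e : c.m - rankIn cls I.p i = digit c.R u (cls i + 2) := by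
    have := hi.2
    change _ = digit (c.m + 1) u _
    omega
  rw [e, h0] at this
  omega

theorem TableOK.succ {I : Instance} {c : Params} {cls : Fin I.n → ℕ} {s : Mem} {u j : ℕ}
    (h : TableOK I c cls s) (hj : j < c.D)
    (h0 : s.nat nTab (j * c.R + digit c.R u (j + 2)) ≠ 0) :
    ∃ i ∈ candidates I.p cls c.D c.m (availableAt I.p cls c.D c.m u), cls i = j ∧
      s.nat nTab (j * c.R + digit c.R u (j + 2)) = i + 1 := by
  have hR : 0 < c.R := Nat.succ_pos _
  have hd : digit c.R u (j + 2) < c.R := digit_lt hR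
  obtain ⟨i, hi, he, ht⟩ := h.of_ne _ (by nlinarith) h0
  have hlt : c.m - rankIn cls I.p i < c.R := by
    show _ < c.m + 1
    omega
  have e1 := congrArg (· / c.R) he
  have e2 := congrArg (· % c.R) he
  simp only [mul_comm _ c.R, Nat.mul_add_div hR, Nat.div_eq_of_lt hlt, Nat.div_eq_of_lt hd,
    add_zero] at e1
  simp only [mul_comm _ c.R, Nat.mul_add_mod, Nat.mod_eq_of_lt hlt, Nat.mod_eq_of_lt hd] at e2
  refine ⟨i, ?_, e1.symm, ht⟩
  rw [mem_candidates_availableAt, ← e1]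
  refine ⟨hi, ?_⟩
  have := hi.2
  change digit (c.m + 1) u _ = _ at e2
  omega

theorem chooseOffer_ensures {I : Instance} {c : Params} {s : Mem} {cls : Fin I.n → ℕ} {u : ℕ}
    (h : Ready I c s) (ht : TableOK I c cls s) (hu : s.nat nU 0 = u)
    (hdig : ∀ x < c.D + 2, s.nat nDig x = digit c.R u x)
    (hval : ∀ x < u, s.real rVal x = stateVal I.p I.v cls c.D c.m x) (hz : s.real rVal u = 0)
    (h0 : 1 ≤ digit c.R u 0) (h1 : 1 ≤ digit c.R u 1) :
    chooseOffer.Ensures s (c.D * 162 + 20) fun s' =>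
      (∀ x ≠ u, s'.real rVal x = s.real rVal x ∧ s'.nat nApp x = s.nat nApp x ∧
        s'.nat nAcc x = s.nat nAcc x ∧ s'.nat nRej x = s.nat nRej x) ∧
      s'.real rVal u = stateVal I.p I.v cls c.D c.m u ∧
      ((candidates I.p cls c.D c.m (availableAt I.p cls c.D c.m u) = ∅ ∧
          s'.nat nApp u = s.nat nApp u ∧ s'.nat nAcc u = s.nat nAcc u ∧
          s'.nat nRej u = s.nat nRej u) ∨
        ∃ i, IsBestOffer I.p I.v cls c.D c.m (digit c.R u 1) (digit c.R u 0)
            (availableAt I.p cls c.D c.m u) i ∧ s'.nat nApp u = i ∧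
          s'.nat nAcc u = rejectState cls c.m u i - 1 ∧
          s'.nat nRej u = rejectState cls c.m u i) := by
  set cand := candidates I.p cls c.D c.m (availableAt I.p cls c.D c.m u) with hcand
  set offer := offerVal I.p I.v cls c.D c.m (digit c.R u 1) (digit c.R u 0)
    (availableAt I.p cls c.D c.m u) with hoffer
  have hoffer0 : ∀ i, 0 ≤ offer i := fun i =>
    offerVal_nonneg I.p_nonneg I.p_le_one I.v_nonneg _ _ _ i
  refine Prog.Ensures.setN_seq (B₂ := c.D * 162 + 12) (by simp; omega) ?_
  refine Prog.Ensures.mono (Prog.Ensures.forLoop (B := 150) (N := c.D)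
    (fun j s' => s'.nat nAddr 0 = j * c.R ∧
      (∀ x ≠ u, s'.real rVal x = s.real rVal x ∧ s'.nat nApp x = s.nat nApp x ∧
        s'.nat nAcc x = s.nat nAcc x ∧ s'.nat nRej x = s.nat nRej x) ∧
      (((∀ i ∈ cand, ¬ cls i < j) ∧ s'.real rVal u = 0 ∧
          s'.nat nApp u = s.nat nApp u ∧ s'.nat nAcc u = s.nat nAcc u ∧
          s'.nat nRej u = s.nat nRej u) ∨
        ∃ i ∈ cand, (∀ i' ∈ cand, cls i' < j →
            offer i' < offer i ∨ (offer i' = offer i ∧ cls i' ≤ cls i)) ∧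
          s'.real rVal u = offer i ∧ s'.nat nApp u = i ∧
          s'.nat nAcc u = rejectState cls c.m u i - 1 ∧
          s'.nat nRej u = rejectState cls c.m u i))
    (by decide) (by decide) (by simp [h.d_eq]) ?_ ?_) le_rfl ?_
  · simp [hz]
  · rintro j hj s' hag hij ⟨haddr, hoff, hinv⟩
    have hr : Ready I c s' := by
      refine Ready.of_agree (l := [nAddr]) (r := []) (s := s) h ?_ (by decide) (by decide) |>.of_agree
        hag (by decide) (by decide)
      exact ⟨fun a ha => Mem.putN_nat_of_ne _ _ _ (by simpa using ha), fun a _ => rfl⟩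
    have hu' : s'.nat nU 0 = u := by
      rw [hag.1 _ (by decide)]
      simp [hu]
    have hdig' : s'.nat nDig (j + 2) = digit c.R u (j + 2) := by
      rw [hag.1 _ (by decide)]
      simp [hdig (j + 2) (by omega)]
    have htab : s'.nat nTab = s.nat nTab := by
      rw [hag.1 _ (by decide)]
      ext x
      simp
    refine Prog.Ensures.setN_seq (B₂ := 135) (by simp) ?_
    have hx : ((NExp.get nTab ((NExp.var nAddr).add (NExp.get nDig
        ((NExp.var nJ).add (NExp.const 2))))).eval s') =
        s.nat nTab (j * c.R + digit c.R u (j + 2)) := by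
      simp [haddr, hij, hdig', htab]
    rw [hx]
    refine Prog.Ensures.mono_bound (Prog.Ensures.seq (B := 120) (B' := 8)
      (Prog.Ensures.ite_of (B₁ := 115) (by simp) (fun hb => ?_) fun hb => ?_)) (by omega)
    · simp at hb
      refine Prog.Ensures.mono_bound (Prog.Ensures.skip (Prog.Ensures.setN ?_ (by simp))) (by omega)
      have hstep : ∀ i ∈ cand, cls i < j + 1 ↔ cls i < j := fun i hi => by
        have := ht.zero hb hi
        omega
      refine ⟨by simp [haddr, hr.r_eq]; ring, by simpa using hoff, ?_⟩
      rcases hinv with hinv | ⟨i, hi, hinv⟩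
      · refine Or.inl ⟨fun i hi => by rw [hstep i hi]; exact hinv.1 i hi, ?_⟩
        simpa using hinv.2
      · refine Or.inr ⟨i, hi, fun i' hi' hlt => hinv.1 i' hi' ((hstep i' hi').1 hlt), ?_⟩
        simpa using hinv.2
    · have hb' : s.nat nTab (j * c.R + digit c.R u (j + 2)) ≠ 0 := by
        intro h
        rw [h] at hb
        simp at hb
      obtain ⟨i, hi, hci, hti⟩ := ht.succ hj hb'
      rw [hti]
      have hp := hr.prob_eq i
      have hv := hr.val_eq i
      have hstr := hr.str_eq (j + 2) (by omega)
      have hR := hr.r_eq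
      have hrej : rejectState cls c.m u i = u - c.R ^ (j + 2) - c.R := by
        rw [rejectState, hci]
        rfl
      have hlt : rejectState cls c.m u i < u := rejectState_lt h1
      have hv1 : s'.real rVal (rejectState cls c.m u i) =
          stateVal I.p I.v cls c.D c.m (rejectState cls c.m u i) := by
        rw [(hoff _ hlt.ne).1, hval _ hlt]
      have hv2 : s'.real rVal (rejectState cls c.m u i - 1) =
          stateVal I.p I.v cls c.D c.m (rejectState cls c.m u i - 1) := by
        rw [(hoff _ (by omega)).1, hval _ (by omega)]
      have hoi : offer i = I.p i * (I.v i + stateVal I.p I.v cls c.D c.m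
          (rejectState cls c.m u i - 1)) + (1 - I.p i) *
          stateVal I.p I.v cls c.D c.m (rejectState cls c.m u i) :=
        offerVal_eq_stateVal hi h0 h1
      obtain ⟨w, hw⟩ : ∃ w, rejectState cls c.m u i = w := ⟨_, rfl⟩
      rw [hw] at hrej hlt hv1 hv2 hoi
      rw [← hv1, ← hv2] at hoi
      refine Prog.Ensures.setN_seq (B₂ := 105) (by simp) ?_
      refine Prog.Ensures.setN_seq (B₂ := 85) (by simp) ?_
      refine Prog.Ensures.setR_seq (B₂ := 45) (by simp) ?_
      refine Prog.Ensures.ite_of (B₁ := 35) (by simp) (fun hc => ?_) fun hc => ?_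
      · have hc' : s'.real rVal u ≤ offer i := by
          rw [hoi]
          simpa [hu', hp, hv, hstr, hR, hij, ← hrej] using hc
        refine Prog.Ensures.setR_seq (B₂ := 28) (by simp) ?_
        refine Prog.Ensures.setN_seq (B₂ := 22) (by simp) ?_
        refine Prog.Ensures.setN_seq (B₂ := 12) (by simp) ?_
        refine Prog.Ensures.setN (Prog.Ensures.setN ?_ (by simp)) (by simp)
        refine ⟨by simp [haddr, hR]; ring, fun x hx => ?_, Or.inr ⟨i, hi, fun i' hi' hlt' => ?_, ?_⟩⟩
        · simpa [hu', hx] using hoff x hx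
        · rcases Nat.lt_succ_iff_lt_or_eq.1 hlt' with hlt' | he
          · have hle : offer i' ≤ offer i := by
              rcases hinv with hinv | ⟨i₀, hi₀, hinv, hval₀, -⟩
              · exact absurd hlt' (hinv.1 i' hi')
              · rw [hval₀] at hc'
                rcases hinv i' hi' hlt' with h | h
                · exact h.le.trans hc'
                · exact h.1.le.trans hc'
            rcases hle.lt_or_eq with h | h
            · exact Or.inl h
            · exact Or.inr ⟨h, by omega⟩
          · obtain rfl := candidate_unique hi' hi (he.trans hci.symm)
            exact Or.inr ⟨rfl, le_rfl⟩
        · simp [hu', hp, hv, hstr, hR, hij, ← hrej, hoi, hw]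
      · have hc' : offer i < s'.real rVal u := by
          rw [hoi]
          simpa [hu', hp, hv, hstr, hR, hij, ← hrej] using hc
        refine Prog.Ensures.mono_bound (Prog.Ensures.skip (Prog.Ensures.setN ?_ (by simp))) (by omega)
        refine ⟨by simp [haddr, hR]; ring, fun x hx => ?_, ?_⟩
        · simpa using hoff x hx
        rcases hinv with hinv | ⟨i₀, hi₀, hinv, hval₀, hinv'⟩
        · rw [hinv.2.1] at hc'
          exact absurd (hoffer0 i) (not_le.2 hc')
        · refine Or.inr ⟨i₀, hi₀, fun i' hi' hlt' => ?_, by simpa using ⟨hval₀, hinv'⟩⟩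
          rcases Nat.lt_succ_iff_lt_or_eq.1 hlt' with hlt' | he
          · exact hinv i' hi' hlt'
          · obtain rfl := candidate_unique hi' hi (he.trans hci.symm)
            rw [hval₀] at hc'
            exact Or.inl hc'
  · rintro s' ⟨-, hoff, hinv⟩
    refine ⟨hoff, ?_⟩
    have hlt : ∀ i ∈ cand, cls i < c.D := fun i hi => (mem_candidates_availableAt.1 hi).1.1
    rcases hinv with hinv | ⟨i, hi, hinv, hv, hinv'⟩
    · have : cand = ∅ := Finset.eq_empty_of_forall_notMem fun i hi => hinv.1 i hi (hlt i hi)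
      refine ⟨?_, Or.inl ⟨this, hinv.2.2⟩⟩
      rw [hinv.2.1]
      exact (classVal_eq_zero (Or.inr (Or.inr this))).symm
    · have hbest : IsBestOffer I.p I.v cls c.D c.m (digit c.R u 1) (digit c.R u 0)
          (availableAt I.p cls c.D c.m u) i := ⟨hi, fun i' hi' => hinv i' hi' (hlt i' hi')⟩
      exact ⟨hv.trans (hbest.classVal_eq h1 h0).symm, Or.inr ⟨i, hbest, hinv'⟩⟩

theorem digit_succ {R u x : ℕ} (hR : 0 < R) : digit R (u + 1) x =
    if R ^ x ≤ u % R ^ x + 1 then (if R ≤ digit R u x + 1 then 0 else digit R u x + 1)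
      else digit R u x := by
  rw [digit, (succ_mod_div (pow_pos hR x)).2, digit]
  split_ifs with h h'
  · rw [(succ_mod_div hR).1, if_pos h']
  · rw [(succ_mod_div hR).1, if_neg h']
  · rfl

theorem countUp_ensures {I : Instance} {c : Params} {s : Mem} {u : ℕ} (h : Ready I c s)
    (hdig : ∀ x < c.D + 2, s.nat nDig x = digit c.R u x)
    (hctr : ∀ x < c.D + 2, s.nat nCtr x = u % c.R ^ x) :
    countUp.Ensures s ((c.D + 2) * 72 + 12) fun s' =>
      ∀ x < c.D + 2, s'.nat nDig x = digit c.R (u + 1) x ∧ s'.nat nCtr x = (u + 1) % c.R ^ x := by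
  have hR : 0 < c.R := Nat.succ_pos _
  refine Prog.Ensures.mono (Prog.Ensures.forLoop (B := 60) (N := c.D + 2)
    (fun j s' => ∀ x < c.D + 2, s'.nat nDig x = digit c.R (if x < j then u + 1 else u) x ∧
      s'.nat nCtr x = (if x < j then u + 1 else u) % c.R ^ x)
    (by decide) (by decide) (by simp [h.dtwo_eq]) (fun x hx => by simp [hdig x hx, hctr x hx]) ?_)
    le_rfl fun s' h x hx => by simpa [hx] using h x hx
  intro j hj s' hag hij hinv
  have hr : Ready I c s' := h.of_agree hag (by decide) (by decide)
  have hd := (hinv j hj).1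
  have hc := (hinv j hj).2
  simp only [lt_irrefl, if_false] at hd hc
  have hstr := hr.str_eq j hj.le
  have key : ∀ s₁ : Mem, s₁.nat nDig j = digit c.R (u + 1) j → s₁.nat nCtr j = (u + 1) % c.R ^ j →
      (∀ x ≠ j, s₁.nat nDig x = s'.nat nDig x ∧ s₁.nat nCtr x = s'.nat nCtr x) →
      ∀ x < c.D + 2, s₁.nat nDig x = digit c.R (if x < j + 1 then u + 1 else u) x ∧
        s₁.nat nCtr x = (if x < j + 1 then u + 1 else u) % c.R ^ x := by
    intro s₁ h1 h2 h3 x hx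
    by_cases hxj : x = j
    · subst hxj
      simp [h1, h2]
    · have : x < j + 1 ↔ x < j := by omega
      simp only [this, h3 x hxj]
      exact hinv x hx
  refine Prog.Ensures.setN_seq (B₂ := 48) (by simp) ?_
  refine Prog.Ensures.ite_of (B₁ := 40) (by simp) (fun h1 => ?_) fun h1 => ?_
  · simp [hij, hstr, hc] at h1
    refine Prog.Ensures.setN_seq (B₂ := 35) (by simp) ?_
    refine Prog.Ensures.setN_seq (B₂ := 25) (by simp) ?_
    refine Prog.Ensures.ite_of (B₁ := 15) (by simp) (fun h2 => ?_) fun h2 => ?_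
    · simp [hij, hd, hr.r_eq] at h2
      refine Prog.Ensures.setN ?_ (by simp)
      refine key _ ?_ ?_ fun x hx => by simp [hij, hx]
      · simp [hij, digit_succ hR, h1, h2]
      · simp [hij, succ_mod_div (pow_pos hR j), h1]
    · simp [hij, hd, hr.r_eq] at h2
      refine Prog.Ensures.mono_bound (Prog.Ensures.skip ?_) (by omega)
      refine key _ ?_ ?_ fun x hx => by simp [hij, hx]
      · simp [hij, digit_succ hR, h1, not_le.2 h2, hd]
      · simp [hij, succ_mod_div (pow_pos hR j), h1]
  · simp [hij, hstr, hc] at h1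
    refine Prog.Ensures.mono_bound (Prog.Ensures.skip ?_) (by omega)
    refine key _ ?_ ?_ fun x hx => by simp [hij, hx]
    · simp [digit_succ hR, not_le.2 h1, hd]
    · simp [hij, succ_mod_div (pow_pos hR j), not_le.2 h1, hc]

/-- The memory holds the value of the state number `u`, and the node number `u` makes a best offer
and passes on to the nodes of the next states. If there are no candidates, it makes the first offer
of the chain at the end of the diagram. -/
structure NodeOK (I : Instance) (c : Params) (cls : Fin I.n → ℕ) (s : Mem) (u : ℕ) : Prop where
  val_eq : s.real rVal u = stateVal I.p I.v cls c.D c.m u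
  node : 1 ≤ digit c.R u 0 → 1 ≤ digit c.R u 1 →
    (candidates I.p cls c.D c.m (availableAt I.p cls c.D c.m u) = ∅ ∧
        s.nat nApp u = s.nat nApp c.size ∧ s.nat nAcc u = c.size + 1 ∧
        s.nat nRej u = c.size + 1) ∨
      ∃ i, IsBestOffer I.p I.v cls c.D c.m (digit c.R u 1) (digit c.R u 0)
          (availableAt I.p cls c.D c.m u) i ∧ s.nat nApp u = i ∧
        s.nat nAcc u = rejectState cls c.m u i - 1 ∧ s.nat nRej u = rejectState cls c.m u i

theorem solveStates_ensures {I : Instance} {c : Params} {s : Mem} {cls : Fin I.n → ℕ}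
    (h : Ready I c s) (ht : TableOK I c cls s) :
    solveStates.Ensures s (c.size * (c.D * 240 + 350) + c.D * 30 + 100) fun s' =>
      (∀ u < c.size, NodeOK I c cls s' u) ∧ ∀ x ≥ c.size, s'.nat nApp x = s.nat nApp x ∧
        s'.nat nAcc x = s.nat nAcc x ∧ s'.nat nRej x = s.nat nRej x := by
  refine Prog.Ensures.seq_of (B₁ := (c.D + 2) * (10 + 12) + 12)
    (B₂ := c.size * ((c.D * 240 + 338) + 12) + 12)
    (Prog.Ensures.forLoop (N := c.D + 2) (fun j s' => ∀ x < j, s'.nat nDig x = 0 ∧ s'.nat nCtr x = 0)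
      (by decide) (by decide) (by simp [h.dtwo_eq]) (by simp) ?_) ?_ ?_
  · intro j hj s' hag hij hinv
    refine Prog.Ensures.setN_seq (B₂ := 5) (by simp) (Prog.Ensures.setN ?_ (by simp))
    intro x hx
    by_cases hxj : x = j
    · simp [hxj, hij]
    · simpa [hxj, hij] using hinv x (by omega)
  · linarith
  intro s₁ hag₁ hinit
  have hr₁ : Ready I c s₁ := h.of_agree hag₁ (by decide) (by decide)
  have e₁ : ∀ a, a ≠ nDig → a ≠ nCtr → a ≠ nJ → s₁.nat a = s.nat a := fun a h1 h2 h3 =>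
    hag₁.1 a (by simp [Prog.forLoop, h1, h2, h3])
  refine Prog.Ensures.mono (Prog.Ensures.forLoop (B := c.D * 240 + 338) (N := c.size)
    (fun u s' => (∀ x < c.D + 2, s'.nat nDig x = digit c.R u x ∧ s'.nat nCtr x = u % c.R ^ x) ∧
      (∀ x < u, NodeOK I c cls s' x) ∧ ∀ x ≥ c.size, s'.nat nApp x = s.nat nApp x ∧
        s'.nat nAcc x = s.nat nAcc x ∧ s'.nat nRej x = s.nat nRej x)
    (by decide) (by decide) (by simp [hr₁.size_eq]) ?_ ?_) le_rfl fun s' h => h.2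
  · refine ⟨fun x hx => ?_, by simp, fun x _ => ?_⟩
    · simp [hinit x hx, digit]
    · simp [e₁]
  rintro u hu s' hag hiu ⟨hdc, hnode, hchain⟩
  have hr : Ready I c s' := hr₁.of_agree hag (by decide) (by decide)
  have htab : TableOK I c cls s' := by
    have e : s'.nat nTab = s.nat nTab := by
      rw [hag.1 _ (by decide), e₁ _ (by decide) (by decide) (by decide)]
    exact ⟨fun i hi => by rw [e]; exact ht.entry i hi, fun x hx => by rw [e]; exact ht.of_ne x hx⟩
  refine Prog.Ensures.setR_seq (B₂ := c.D * 240 + 330) (by simp; omega) ?_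
  refine Prog.Ensures.setN_seq (B₂ := c.D * 240 + 320) (by simp; omega) ?_
  refine Prog.Ensures.setN_seq (B₂ := c.D * 240 + 310) (by simp; omega) ?_
  refine Prog.Ensures.setN_seq (B₂ := c.D * 240 + 300) (by simp; omega) ?_
  simp only [NExp.eval, NExp.var, RExp.eval, Mem.putR_nat, Mem.putN_nat, hiu, hr.size_eq]
  norm_num
  set s₂ := (((s'.putR rVal u 0).putN nApp u (s'.nat nApp c.size)).putN nAcc u
    (c.size + 1)).putN nRej u (c.size + 1) with hs₂
  have hag₂ : Mem.AgreeOff [nApp, nAcc, nRej] [rVal] s' s₂ := by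
    refine ⟨fun a ha => ?_, fun a ha => ?_⟩
    · simp only [List.mem_cons, List.not_mem_nil, or_false, not_or] at ha
      rw [hs₂, Mem.putN_nat_of_ne _ _ _ ha.2.2, Mem.putN_nat_of_ne _ _ _ ha.2.1,
        Mem.putN_nat_of_ne _ _ _ ha.1, Mem.putR_nat]
    · simp only [List.mem_cons, List.not_mem_nil, or_false] at ha
      rw [hs₂, Mem.putN_real, Mem.putN_real, Mem.putN_real, Mem.putR_real_of_ne _ _ _ ha]
  have hr₂ : Ready I c s₂ := hr.of_agree hag₂ (by decide) (by decide)
  have htab₂ : TableOK I c cls s₂ := by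
    have e : s₂.nat nTab = s'.nat nTab := hag₂.1 _ (by decide)
    exact ⟨fun i hi => by rw [e]; exact htab.entry i hi,
      fun x hx => by rw [e]; exact htab.of_ne x hx⟩
  have hu₂ : s₂.nat nU 0 = u := by rw [hag₂.1 _ (by decide), hiu]
  have hdc₂ : ∀ x < c.D + 2, s₂.nat nDig x = digit c.R u x ∧ s₂.nat nCtr x = u % c.R ^ x := by
    rw [hag₂.1 _ (by decide), hag₂.1 _ (by decide)]
    exact hdc
  have hval₂ : ∀ x < u, s₂.real rVal x = stateVal I.p I.v cls c.D c.m x := fun x hx => by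
    rw [← (hnode x hx).val_eq]
    simp [hs₂, hx.ne]
  have hoff₂ : ∀ x ≠ u, s₂.real rVal x = s'.real rVal x ∧ s₂.nat nApp x = s'.nat nApp x ∧
      s₂.nat nAcc x = s'.nat nAcc x ∧ s₂.nat nRej x = s'.nat nRej x := fun x hx => by
    simp [hs₂, hx]
  have hnew₂ : s₂.real rVal u = 0 ∧ s₂.nat nApp u = s'.nat nApp c.size ∧
      s₂.nat nAcc u = c.size + 1 ∧ s₂.nat nRej u = c.size + 1 := by
    simp [hs₂]
  clear_value s₂
  -- the entries of the other states do not change, and those of the new state are right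
  have hblock : ∀ s₃ : Mem, (∀ x ≠ u, s₃.real rVal x = s₂.real rVal x ∧
      s₃.nat nApp x = s₂.nat nApp x ∧ s₃.nat nAcc x = s₂.nat nAcc x ∧
      s₃.nat nRej x = s₂.nat nRej x) → NodeOK I c cls s₃ u →
      (∀ x < u + 1, NodeOK I c cls s₃ x) ∧ ∀ x ≥ c.size, s₃.nat nApp x = s.nat nApp x ∧
        s₃.nat nAcc x = s.nat nAcc x ∧ s₃.nat nRej x = s.nat nRej x := by
    intro s₃ hoff hok
    have hoff' : ∀ x ≠ u, s₃.real rVal x = s'.real rVal x ∧ s₃.nat nApp x = s'.nat nApp x ∧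
      s₃.nat nAcc x = s'.nat nAcc x ∧ s₃.nat nRej x = s'.nat nRej x := fun x hx => by
      obtain ⟨h1, h2, h3, h4⟩ := hoff x hx
      obtain ⟨h1', h2', h3', h4'⟩ := hoff₂ x hx
      exact ⟨h1.trans h1', h2.trans h2', h3.trans h3', h4.trans h4'⟩
    refine ⟨fun x hx => ?_, fun x hx => ?_⟩
    · rcases Nat.lt_succ_iff_lt_or_eq.1 hx with hx | rfl
      · obtain ⟨h1, h2, h3, h4⟩ := hoff' x hx.ne
        refine ⟨h1.trans (hnode x hx).val_eq, ?_⟩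
        rw [h2, h3, h4, (hoff' c.size hu.ne').2.1]
        exact (hnode x hx).node
      · exact hok
    · obtain ⟨h1, h2, h3, h4⟩ := hoff' x (by omega)
      rw [h2, h3, h4]
      exact hchain x hx
  have htriv : digit c.R u 0 = 0 ∨ digit c.R u 1 = 0 → NodeOK I c cls s₂ u := by
    intro hz
    refine ⟨?_, fun h0 h1 => by omega⟩
    rw [hnew₂.1, stateVal]
    refine (classVal_eq_zero ?_).symm
    rcases hz with hz | hz
    · exact Or.inr (Or.inl hz)
    · exact Or.inl hz
  refine Prog.Ensures.seq_of (B₁ := c.D * 162 + 40) (B₂ := (c.D + 2) * 72 + 12)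
    (Q₁ := fun s₃ => (∀ x < u + 1, NodeOK I c cls s₃ x) ∧ ∀ x ≥ c.size,
      s₃.nat nApp x = s.nat nApp x ∧ s₃.nat nAcc x = s.nat nAcc x ∧ s₃.nat nRej x = s.nat nRej x)
    ?_ (by omega) ?_
  · have d0 := (hdc₂ 0 (by omega)).1
    have d1 := (hdc₂ 1 (by omega)).1
    refine Prog.Ensures.ite_of (B₁ := c.D * 162 + 30) (by simp; omega) (fun h1 => ?_) fun h1 => ?_
    · simp [d0] at h1
      exact (Prog.Ensures.skip (hblock s₂ (by simp) (htriv (Or.inl h1)))).mono_bound (by omega)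
    refine Prog.Ensures.ite_of (B₁ := c.D * 162 + 20) (by simp; omega) (fun h2 => ?_) fun h2 => ?_
    · simp [d1] at h2
      exact (Prog.Ensures.skip (hblock s₂ (by simp) (htriv (Or.inr h2)))).mono_bound (by omega)
    simp [d0] at h1
    simp [d1] at h2
    refine (chooseOffer_ensures hr₂ htab₂ hu₂ (fun x hx => (hdc₂ x hx).1) hval₂ hnew₂.1
      (by omega) (by omega)).mono le_rfl ?_
    rintro s₃ ⟨hoff, hv, hbest⟩
    refine hblock s₃ hoff ⟨hv, fun _ _ => ?_⟩
    rcases hbest with ⟨hc, h3, h4, h5⟩ | hbest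
    · refine Or.inl ⟨hc, ?_, ?_, ?_⟩
      · rw [h3, hnew₂.2.1, (hoff _ hu.ne').2.1, (hoff₂ _ hu.ne').2.1]
      · rw [h4, hnew₂.2.2.1]
      · rw [h5, hnew₂.2.2.2]
    · exact Or.inr hbest
  · rintro s₃ hag₃ ⟨hok, hch⟩
    have hr₃ : Ready I c s₃ := hr₂.of_agree hag₃ (by decide) (by decide)
    have hdc₃ : ∀ x < c.D + 2, s₃.nat nDig x = digit c.R u x ∧ s₃.nat nCtr x = u % c.R ^ x := by
      rw [hag₃.1 _ (by decide), hag₃.1 _ (by decide)]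
      exact hdc₂
    refine (countUp_ensures hr₃ (fun x hx => (hdc₃ x hx).1) fun x hx => (hdc₃ x hx).2).frame.mono
      le_rfl ?_
    rintro s₄ ⟨h4, hag₄⟩
    have ea := hag₄.1 nApp (by decide)
    have eb := hag₄.1 nAcc (by decide)
    have ec := hag₄.1 nRej (by decide)
    have ed := hag₄.2 rVal (by decide)
    refine ⟨by simpa using h4, fun x hx => ⟨?_, ?_⟩, ?_⟩
    · simpa [ed] using (hok x (by omega)).val_eq
    · simpa [ea, eb, ec] using (hok x (by omega)).node
    · simpa [ea, eb, ec] using hch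

instance {n : ℕ} (cls rank : Fin n → ℕ) (D m : ℕ) : DecidablePred (Retained cls rank D m) :=
  fun _ => inferInstanceAs (Decidable (_ ∧ _))

/-- The memory holds the solution for the classes `cls`. -/
structure Solved (I : Instance) (c : Params) (cls : Fin I.n → ℕ) (s : Mem) : Prop where
  node : ∀ u < c.size, NodeOK I c cls s u
  chain : ChainOK (fun i => ¬ Retained cls (rankIn cls I.p) c.D c.m i) c.size s

/-- A bound for the number of steps of `solve`. -/
def Params.solveBound (c : Params) (n : ℕ) : ℕ :=
  n * (c.L * 50 + c.V * 50 + 300) + n * (n * 70 + c.D * 30 + 200) + n * 62 + c.D * c.R * 20 +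
    c.size * (c.D * 240 + 350) + c.D * 30 + 200

theorem solve_ensures {I : Instance} {c : Params} {s : Mem} {X : ℝ} (h : Ready I c s)
    (hX : s.real rX 0 = X) :
    solve.Ensures s (c.solveBound I.n) (Solved I c (c.cls I X)) := by
  unfold Params.solveBound
  refine Prog.Ensures.seq_of (B₂ := I.n * (I.n * 70 + c.D * 30 + 200) + I.n * 62 + c.D * c.R * 20 +
    c.size * (c.D * 240 + 350) + c.D * 30 + 188) (classify_ensures h hX) (by omega) ?_
  intro s₁ hag₁ hcls
  have hr₁ : Ready I c s₁ := h.of_agree hag₁ (by decide) (by decide)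
  refine Prog.Ensures.seq_of (B₁ := c.D * c.R * 20 + 12) (B₂ := I.n * (I.n * 70 + c.D * 30 + 200) +
    I.n * 62 + c.size * (c.D * 240 + 350) + c.D * 30 + 170)
    (Prog.Ensures.mono (Prog.Ensures.forLoop (B := 8) (N := c.D * c.R)
      (fun j s' => ∀ x < j, s'.nat nTab x = 0) (by decide) (by decide) hr₁.dr_eq (by simp) ?_) le_rfl
      fun s' h => h) (by omega) ?_
  · intro j hj s' hag hij hinv
    refine Prog.Ensures.setN ?_ (by simp)
    intro x hx
    by_cases hxj : x = j
    · simp [hxj, hij]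
    · simpa [hxj, hij] using hinv x (by omega)
  intro s₂ hag₂ htab
  have hr₂ : Ready I c s₂ := hr₁.of_agree hag₂ (by decide) (by decide)
  refine Prog.Ensures.seq_of (B₂ := I.n * 62 + c.size * (c.D * 240 + 350) + c.D * 30 + 150)
    (fillTable_ensures hr₂ (cls := c.cls I X) (fun i => ?_) htab) (by omega) ?_
  · rw [hag₂.1 _ (by decide), hcls]
  rintro s₃ hag₃ ⟨hin, hout, hconv⟩
  have hr₃ : Ready I c s₃ := hr₂.of_agree hag₃ (by decide) (by decide)
  refine Prog.Ensures.seq_of (B₂ := c.size * (c.D * 240 + 350) + c.D * 30 + 100)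
    (writeChain_ensures hr₃
      (left := fun i => ¬ Retained (c.cls I X) (rankIn (c.cls I X) I.p) c.D c.m i) fun i => ?_)
    (by omega) ?_
  · refine ⟨hout i, fun h0 hi => ?_⟩
    rw [(hin i hi).2] at h0
    omega
  intro s₄ hag₄ hchain
  have hr₄ : Ready I c s₄ := hr₃.of_agree hag₄ (by decide) (by decide)
  have e₄ : s₄.nat nTab = s₃.nat nTab := hag₄.1 _ (by decide)
  refine (solveStates_ensures hr₄ (cls := c.cls I X) ⟨fun i hi => ?_, fun x hx h0 => ?_⟩).mono le_rfl
    ?_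
  · rw [e₄]
    exact (hin i hi).1
  · rw [e₄] at h0 ⊢
    exact hconv x hx h0
  · rintro s₅ ⟨hnode, hsame⟩
    refine ⟨hnode, fun i hi => ?_, fun i hi => ?_, fun i hi => ?_⟩
    · rw [(hsame _ (Nat.le_add_right _ _)).1]
      exact hchain.app_eq i hi
    · rw [(hsame _ (Nat.le_add_right _ _)).2.1]
      exact hchain.acc_eq i hi
    · rw [(hsame _ (Nat.le_add_right _ _)).2.2]
      exact hchain.rej_eq i hi

/-! ### The policy of a solution -/

section policy

variable {I : Instance} {c : Params} {cls : Fin I.n → ℕ}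

/-- The policy that makes a best offer to a candidate, and offers to the applicants that are not
retained, in the order of their indices, when there is no candidate. The arguments are translated
to the capped numbers of stages and positions. -/
noncomputable def classPolicy (I : Instance) (c : Params) (cls : Fin I.n → ℕ) (hn : 1 ≤ I.n) :
    Policy I where
  pick t κ A :=
    if h : (candidates I.p cls c.D c.m A).Nonempty then
      (exists_isBestOffer I.p I.v cls c.D c.m (c.m - (t - 1)) (κ - (I.k - c.kcap)) A h).choose
    else if h : A.Nonempty then A.min' h else ⟨0, hn⟩
  pick_mem t κ A _ _ _ _ hA := by
    split_ifs with h
    · exact heads_subset _ (exists_isBestOffer I.p I.v cls c.D c.m (c.m - (t - 1))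
        (κ - (I.k - c.kcap)) A h).choose_spec.1
    · exact A.min'_mem hA

theorem classPolicy_pick_of_nonempty {hn : 1 ≤ I.n} {t κ : ℕ} {A : Finset (Fin I.n)}
    (h : (candidates I.p cls c.D c.m A).Nonempty) :
    IsBestOffer I.p I.v cls c.D c.m (c.m - (t - 1)) (κ - (I.k - c.kcap)) A
      ((classPolicy I c cls hn).pick t κ A) := by
  have := (exists_isBestOffer I.p I.v cls c.D c.m (c.m - (t - 1)) (κ - (I.k - c.kcap)) A
    h).choose_spec
  simpa only [classPolicy, dif_pos h] using this

theorem classPolicy_pick_of_empty {hn : 1 ≤ I.n} {t κ : ℕ} {A : Finset (Fin I.n)}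
    (h : candidates I.p cls c.D c.m A = ∅) (hA : A.Nonempty) :
    (classPolicy I c cls hn).pick t κ A = A.min' hA := by
  have : ¬ (candidates I.p cls c.D c.m A).Nonempty := by simp [h]
  simp only [classPolicy, dif_neg this, dif_pos hA]

theorem candidates_eq_empty_iff {A : Finset (Fin I.n)} :
    candidates I.p cls c.D c.m A = ∅ ↔ ∀ i ∈ A, ¬ Retained cls (rankIn cls I.p) c.D c.m i := by
  constructor
  · intro h i hi hret
    obtain ⟨j, hj, hmin⟩ := Finset.exists_min_image (A.filter fun j => cls j = cls i)
      (rankIn cls I.p) ⟨i, by simp [hi]⟩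
    have hj' := Finset.mem_filter.1 hj
    have : j ∈ candidates I.p cls c.D c.m A := by
      refine mem_heads.2 ⟨hj'.1, ⟨by rw [hj'.2]; exact hret.1,
        (hmin i (by simp [hi])).trans_lt hret.2⟩, fun x hx hxj => hmin x ?_⟩
      simp [hx, hxj, hj'.2]
    simp [h] at this
  · intro h
    refine Finset.eq_empty_of_forall_notMem fun i hi => ?_
    have := mem_heads.1 hi
    exact h i this.1 this.2.1

/-- The chain follows the policy once no retained applicant is available. -/
theorem chain_followsFrom {s : Mem} (hn : 1 ≤ I.n)
    (hs : ChainOK (fun i => ¬ Retained cls (rankIn cls I.p) c.D c.m i) c.size s) :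
    ∀ (r κ : ℕ) (A : Finset (Fin I.n)) (u : ℕ),
      (∀ i ∈ A, ¬ Retained cls (rankIn cls I.p) c.D c.m i) →
      (∀ i ∈ A, ∀ j, ¬ Retained cls (rankIn cls I.p) c.D c.m j → j ∉ A → j < i) →
      u = c.size + (univ.filter fun j =>
        ¬ Retained cls (rankIn cls I.p) c.D c.m j ∧ j ∉ A).card →
      s.diagram.FollowsFrom (classPolicy I c cls hn) r u κ A := by
  intro r
  induction r with
  | zero => intros; trivial
  | succ r ih =>
    intro κ A u hleft hup hu
    by_cases hA : A.Nonempty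
    swap
    · exact Or.inr (Or.inl (Finset.not_nonempty_iff_eq_empty.1 hA))
    refine Or.inr (Or.inr ?_)
    rw [classPolicy_pick_of_empty (candidates_eq_empty_iff.2 hleft) hA]
    set i := A.min' hA with hi
    have hiA : i ∈ A := A.min'_mem hA
    have hset : (univ.filter fun j => ¬ Retained cls (rankIn cls I.p) c.D c.m j ∧ j < i) =
        univ.filter fun j => ¬ Retained cls (rankIn cls I.p) c.D c.m j ∧ j ∉ A := by
      ext j
      simp only [Finset.mem_filter, Finset.mem_univ, true_and]
      refine and_congr_right fun hj => ⟨fun h hjA => ?_, fun h => hup i hiA j hj h⟩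
      exact absurd (A.min'_le j hjA) (not_le.2 h)
    have h1 := hs.app_eq i (hleft i hiA)
    have h2 := hs.acc_eq i (hleft i hiA)
    have h3 := hs.rej_eq i (hleft i hiA)
    rw [hset, ← hu] at h1 h2 h3
    have hnext : ∀ κ, s.diagram.FollowsFrom (classPolicy I c cls hn) r (u + 1) κ (A.erase i) := by
      intro κ
      refine ih κ _ _ (fun j hj => hleft j (Finset.mem_of_mem_erase hj)) (fun j hj x hx hxA => ?_) ?_
      · by_cases hxi : x = i
        · rw [hxi]
          exact lt_of_le_of_ne (A.min'_le j (Finset.mem_of_mem_erase hj))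
            (Finset.ne_of_mem_erase hj).symm
        · exact hup j (Finset.mem_of_mem_erase hj) x hx fun h => hxA (Finset.mem_erase.2 ⟨hxi, h⟩)
      · have : (univ.filter fun j => ¬ Retained cls (rankIn cls I.p) c.D c.m j ∧ j ∉ A.erase i) =
            insert i (univ.filter fun j =>
              ¬ Retained cls (rankIn cls I.p) c.D c.m j ∧ j ∉ A) := by
          ext j
          simp only [Finset.mem_filter, Finset.mem_univ, true_and, Finset.mem_insert,
            Finset.mem_erase, not_and, ne_eq]
          by_cases hj : j = i
          · simp [hj, hleft i hiA]
          · simp [hj]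
        rw [this, Finset.card_insert_of_notMem (by simp [hiA])]
        omega
    refine ⟨h1, ?_, ?_⟩
    · change s.diagram.FollowsFrom _ r (s.nat nAcc u) _ _
      rw [h2]
      exact hnext _
    · change s.diagram.FollowsFrom _ r (s.nat nRej u) _ _
      rw [h3]
      exact hnext _

/-- From the node of a state on, the diagram follows the policy, and the policy achieves at least
the value of the state. The numbers of stages and positions of a state are capped at `n` and at the
number of stages, so a state may have less of them than there really are; then the applicants, or
the stages, are used up first. -/
theorem Solved.followsFrom {s : Mem} (hn : 1 ≤ I.n) (hm : c.m = min I.T I.n)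
    (hk : c.kcap = min I.k c.m) (hs : Solved I c cls s) :
    ∀ (r κ : ℕ) (A : Finset (Fin I.n)) (u : ℕ), r ≤ I.T → u < c.size →
      availableAt I.p cls c.D c.m u = A → digit c.R u 1 = c.m - (I.T - r) →
      κ = digit c.R u 0 + (I.k - c.kcap) → (c.kcap < I.k → digit c.R u 1 ≤ digit c.R u 0) →
      A.card + (I.T - r) = I.n →
      s.diagram.FollowsFrom (classPolicy I c cls hn) r u κ A ∧
        stateVal I.p I.v cls c.D c.m u ≤ (classPolicy I c cls hn).value r κ A := by
  intro r
  induction r with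
  | zero =>
    intro κ A u _ _ _ h1 _ _ _
    refine ⟨trivial, le_of_eq ?_⟩
    have : digit (c.m + 1) u 1 = 0 := by
      change digit c.R u 1 = 0
      omega
    exact classVal_eq_zero (Or.inl this)
  | succ r ih =>
    intro κ A u hr hu hav h1 hκ hle hcard
    by_cases hz : κ = 0 ∨ A = ∅
    · refine ⟨?_, ?_⟩
      · rcases hz with hz | hz
        · exact Or.inl hz
        · exact Or.inr (Or.inl hz)
      · refine le_trans (le_of_eq ?_) (Policy.value_nonneg _ _ _ _)
        refine classVal_eq_zero ?_
        rcases hz with hz | hz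
        · refine Or.inr (Or.inl ?_)
          change digit c.R u 0 = 0
          omega
        · refine Or.inr (Or.inr (candidates_eq_empty_iff.2 ?_))
          rw [hav, hz]
          simp
    push Not at hz
    obtain ⟨hκ0, hA⟩ := hz
    have hA' : 0 < A.card := hA.card_pos
    have hd1 : 1 ≤ digit c.R u 1 := by omega
    have hd0 : 1 ≤ digit c.R u 0 := by
      by_cases h : c.kcap < I.k
      · exact hd1.trans (hle h)
      · omega
    rcases (hs.node u hu).node hd0 hd1 with ⟨hc, happ, hacc, hrej⟩ | ⟨i, hi, happ, hacc, hrej⟩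
    · refine ⟨?_, ?_⟩
      · have hleft := candidates_eq_empty_iff.1 hc
        have hall : ∀ j, ¬ Retained cls (rankIn cls I.p) c.D c.m j →
            j ∈ availableAt I.p cls c.D c.m u := fun j hj => mem_availableAt.2 fun h => hj h.1
        have hch := chain_followsFrom (A := A) (κ := κ) (r := r + 1) (u := c.size) hn hs.chain
          (by rw [← hav]; exact hleft)
          (fun i _ j hj hjA => absurd (hav ▸ hall j hj) hjA) (by
            rw [← hav, Finset.filter_eq_empty_iff.2]
            · simp
            · rintro j - ⟨h1, h2⟩
              exact h2 (hall j h1))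
        rcases hch with h | h | ⟨h2, h3, h4⟩
        · exact Or.inl h
        · exact Or.inr (Or.inl h)
        · refine Or.inr (Or.inr ⟨happ.trans h2, ?_⟩)
          -- the first node of the chain has the same successors
          have hfirst : s.nat nAcc c.size = c.size + 1 ∧ s.nat nRej c.size = c.size + 1 := by
            have hmin := hleft (A.min' hA) (hav ▸ A.min'_mem hA)
            have e : (univ.filter fun j => ¬ Retained cls (rankIn cls I.p) c.D c.m j ∧
                j < A.min' hA) = ∅ := by
              rw [Finset.filter_eq_empty_iff]
              rintro j - ⟨h1, h2⟩
              exact absurd (A.min'_le j (hav ▸ hall j h1)) (not_le.2 h2)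
            have e2 := hs.chain.acc_eq _ hmin
            have e3 := hs.chain.rej_eq _ hmin
            rw [e] at e2 e3
            exact ⟨by simpa using e2, by simpa using e3⟩
          change s.diagram.FollowsFrom _ r (s.nat nAcc c.size) _ _ at h3
          change s.diagram.FollowsFrom _ r (s.nat nRej c.size) _ _ at h4
          change s.diagram.FollowsFrom _ r (s.nat nAcc u) _ _ ∧
            s.diagram.FollowsFrom _ r (s.nat nRej u) _ _
          rw [hacc, hrej]
          rw [hfirst.1] at h3
          rw [hfirst.2] at h4
          exact ⟨h3, h4⟩
      · refine le_trans (le_of_eq ?_) (Policy.value_nonneg _ _ _ _)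
        exact classVal_eq_zero (Or.inr (Or.inr hc))
    · have hpick : (classPolicy I c cls hn).pick (I.T - r) κ A = i := by
        have hne : (candidates I.p cls c.D c.m A).Nonempty := ⟨i, hav ▸ hi.1⟩
        have h := classPolicy_pick_of_nonempty (hn := hn) (t := I.T - r) (κ := κ) hne
        have e1 : c.m - (I.T - r - 1) = digit c.R u 1 := by
          rw [h1, Nat.sub_sub]
        have e2 : κ - (I.k - c.kcap) = digit c.R u 0 := by omega
        rw [e1, e2] at h
        subst hav
        exact h.eq hi
      have hiA : i ∈ A := hav ▸ heads_subset _ hi.1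
      have hw := digit_rejectState hi.1 hd1
      have hwlt : rejectState cls c.m u i < u := rejectState_lt hd1
      set w := rejectState cls c.m u i with hwdef
      have hw0 : digit c.R w 0 = digit c.R u 0 := by
        have := hw 0
        rwa [if_neg (by omega), if_neg (by omega)] at this
      have hw1 : digit c.R w 1 = digit c.R u 1 - 1 := by
        have := hw 1
        rwa [if_pos rfl] at this
      have hwav : availableAt I.p cls c.D c.m w = A.erase i := by
        rw [← hav]
        exact availableAt_rejectState hi.1 hd1
      have hw0' : 1 ≤ digit (c.m + 1) w 0 := by
        change 1 ≤ digit c.R w 0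
        omega
      have ha0 : digit c.R (w - 1) 0 = digit c.R w 0 - 1 := by
        have := digit_sub_one hw0' 0
        rwa [if_pos rfl] at this
      have ha1 : digit c.R (w - 1) 1 = digit c.R w 1 := by
        have := digit_sub_one hw0' 1
        rwa [if_neg (by omega)] at this
      have hcard' : (A.erase i).card = A.card - 1 := Finset.card_erase_of_mem hiA
      obtain ⟨hf1, hv1⟩ := ih (κ - 1) (A.erase i) (w - 1) (by omega) (by omega)
        ((availableAt_sub_one hw0').trans hwav) (by omega) (by omega) (by omega) (by omega)
      obtain ⟨hf2, hv2⟩ := ih κ (A.erase i) w (by omega) (by omega) hwav (by omega) (by omega)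
        (by omega) (by omega)
      refine ⟨Or.inr (Or.inr ?_), ?_⟩
      · rw [hpick]
        refine ⟨happ, ?_, ?_⟩
        · change s.diagram.FollowsFrom _ r (s.nat nAcc u) _ _
          rw [hacc]
          exact hf1
        · change s.diagram.FollowsFrom _ r (s.nat nRej u) _ _
          rw [hrej]
          exact hf2
      · have e : stateVal I.p I.v cls c.D c.m u = I.p i * (I.v i +
            stateVal I.p I.v cls c.D c.m (w - 1)) +
              (1 - I.p i) * stateVal I.p I.v cls c.D c.m w :=
          (hi.classVal_eq hd1 hd0).trans (offerVal_eq_stateVal hi.1 hd0 hd1)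
        rw [e, Policy.value, if_neg (not_or.2 ⟨hκ0, hA.ne_empty⟩), hpick]
        have hp := I.p_nonneg i
        have hp1 := I.p_le_one i
        gcongr

end policy

/-- The number of the first state: all digits of classes and of stages are `m`. -/
def Params.root (c : Params) : ℕ := c.R ^ (c.D + 2) - c.R + c.kcap

theorem Params.digit_root (c : Params) (hk : c.kcap ≤ c.m) {x : ℕ} (hx : x < c.D + 2) :
    digit c.R c.root x = if x = 0 then c.kcap else c.m := by
  have hR : 0 < c.R := Nat.succ_pos _
  have hRm : c.R = c.m + 1 := rfl
  have hle : c.R ≤ c.R ^ (c.D + 2) := Nat.le_self_pow (by omega) _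
  split_ifs with h0
  · subst h0
    have e : c.root = c.kcap + c.R * (c.R ^ (c.D + 1) - 1) := by
      rw [Nat.mul_sub, ← pow_succ', Params.root, mul_one]
      change c.R ^ (c.D + 2) - c.R + c.kcap = c.kcap + (c.R ^ (c.D + 2) - c.R)
      omega
    rw [digit, pow_zero, Nat.div_one, e, Nat.add_mul_mod_self_left, Nat.mod_eq_of_lt (by omega)]
  · obtain ⟨y, hy⟩ := Nat.exists_eq_add_of_lt hx
    have hRx : c.R ≤ c.R ^ x := Nat.le_self_pow h0 _
    have hy0 : 0 < c.R ^ y := pow_pos hR y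
    have e : c.root = (c.R ^ x - c.R + c.kcap) + c.R ^ x * (c.R ^ (y + 1) - 1) := by
      have h1 : c.R ^ x ≤ c.R ^ x * c.R ^ (y + 1) := Nat.le_mul_of_pos_right _ (pow_pos hR _)
      rw [Nat.mul_sub, mul_one, Params.root, hy]
      have : c.R ^ (x + y + 1) = c.R ^ x * c.R ^ (y + 1) := by rw [← pow_add, add_assoc]
      omega
    have e2 : c.R ^ (y + 1) - 1 = c.m + c.R * (c.R ^ y - 1) := by
      have h1 : c.R ≤ c.R * c.R ^ y := Nat.le_mul_of_pos_right _ hy0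
      rw [Nat.mul_sub, mul_one, pow_succ']
      omega
    rw [digit, e, Nat.add_mul_div_left _ _ (pow_pos hR x), Nat.div_eq_of_lt (by omega), zero_add,
      e2, Nat.add_mul_mod_self_left, Nat.mod_eq_of_lt (by omega)]

theorem Params.root_lt (c : Params) (hk : c.kcap ≤ c.m) : c.root < c.size := by
  have hRm : c.R = c.m + 1 := rfl
  have hle : c.R ≤ c.R ^ (c.D + 2) := Nat.le_self_pow (by omega) _
  unfold Params.root Params.size
  omega

theorem availableAt_root {I : Instance} {c : Params} {cls : Fin I.n → ℕ} (hk : c.kcap ≤ c.m) :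
    availableAt I.p cls c.D c.m c.root = univ := by
  refine Finset.eq_univ_of_forall fun i => mem_availableAt.2 fun h => ?_
  have e := c.digit_root hk (x := cls i + 2) (by have := h.1.1; omega)
  rw [if_neg (by omega)] at e
  have := h.2
  change _ + digit c.R c.root _ < _ at this
  omega

theorem stateVal_root {I : Instance} {c : Params} {cls : Fin I.n → ℕ} (hk : c.kcap ≤ c.m) :
    stateVal I.p I.v cls c.D c.m c.root = classVal I.p I.v cls c.D c.m c.m c.kcap univ := by
  have e0 : digit (c.m + 1) c.root 0 = c.kcap := c.digit_root hk (by omega)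
  have e1 : digit (c.m + 1) c.root 1 = c.m := c.digit_root hk (by omega)
  rw [stateVal, e0, e1, availableAt_root hk]

/-- The diagram of a solution represents a policy that is at least as good as the best class-ordered
policy. -/
theorem Solved.represents {I : Instance} {c : Params} {cls : Fin I.n → ℕ} {s : Mem} (hn : 1 ≤ I.n)
    (hm : c.m = min I.T I.n) (hk : c.kcap = min I.k c.m) (hs : Solved I c cls s)
    (hroot : s.nat nRoot 0 = c.root) :
    s.diagram.Represents (classPolicy I c cls hn) ∧
      classVal I.p I.v cls c.D c.m c.m c.kcap univ ≤ (classPolicy I c cls hn).expectedReward := by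
  have hk' : c.kcap ≤ c.m := hk ▸ min_le_right _ _
  have e0 := c.digit_root hk' (x := 0) (by omega)
  have e1 := c.digit_root hk' (x := 1) (by omega)
  simp only [if_pos, if_neg, one_ne_zero, not_false_eq_true] at e0 e1
  obtain ⟨h1, h2⟩ := hs.followsFrom hn hm hk I.T I.k univ c.root le_rfl (c.root_lt hk')
    (availableAt_root hk') (by omega) (by omega) (by omega) (by simp)
  refine ⟨?_, ?_⟩
  · change s.diagram.FollowsFrom _ _ (s.nat nRoot 0) _ _
    rw [hroot]
    exact h1
  · rw [Policy.expectedReward_eq_value, ← stateVal_root hk']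
    exact h2

/-! ### Parameters and guesses -/

/-- The memory holds the input. -/
structure HasInput (I : Instance) (ε : ℝ) (s : Mem) : Prop where
  n_eq : s.nat nN 0 = I.n
  k_eq : s.nat nK 0 = I.k
  stages_eq : s.nat nT 0 = I.T
  val_eq : ∀ i : Fin I.n, s.real rV i = I.v i
  prob_eq : ∀ i : Fin I.n, s.real rP i = I.p i
  eps_eq : s.real rEps 0 = ε

theorem hasInput_input (I : Instance) (ε : ℝ) : HasInput I ε (I.input ε) := by
  constructor <;> simp [Instance.input]

theorem HasInput.of_agree {I : Instance} {ε : ℝ} {s s' : Mem} {l r : List ℕ} (h : HasInput I ε s)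
    (ha : Mem.AgreeOff l r s s') (hl : ∀ a ∈ [nN, nK, nT], a ∉ l)
    (hr : ∀ a ∈ [rV, rP, rEps], a ∉ r) : HasInput I ε s' := by
  have e : ∀ a ∈ [nN, nK, nT], s'.nat a = s.nat a := fun a h => ha.1 a (hl a h)
  have f : ∀ a ∈ [rV, rP, rEps], s'.real a = s.real a := fun a h => ha.2 a (hr a h)
  simp only [List.forall_mem_cons] at e f
  obtain ⟨e1, e2, e3, -⟩ := e
  obtain ⟨f1, f2, f3, -⟩ := f
  constructor
  · rw [e1]; exact h.n_eq
  · rw [e2]; exact h.k_eq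
  · rw [e3]; exact h.stages_eq
  · rw [f1]; exact h.val_eq
  · rw [f2]; exact h.prob_eq
  · rw [f3]; exact h.eps_eq

theorem computeMax_ensures {I : Instance} {ε : ℝ} {s : Mem} (h : HasInput I ε s) :
    computeMax.Ensures s (I.n * 50 + 20) fun s' => 0 ≤ s'.real rM 0 ∧
      (∀ i, I.p i * I.v i ≤ s'.real rM 0) ∧
      (s'.real rM 0 = 0 ∨ ∃ i, I.p i * I.v i = s'.real rM 0) := by
  refine Prog.Ensures.setR_seq (B₂ := I.n * 50 + 12) (by simp; omega) ?_
  refine Prog.Ensures.mono (Prog.Ensures.forLoop (B := 38) (N := I.n)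
    (fun j s' => 0 ≤ s'.real rM 0 ∧ (∀ i : Fin I.n, (i : ℕ) < j → I.p i * I.v i ≤ s'.real rM 0) ∧
      (s'.real rM 0 = 0 ∨ ∃ i, I.p i * I.v i = s'.real rM 0))
    (by decide) (by decide) (by simp [h.n_eq]) (by simp) ?_) le_rfl
    fun s' h => ⟨h.1, fun i => h.2.1 i i.2, h.2.2⟩
  rintro j hj s' hag hij ⟨h0, hle, hex⟩
  have hv := h.val_eq ⟨j, hj⟩
  have hp := h.prob_eq ⟨j, hj⟩
  have e1 := hag.2 rV (by decide)
  have e2 := hag.2 rP (by decide)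
  have hv' : s'.real rV j = I.v ⟨j, hj⟩ := by simpa [e1] using hv
  have hp' : s'.real rP j = I.p ⟨j, hj⟩ := by simpa [e2] using hp
  have hstep : ∀ y : ℝ, s'.real rM 0 ≤ y → I.p ⟨j, hj⟩ * I.v ⟨j, hj⟩ ≤ y →
      ∀ i : Fin I.n, (i : ℕ) < j + 1 → I.p i * I.v i ≤ y := by
    intro y h1 h2 i hi
    rcases Nat.lt_succ_iff_lt_or_eq.1 hi with hi | hi
    · exact (hle i hi).trans h1
    · obtain rfl : i = ⟨j, hj⟩ := Fin.ext hi
      exact h2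
  refine Prog.Ensures.ite_of (B₁ := 20) (by simp) (fun h1 => ?_) fun h1 => ?_
  · simp [hij, hv', hp'] at h1
    refine Prog.Ensures.setR ?_ (by simp)
    simp only [RExp.eval, NExp.eval, NExp.var, Mem.putN_real, Mem.putR_real, hij, hv', hp', and_self,
      if_true]
    exact ⟨mul_nonneg (I.p_nonneg _) (I.v_nonneg _), hstep _ h1 le_rfl, Or.inr ⟨_, rfl⟩⟩
  · simp [hij, hv', hp'] at h1
    refine Prog.Ensures.mono_bound (Prog.Ensures.skip ?_) (by omega)
    simp only [Mem.putN_real]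
    exact ⟨h0, hstep _ le_rfl h1.le, hex⟩

theorem trivialParams_ensures {ε : ℝ} {s : Mem} (hε : s.real rEps 0 = ε) :
    trivialParams.Ensures s 30 fun s' => s'.real rBeta 0 = 1 - ε ∧ s'.nat nL 0 = 1 ∧
      s'.nat nV 0 = 1 ∧ s'.real rX 0 = 0 := by
  refine Prog.Ensures.setR_seq (B₂ := 20) (by simp) ?_
  refine Prog.Ensures.setN_seq (B₂ := 15) (by simp) ?_
  refine Prog.Ensures.setN_seq (B₂ := 10) (by simp) ?_
  exact Prog.Ensures.setR (by simp [hε]) (by simp)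

theorem mainParams_ensures {ε M : ℝ} {m : ℕ} {s : Mem} (hε : 0 < ε) (hs : s.real rEps 0 = ε)
    (hm : s.nat nM 0 = m) (hM : s.real rM 0 = M) :
    mainParams.Ensures s (⌈16 / ε⌉₊ * 100 + Nat.clog 2 m * 100 + 200) fun s' =>
      s'.real rBeta 0 = 1 - 1 / (⌈16 / ε⌉₊ : ℝ) ∧
      s'.nat nL 0 = ⌈16 / ε⌉₊ * (Nat.clog 2 m + ⌈16 / ε⌉₊) ∧
      s'.nat nV 0 = ⌈16 / ε⌉₊ ^ 3 + 2 ∧ s'.real rX 0 = M * ⌈16 / ε⌉₊ := by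
  set q := ⌈16 / ε⌉₊ with hq
  set t := Nat.clog 2 m with ht
  have hqlt : ∀ j : ℕ, (16 : ℝ) ≤ j * ε ↔ q ≤ j := by
    intro j
    rw [hq, Nat.ceil_le, div_le_iff₀ hε]
  have htlt : ∀ j : ℕ, m ≤ 2 ^ j ↔ t ≤ j := by
    intro j
    rw [ht, Nat.clog_le_iff_le_pow (by norm_num)]
  refine Prog.Ensures.setN_seq (B₂ := q * 100 + t * 100 + 190) (by simp; omega) ?_
  refine Prog.Ensures.seq_of (B₁ := q * 18 + 12) (B₂ := q * 80 + t * 100 + 170)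
    (Prog.Ensures.mono (Prog.Ensures.loop (N := q) (B := 6) (fun j s' =>
      s'.nat nQ 0 = j ∧ s'.real rEps 0 = ε) (by simp [hs]) ?_ ?_) (by simp; omega) fun s' h => h.1)
    (by omega) ?_
  · rintro j hj s' ⟨h1, h2⟩
    refine ⟨?_, Prog.Ensures.setN (by simp [h1, h2]) (by simp)⟩
    simp [h1, h2]
    exact not_le.1 fun h => absurd ((hqlt j).1 h) (not_le.2 hj)
  · rintro s' ⟨h1, h2⟩
    simp [h1, h2]
    exact (hqlt q).2 le_rfl
  intro s₁ hag₁ hq₁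
  refine Prog.Ensures.setN_seq (B₂ := q * 80 + t * 100 + 160) (by simp; omega) ?_
  refine Prog.Ensures.setN_seq (B₂ := q * 80 + t * 100 + 150) (by simp; omega) ?_
  refine Prog.Ensures.seq_of (B₁ := t * 26 + 6) (B₂ := q * 80 + t * 50 + 140)
    (Prog.Ensures.mono (Prog.Ensures.loop (N := t) (B := 20) (fun j s' =>
      s'.nat nLog 0 = j ∧ s'.nat nPow 0 = 2 ^ j ∧ s'.nat nM 0 = m) ?_ ?_ ?_) (by simp)
      fun s' h => h.1)
    (by omega) ?_
  · simp [hag₁.1 nM (by decide), hm]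
  · rintro j hj s' ⟨h1, h2, h3⟩
    refine ⟨?_, Prog.Ensures.setN_seq (B₂ := 10) (by simp) (Prog.Ensures.setN ?_ (by simp))⟩
    · simp [h2, h3]
      exact not_le.1 fun h => absurd ((htlt j).1 h) (not_le.2 hj)
    · simp [h1, h2, h3, pow_succ, mul_two]
  · rintro s' ⟨h1, h2, h3⟩
    simp [h2, h3]
    exact (htlt t).2 le_rfl
  intro s₂ hag₂ ht₂
  have hq₂ : s₂.nat nQ 0 = q := by
    rw [hag₂.1 _ (by decide)]
    simp [hq₁]
  refine Prog.Ensures.setN_seq (B₂ := q * 80 + t * 50 + 130) (by simp; omega) ?_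
  refine Prog.Ensures.seq_of (B₁ := (t + q) * 20 + 20) (B₂ := q * 60 + 110)
    (Prog.Ensures.mono (Prog.Ensures.mulN (by decide) (by decide) (by decide) (by decide)
      (by decide)) (by simp [hq₂, ht₂]) fun s' h => h) (by omega) ?_
  intro s₃ hag₃ hL₃
  simp [hq₂, ht₂] at hL₃
  have hq₃ : s₃.nat nQ 0 = q := by
    rw [hag₃.1 _ (by decide)]
    simp [hq₂]
  refine Prog.Ensures.seq_of (B₁ := q * 20 + 20) (B₂ := q * 40 + 90)
    (Prog.Ensures.mono (Prog.Ensures.mulN (by decide) (by decide) (by decide) (by decide)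
      (by decide)) (by simp [hq₃]) fun s' h => h) (by omega) ?_
  intro s₄ hag₄ h₄
  have hq₄ : s₄.nat nQ 0 = q := by rw [hag₄.1 _ (by decide), hq₃]
  refine Prog.Ensures.seq_of (B₁ := q * 20 + 20) (B₂ := q * 20 + 70)
    (Prog.Ensures.mono (Prog.Ensures.mulN (by decide) (by decide) (by decide) (by decide)
      (by decide)) (by simp [hq₄]) fun s' h => h) (by omega) ?_
  intro s₅ hag₅ h₅
  have hq₅ : s₅.nat nQ 0 = q := by rw [hag₅.1 _ (by decide), hq₄]
  have hL₅ : s₅.nat nL 0 = q * (t + q) := by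
    rw [hag₅.1 _ (by decide), hag₄.1 _ (by decide), hL₃]
  have hM₅ : s₅.real rM 0 = M := by
    rw [hag₅.2 _ (by decide), hag₄.2 _ (by decide), hag₃.2 _ (by decide)]
    simp [hag₂.2 rM (by decide), hag₁.2 rM (by decide), hM]
  refine Prog.Ensures.setN_seq (B₂ := q * 20 + 60) (by simp; omega) ?_
  refine Prog.Ensures.setR_seq (B₂ := q * 20 + 40) (by simp; omega) ?_
  refine Prog.Ensures.setR ?_ (by simp)
  rw [h₄, hq₄, hq₃] at h₅
  simp [hq₅, hL₅, hM₅, h₅]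
  ring

/-- The number of the first state is the sum of `kcap` and of `m R ^ (j + 1)` for `j ≤ D`, which
telescopes. -/
theorem computeSizes_ensures {c : Params} {s : Mem} (hm : s.nat nM 0 = c.m)
    (hR : s.nat nR 0 = c.R) (hkcap : s.nat nKcap 0 = c.kcap) (hL : s.nat nL 0 = c.L)
    (hV : s.nat nV 0 = c.V) :
    computeSizes.Ensures s (c.V * 20 + c.R * 20 + (c.D + 2) * (c.R * 50 + 150) + 200) fun s' =>
      s'.nat nVone 0 = c.V - 1 ∧ s'.nat nOne 0 = 1 ∧ s'.nat nD 0 = c.D ∧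
      s'.nat nDtwo 0 = c.D + 2 ∧ s'.nat nDR 0 = c.D * c.R ∧ s'.nat nSize 0 = c.size ∧
      (∀ j ≤ c.D + 2, s'.nat nStr j = c.R ^ j) ∧ s'.nat nRoot 0 = c.root := by
  set N := (c.D + 2) * (c.R * 50 + 150) with hN
  refine Prog.Ensures.setN_seq (B₂ := c.V * 20 + c.R * 20 + N + 190) (by simp; omega) ?_
  refine Prog.Ensures.setN_seq (B₂ := c.V * 20 + c.R * 20 + N + 180) (by simp; omega) ?_
  refine Prog.Ensures.seq_of (B₁ := c.V * 20 + 20) (B₂ := c.R * 20 + N + 160)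
    (Prog.Ensures.mono (Prog.Ensures.mulN (by decide) (by decide) (by decide) (by decide)
      (by decide)) (by simp [hV]) fun s' h => h) (by omega) ?_
  intro s₁ hag₁ hD
  have hD₁ : s₁.nat nD 0 = c.D := by
    rw [hD]
    simp [hL, hV, Params.D]
  have hR₁ : s₁.nat nR 0 = c.R := by
    rw [hag₁.1 _ (by decide)]
    simp [hR]
  have hm₁ : s₁.nat nM 0 = c.m := by
    rw [hag₁.1 _ (by decide)]
    simp [hm]
  have hk₁ : s₁.nat nKcap 0 = c.kcap := by
    rw [hag₁.1 _ (by decide)]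
    simp [hkcap]
  have ho₁ : s₁.nat nOne 0 = 1 := by
    rw [hag₁.1 _ (by decide)]
    simp
  have hv₁ : s₁.nat nVone 0 = c.V - 1 := by
    rw [hag₁.1 _ (by decide)]
    simp [hV]
  refine Prog.Ensures.setN_seq (B₂ := c.R * 20 + N + 150) (by simp; omega) ?_
  refine Prog.Ensures.setN_seq (B₂ := c.R * 20 + N + 140) (by simp; omega) ?_
  refine Prog.Ensures.seq_of (B₁ := c.R * 20 + 20) (B₂ := N + 120)
    (Prog.Ensures.mono (Prog.Ensures.mulN (by decide) (by decide) (by decide) (by decide)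
      (by decide)) (by simp [hR₁]) fun s' h => h) (by omega) ?_
  intro s₂ hag₂ hDR
  simp [hD₁, hR₁] at hDR
  have e₂ : ∀ a, a ≠ nDR → a ≠ nC → a ≠ nDone → a ≠ nDtwo → s₂.nat a = s₁.nat a := by
    intro a h1 h2 h3 h4
    rw [hag₂.1 a (by simp [Prog.mulN, Prog.forLoop, h1, h2])]
    simp only [Mem.putN_nat_of_ne _ _ _ h3, Mem.putN_nat_of_ne _ _ _ h4]
  have hone₂ : s₂.nat nDone 0 = c.D + 1 := by
    rw [hag₂.1 _ (by decide)]
    simp [hD₁]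
  have htwo₂ : s₂.nat nDtwo 0 = c.D + 2 := by
    rw [hag₂.1 _ (by decide)]
    simp [hD₁]
  refine Prog.Ensures.setN_seq (B₂ := N + 110) (by simp; omega) ?_
  refine Prog.Ensures.seq_of (B₁ := (c.D + 2) * ((c.R * 20 + 40) + 12) + 12)
    (B₂ := (c.D + 1) * ((c.m * 24 + 12) + 12) + 30)
    (Prog.Ensures.forLoop (N := c.D + 2) (fun j s' => ∀ x ≤ j, s'.nat nStr x = c.R ^ x)
      (by decide) (by decide) (by simp [htwo₂]) (by simp) ?_) ?_ ?_
  · intro j hj s' hag hij hinv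
    have hR' : s'.nat nR 0 = c.R := by
      rw [hag.1 _ (by decide)]
      simp [e₂, hR₁]
    refine Prog.Ensures.setN_seq (B₂ := c.R * 20 + 30) (by simp; omega) ?_
    refine Prog.Ensures.seq_of (B₁ := c.R * 20 + 20) (B₂ := 10)
      (Prog.Ensures.mono (Prog.Ensures.mulN (by decide) (by decide) (by decide) (by decide)
        (by decide)) (by simp [hR']) fun s' h => h) (by omega) ?_
    intro s'' hag'' hsz
    simp [hij, hinv j le_rfl, hR'] at hsz
    refine Prog.Ensures.setN ?_ (by simp)
    have e1 := hag''.1 nStr (by decide)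
    have e2 := hag''.1 nJ (by decide)
    intro x hx
    by_cases hxj : x = j + 1
    · simp [hxj, hij, e2, hsz, pow_succ]
    · simpa [hxj, hij, e1, e2] using hinv x (by omega)
  · have : c.R = c.m + 1 := rfl
    rw [hN]
    nlinarith
  intro s₃ hag₃ hstr
  have e₃ : ∀ a, a ≠ nStr → a ≠ nJ → a ≠ nTmp → a ≠ nSize → a ≠ nC → s₃.nat a = s₂.nat a := by
    intro a h1 h2 h3 h4 h5
    rw [hag₃.1 a (by simp [Prog.mulN, Prog.forLoop, h1, h2, h3, h4, h5])]
    simp only [Mem.putN_nat_of_ne _ _ _ h1]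
  refine Prog.Ensures.setN_seq (B₂ := (c.D + 1) * ((c.m * 24 + 12) + 12) + 20) (by simp; omega) ?_
  refine Prog.Ensures.setN_seq (B₂ := (c.D + 1) * ((c.m * 24 + 12) + 12) + 12) (by simp; omega) ?_
  set s₄ := (s₃.putN nSize ((NExp.const 0).eval s₃) ((NExp.get nStr (NExp.var nDtwo)).eval s₃)).putN
    nRoot ((NExp.const 0).eval (s₃.putN nSize ((NExp.const 0).eval s₃)
      ((NExp.get nStr (NExp.var nDtwo)).eval s₃))) ((NExp.var nKcap).eval
      (s₃.putN nSize ((NExp.const 0).eval s₃) ((NExp.get nStr (NExp.var nDtwo)).eval s₃))) with hs₄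
  have e₄ : ∀ a, a ≠ nSize → a ≠ nRoot → s₄.nat a = s₃.nat a := by
    intro a h1 h2
    simp only [hs₄, Mem.putN_nat_of_ne _ _ _ h1, Mem.putN_nat_of_ne _ _ _ h2]
  have hsize₄ : s₄.nat nSize 0 = c.size := by
    simp [hs₄, e₃, htwo₂, hstr, Params.size]
  have hroot₄ : s₄.nat nRoot 0 = c.kcap := by
    simp [hs₄, e₃, e₂, hk₁]
  clear_value s₄
  have hpow : ∀ j, (c.R ^ (j + 1) - c.R + c.kcap) + c.m * c.R ^ (j + 1) =
      c.R ^ (j + 1 + 1) - c.R + c.kcap := by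
    intro j
    have h1 : c.R ≤ c.R ^ (j + 1) := Nat.le_self_pow (by omega) _
    have h2 : c.R ^ (j + 1 + 1) = c.m * c.R ^ (j + 1) + c.R ^ (j + 1) := by
      have : c.R = c.m + 1 := rfl
      rw [pow_succ' c.R (j + 1)]
      nth_rewrite 1 [this]
      ring
    omega
  refine Prog.Ensures.mono (Prog.Ensures.frame (Prog.Ensures.forLoop (N := c.D + 1)
    (B := c.m * 24 + 12)
    (fun j s' => s'.nat nRoot 0 = c.R ^ (j + 1) - c.R + c.kcap) (by decide) (by decide)
    (by simp [e₄, e₃, hone₂]) (by simp [hroot₄]) ?_)) le_rfl ?_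
  · intro j hj s' hag hij hinv
    refine Prog.Ensures.mono (Prog.Ensures.frame (Prog.Ensures.forLoop (N := c.m) (B := 12)
      (fun r s'' => s''.nat nRoot 0 = (c.R ^ (j + 1) - c.R + c.kcap) + r * c.R ^ (j + 1))
      (by decide) (by decide) ?_ (by simp [hinv]) ?_)) le_rfl ?_
    · rw [hag.1 _ (by decide), e₄ _ (by decide) (by decide),
        e₃ _ (by decide) (by decide) (by decide) (by decide) (by decide),
        e₂ _ (by decide) (by decide) (by decide) (by decide), hm₁]
    · intro r hr s'' hag'' _ hinv''
      have e1 : s''.nat nJ 0 = j := by rw [hag''.1 _ (by decide), hij]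
      have e2 : s''.nat nStr (j + 1) = c.R ^ (j + 1) := by
        rw [hag''.1 _ (by decide), hag.1 _ (by decide), e₄ _ (by decide) (by decide),
          hstr _ (by omega)]
      refine Prog.Ensures.setN ?_ (by simp)
      simp [e1, e2, hinv'']
      ring
    · rintro s'' ⟨h1, -⟩
      simp [h1, hpow]
  · rintro s₅ ⟨h1, hag₅⟩
    have e₅ : ∀ a, a ≠ nJ → a ≠ nS → a ≠ nRoot → s₅.nat a = s₄.nat a := by
      intro a h1 h2 h3
      exact hag₅.1 a (by simp [Prog.forLoop, h1, h2, h3])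
    refine ⟨?_, ?_, ?_, ?_, ?_, ?_, ?_, h1⟩
    · simp [e₅, e₄, e₃, e₂, hv₁]
    · simp [e₅, e₄, e₃, e₂, ho₁]
    · simp [e₅, e₄, e₃, e₂, hD₁]
    · simp [e₅, e₄, e₃, htwo₂]
    · simp [e₅, e₄, e₃, hDR]
    · simp [e₅, hsize₄]
    · intro j hj
      simp [e₅, e₄, hstr j hj]

/-- The best reward of a class-ordered policy for the threshold `X`. -/
noncomputable def Params.guessVal (c : Params) (I : Instance) (X : ℝ) : ℝ :=
  classVal I.p I.v (c.cls I X) c.D c.m c.m c.kcap univ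

theorem Solved.val_root {I : Instance} {c : Params} {X : ℝ} {s : Mem} (hk : c.kcap ≤ c.m)
    (hs : Solved I c (c.cls I X) s) : s.real rVal c.root = c.guessVal I X :=
  (hs.node c.root (c.root_lt hk)).val_eq.trans (stateVal_root hk)

theorem tryGuesses_ensures {I : Instance} {c : Params} {s : Mem} {X : ℝ} (h : Ready I c s)
    (hk : c.kcap ≤ c.m) (hroot : s.nat nRoot 0 = c.root) (hX : s.real rX 0 = X) :
    tryGuesses.Ensures s (c.R * (c.solveBound I.n + 60) + 30) fun s' =>
      ∀ g ≤ c.m, c.guessVal I (X * 2 ^ g) ≤ c.guessVal I (s'.real rBestX 0) := by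
  refine Prog.Ensures.setR_seq (B₂ := c.R * (c.solveBound I.n + 60) + 20) (by simp; omega) ?_
  refine Prog.Ensures.setR_seq (B₂ := c.R * ((c.solveBound I.n + 40) + 12) + 12)
    (by simp; nlinarith) ?_
  have h0 : ∀ X, 0 ≤ c.guessVal I X := fun X =>
    bestVal_nonneg (fun i => mul_nonneg (I.p_nonneg i) (I.v_nonneg i)) I.p_nonneg I.p_le_one _ _ _
  refine Prog.Ensures.mono (Prog.Ensures.forLoop (N := c.R) (B := c.solveBound I.n + 40)
    (fun g s' => s'.real rX 0 = X * 2 ^ g ∧ (∀ g' < g, c.guessVal I (X * 2 ^ g') ≤ s'.real rBest 0) ∧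
      s'.real rBest 0 ≤ c.guessVal I (s'.real rBestX 0))
    (by decide) (by decide) (by simp [h.r_eq]) ?_ ?_) le_rfl fun s' h g hg =>
      (h.2.1 g (Nat.lt_succ_of_le hg)).trans h.2.2
  · simpa [hX] using h0 X
  rintro g hg s' hag hig ⟨hX', hle, hbest⟩
  have hr : Ready I c s' := by
    refine Ready.of_agree (l := []) (r := [rBest, rBestX]) (s := s) h ?_ (by decide) (by decide)
      |>.of_agree hag (by decide) (by decide)
    refine ⟨fun a _ => rfl, fun a ha => ?_⟩
    simp only [List.mem_cons, List.not_mem_nil, or_false, not_or] at ha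
    rw [Mem.putR_real_of_ne _ _ _ ha.2, Mem.putR_real_of_ne _ _ _ ha.1]
  have hroot' : s'.nat nRoot 0 = c.root := by
    rw [hag.1 _ (by decide)]
    simp [hroot]
  refine Prog.Ensures.seq_of (B₂ := 35) (solve_ensures hr hX') (by omega) ?_
  intro s₁ hag₁ hs₁
  have hv : s₁.real rVal (s₁.nat nRoot 0) = c.guessVal I (X * 2 ^ g) := by
    rw [hag₁.1 _ (by decide), hroot', hs₁.val_root hk]
  have hb₁ : s₁.real rBest = s'.real rBest := hag₁.2 _ (by decide)
  have hbX₁ : s₁.real rBestX = s'.real rBestX := hag₁.2 _ (by decide)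
  have hX₁ : s₁.real rX 0 = X * 2 ^ g := by rw [hag₁.2 _ (by decide), hX']
  have hle' : ∀ y : ℝ, s'.real rBest 0 ≤ y → c.guessVal I (X * 2 ^ g) ≤ y → ∀ g' < g + 1,
      c.guessVal I (X * 2 ^ g') ≤ y := by
    intro y h1 h2 g' hg'
    rcases Nat.lt_succ_iff_lt_or_eq.1 hg' with hg' | rfl
    · exact (hle g' hg').trans h1
    · exact h2
  refine Prog.Ensures.mono_bound (Prog.Ensures.seq (B := 25) (B' := 7)
    (Prog.Ensures.ite_of (B₁ := 15) (by simp) (fun hb => ?_) fun hb => ?_)) (by omega)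
  · simp [hv, hb₁] at hb
    refine Prog.Ensures.setR_seq (B₂ := 5) (by simp)
      (Prog.Ensures.setR (Prog.Ensures.setR ?_ (by simp)) (by simp))
    simp [hv, hX₁, pow_succ, mul_add, mul_two]
    exact fun g' hg' => hle' _ hb le_rfl g' (by omega)
  · simp [hv, hb₁] at hb
    refine Prog.Ensures.mono_bound (Prog.Ensures.skip (Prog.Ensures.setR ?_ (by simp))) (by omega)
    simp [hX₁, hb₁, hbX₁, pow_succ, mul_two, mul_add]
    exact ⟨fun g' hg' => hle' _ le_rfl hb.le g' (by omega), hbest⟩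

/-- A bound for the number of steps after the parameters have been chosen. -/
def Params.bound (c : Params) (n : ℕ) : ℕ :=
  c.V * 20 + c.R * 20 + (c.D + 2) * (c.R * 50 + 150) + 200 +
    (c.R * (c.solveBound n + 60) + 30) + (c.solveBound n + 10)

open Prog in
theorem solve_guesses_ensures {I : Instance} {ε : ℝ} {c : Params} {s : Mem} {X : ℝ}
    (h : HasInput I ε s) (hk : c.kcap ≤ c.m) (hm : s.nat nM 0 = c.m)
    (hR : s.nat nR 0 = c.R) (hkcap : s.nat nKcap 0 = c.kcap) (hL : s.nat nL 0 = c.L)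
    (hV : s.nat nV 0 = c.V) (hM : s.real rM 0 = c.M) (hβ : s.real rBeta 0 = c.β)
    (hX : s.real rX 0 = X) :
    (seq computeSizes (seq tryGuesses (seq (letR rX (RExp.var rBestX)) solve))).Ensures s
      (c.bound I.n) fun s' => s'.nat nRoot 0 = c.root ∧ ∃ X', Solved I c (c.cls I X') s' ∧
        ∀ g ≤ c.m, c.guessVal I (X * 2 ^ g) ≤ c.guessVal I X' := by
  refine Prog.Ensures.seq_of (B₂ := (c.R * (c.solveBound I.n + 60) + 30) + (c.solveBound I.n + 10))
    (computeSizes_ensures hm hR hkcap hL hV) (by unfold Params.bound; omega) ?_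
  rintro s₁ hag₁ ⟨h1, h2, h3, h4, h5, h6, h7, h8⟩
  have hr₁ : Ready I c s₁ := by
    refine ⟨?_, ?_, ?_, ?_, ?_, h1, h2, h3, h4, h5, h6, h7, ?_, ?_, ?_, ?_⟩
    · rw [hag₁.1 _ (by decide), h.n_eq]
    · rw [hag₁.1 _ (by decide), hm]
    · rw [hag₁.1 _ (by decide), hR]
    · rw [hag₁.1 _ (by decide), hL]
    · rw [hag₁.1 _ (by decide), hV]
    · rw [hag₁.2 _ (by decide)]
      exact h.val_eq
    · rw [hag₁.2 _ (by decide)]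
      exact h.prob_eq
    · rw [hag₁.2 _ (by decide), hM]
    · rw [hag₁.2 _ (by decide), hβ]
  have hX₁ : s₁.real rX 0 = X := by rw [hag₁.2 _ (by decide), hX]
  refine Prog.Ensures.seq_of (B₂ := c.solveBound I.n + 10) (tryGuesses_ensures hr₁ hk h8 hX₁) le_rfl
    ?_
  intro s₂ hag₂ hbest
  have hr₂ : Ready I c s₂ := hr₁.of_agree hag₂ (by decide) (by decide)
  refine Prog.Ensures.setR_seq (B₂ := c.solveBound I.n) (by simp; omega) ?_
  have hr₃ : Ready I c (s₂.putR rX 0 (s₂.real rBestX 0)) :=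
    Ready.of_agree (l := []) (r := [rX]) hr₂ ⟨fun a _ => rfl, fun a ha => by
      simp only [List.mem_cons, List.not_mem_nil, or_false] at ha
      exact Mem.putR_real_of_ne _ _ _ ha⟩ (by decide) (by decide)
  refine Prog.Ensures.mono (solve_ensures (X := s₂.real rBestX 0) hr₃ (by simp)).frame le_rfl ?_
  rintro s₄ ⟨hs₄, hag₄⟩
  refine ⟨?_, _, hs₄, hbest⟩
  rw [hag₄.1 _ (by decide), Mem.putR_nat, hag₂.1 _ (by decide), h8]

/-- The numbers of levels of expected rewards and of values. -/
noncomputable def levelCounts (I : Instance) (ε : ℝ) : ℕ × ℕ :=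
  if I.T ≤ 1 ∨ 1 ≤ ε then (1, 1)
  else (⌈16 / ε⌉₊ * (Nat.clog 2 (min I.T I.n) + ⌈16 / ε⌉₊), ⌈16 / ε⌉₊ ^ 3 + 2)

/-- The parameters that the program chooses when `M` is the largest expected reward of an offer. -/
noncomputable def params (I : Instance) (ε M : ℝ) : Params where
  m := min I.T I.n
  kcap := min I.k (min I.T I.n)
  L := (levelCounts I ε).1
  V := (levelCounts I ε).2
  M := M
  β := if I.T ≤ 1 ∨ 1 ≤ ε then 1 - ε else 1 - 1 / (⌈16 / ε⌉₊ : ℝ)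

/-- The smallest guess of the threshold of the levels of values. -/
noncomputable def firstGuess (I : Instance) (ε M : ℝ) : ℝ :=
  if I.T ≤ 1 ∨ 1 ≤ ε then 0 else M * ⌈16 / ε⌉₊

/-- The capped instance has the same optimal value, which one of the guesses attains up to `ε`. -/
theorem exists_guessVal {I : Instance} {ε M : ℝ} (hε : 0 < ε) (hn : 1 ≤ I.n) (hT : 1 ≤ I.T)
    (hM0 : 0 ≤ M) (hM : ∀ i, I.p i * I.v i ≤ M) (hM' : M = 0 ∨ ∃ i, I.p i * I.v i = M) :
    ∃ g ≤ (params I ε M).m, (1 - ε) *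
      bestVal (fun i => I.p i * I.v i) I.p id I.T I.k univ ≤
        (params I ε M).guessVal I (firstGuess I ε M * 2 ^ g) := by
  have hw : ∀ i, 0 ≤ I.p i * I.v i := fun i => mul_nonneg (I.p_nonneg i) (I.v_nonneg i)
  have hb0 : 0 ≤ bestVal (fun i => I.p i * I.v i) I.p id (min I.T I.n) (min I.k (min I.T I.n))
      univ := bestVal_nonneg hw I.p_nonneg I.p_le_one _ _ _
  have hcap : bestVal (fun i => I.p i * I.v i) I.p id I.T I.k univ =
      bestVal (fun i => I.p i * I.v i) I.p id (min I.T I.n) (min I.k (min I.T I.n)) univ := by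
    rw [bestVal_min_stages (adm := id) (fun A => subset_rfl) I.T, Finset.card_univ, Fintype.card_fin,
      bestVal_min_positions]
  rw [hcap]
  by_cases htriv : I.T ≤ 1 ∨ 1 ≤ ε
  · refine ⟨0, Nat.zero_le _, ?_⟩
    by_cases hε1 : 1 ≤ ε
    · refine le_trans (mul_nonpos_of_nonpos_of_nonneg (by linarith) hb0) ?_
      exact bestVal_nonneg hw I.p_nonneg I.p_le_one _ _ _
    · have hT1 : I.T = 1 := le_antisymm (htriv.resolve_right hε1) hT
      have hm : min I.T I.n = 1 := by omega
      have hpar : params I ε M = ⟨1, min I.k 1, 1, 1, M, 1 - ε⟩ := by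
        simp [params, levelCounts, if_pos htriv, hm]
      rw [hpar, hm]
      exact mul_bestVal_le_classVal_one_stage I.p_nonneg I.p_le_one I.v_nonneg hM hM' hM0 hε
        (not_le.1 hε1) (min I.k 1)
  · have hq : (16 : ℝ) / ε ≤ ⌈16 / ε⌉₊ := Nat.le_ceil _
    have hε1 : ε < 1 := not_le.1 fun h => htriv (Or.inr h)
    have hq16 : 16 ≤ ⌈16 / ε⌉₊ := by
      have : (16 : ℝ) ≤ 16 / ε := by
        rw [le_div_iff₀ hε]
        linarith
      exact_mod_cast this.trans hq
    have hpar : params I ε M = ⟨min I.T I.n, min I.k (min I.T I.n),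
        ⌈16 / ε⌉₊ * (Nat.clog 2 (min I.T I.n) + ⌈16 / ε⌉₊), ⌈16 / ε⌉₊ ^ 3 + 2, M,
        1 - 1 / (⌈16 / ε⌉₊ : ℝ)⟩ := by
      simp only [params, levelCounts, if_neg htriv]
    have hX : firstGuess I ε M = M * ⌈16 / ε⌉₊ := if_neg htriv
    obtain ⟨g, hg, h⟩ := exists_guess (p := I.p) (v := I.v) (M := M) (q := ⌈16 / ε⌉₊)
      (t := Nat.clog 2 (min I.T I.n)) (m := min I.T I.n) (κ := min I.k (min I.T I.n))
      I.p_nonneg I.p_le_one I.v_nonneg hM hM' hM0 hq16 (by omega) (min_le_right _ _)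
      (Nat.le_pow_clog (by norm_num) _)
    rw [hpar, hX]
    refine ⟨g, hg, le_trans (mul_le_mul_of_nonneg_right ?_ hb0) h⟩
    have hq0 : (0 : ℝ) < ⌈16 / ε⌉₊ := by
      have : 0 < ⌈16 / ε⌉₊ := by omega
      exact_mod_cast this
    have : 8 / (⌈16 / ε⌉₊ : ℝ) ≤ ε := by
      rw [div_le_iff₀ hq0]
      rw [div_le_iff₀ hε] at hq
      linarith
    linarith

theorem hiringProgram_ensures {I : Instance} {ε : ℝ} (hε : 0 < ε) (hn : 1 ≤ I.n) (hT : 1 ≤ I.T) :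
    hiringProgram.Ensures (I.input ε)
      (I.n * 50 + (levelCounts I ε).1 * 100 + 400 + (params I ε 0).bound I.n) fun s' =>
        ∃ M X, s'.nat nRoot 0 = (params I ε M).root ∧
          Solved I (params I ε M) ((params I ε M).cls I X) s' ∧
          (1 - ε) * bestVal (fun i => I.p i * I.v i) I.p id I.T I.k univ ≤
            (params I ε M).guessVal I X := by
  have hin := hasInput_input I ε
  set B := (params I ε 0).bound I.n with hB
  set L := (levelCounts I ε).1 with hL
  refine Prog.Ensures.setN_seq (B₂ := I.n * 50 + L * 100 + 380 + B) (by simp; omega) ?_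
  refine Prog.Ensures.setN_seq (B₂ := I.n * 50 + L * 100 + 370 + B) (by simp; omega) ?_
  refine Prog.Ensures.setN_seq (B₂ := I.n * 50 + L * 100 + 350 + B) (by simp; omega) ?_
  generalize hs₀ : Mem.putN _ nKcap _ _ = s₀
  have hin₀ : HasInput I ε s₀ := by
    subst hs₀
    constructor
    · simp [hin.n_eq]
    · simp [hin.k_eq]
    · simp [hin.stages_eq]
    · simpa using hin.val_eq
    · simpa using hin.prob_eq
    · simpa using hin.eps_eq
  have hm₀ : s₀.nat nM 0 = min I.T I.n := by
    subst hs₀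
    simp [hin.n_eq, hin.stages_eq]
    omega
  have hR₀ : s₀.nat nR 0 = min I.T I.n + 1 := by
    subst hs₀
    simp [hin.n_eq, hin.stages_eq]
    omega
  have hk₀ : s₀.nat nKcap 0 = min I.k (min I.T I.n) := by
    subst hs₀
    simp [hin.n_eq, hin.stages_eq, hin.k_eq]
    omega
  clear hs₀
  refine Prog.Ensures.seq_of (B₂ := L * 100 + 330 + B) (computeMax_ensures hin₀) (by omega) ?_
  rintro s₁ hag₁ ⟨hM0, hM, hM'⟩
  obtain ⟨M, hMeq⟩ : ∃ M, s₁.real rM 0 = M := ⟨_, rfl⟩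
  rw [hMeq] at hM0 hM hM'
  have hin₁ : HasInput I ε s₁ := hin₀.of_agree hag₁ (by decide) (by decide)
  refine Prog.Ensures.seq_of (B₁ := L * 100 + 230) (B₂ := B)
    (Q₁ := fun s' => s'.real rBeta 0 = (params I ε M).β ∧ s'.nat nL 0 = (params I ε M).L ∧
      s'.nat nV 0 = (params I ε M).V ∧ s'.real rX 0 = firstGuess I ε M) ?_ (by omega) ?_
  · have htriv : I.T ≤ 1 ∨ 1 ≤ ε → trivialParams.Ensures s₁ 30 fun s' =>
        s'.real rBeta 0 = (params I ε M).β ∧ s'.nat nL 0 = (params I ε M).L ∧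
          s'.nat nV 0 = (params I ε M).V ∧ s'.real rX 0 = firstGuess I ε M := by
      intro h
      refine (trivialParams_ensures hin₁.eps_eq).mono le_rfl fun s' hs' => ?_
      simpa only [params, levelCounts, firstGuess, if_pos h] using hs'
    refine Prog.Ensures.ite_of (B₁ := L * 100 + 220) (by simp; omega)
      (fun h1 => (htriv ?_).mono_bound (by omega)) fun h1 => ?_
    · simp [hin₁.stages_eq] at h1
      exact Or.inl h1
    refine Prog.Ensures.ite_of (B₁ := L * 100 + 200) (by simp; omega)
      (fun h2 => (htriv ?_).mono_bound (by omega)) fun h2 => ?_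
    · simp [hin₁.eps_eq] at h2
      exact Or.inr h2
    simp [hin₁.stages_eq] at h1
    simp [hin₁.eps_eq] at h2
    have hnot : ¬ (I.T ≤ 1 ∨ 1 ≤ ε) := not_or.2 ⟨not_le.2 h1, not_le.2 h2⟩
    have hLeq : L = ⌈16 / ε⌉₊ * (Nat.clog 2 (min I.T I.n) + ⌈16 / ε⌉₊) := by
      rw [hL, levelCounts, if_neg hnot]
    have hq : 1 ≤ ⌈16 / ε⌉₊ := Nat.one_le_ceil_iff.2 (by positivity)
    refine (mainParams_ensures (m := min I.T I.n) (M := M) hε hin₁.eps_eq ?_ hMeq).mono ?_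
      fun s' hs' => ?_
    · rw [hag₁.1 _ (by decide), hm₀]
    · rw [hLeq]
      have := Nat.le_mul_of_pos_left (Nat.clog 2 (min I.T I.n) + ⌈16 / ε⌉₊) hq
      linarith
    · simpa only [params, levelCounts, firstGuess, if_neg hnot] using hs'
  · rintro s₂ hag₂ ⟨h1, h2, h3, h4⟩
    have hin₂ : HasInput I ε s₂ := hin₁.of_agree hag₂ (by decide) (by decide)
    refine (solve_guesses_ensures (c := params I ε M) hin₂ (min_le_right _ _) ?_ ?_ ?_ h2 h3 ?_ h1
      h4).mono le_rfl ?_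
    · rw [hag₂.1 _ (by decide), hag₁.1 _ (by decide), hm₀]
      rfl
    · rw [hag₂.1 _ (by decide), hag₁.1 _ (by decide), hR₀]
      rfl
    · rw [hag₂.1 _ (by decide), hag₁.1 _ (by decide), hk₀]
      rfl
    · rw [hag₂.2 _ (by decide), hMeq]
      rfl
    · rintro s₃ ⟨hroot, X, hs, hbest⟩
      obtain ⟨g, hg, hle⟩ := exists_guessVal hε hn hT hM0 hM hM'
      exact ⟨M, X, hroot, hs, hle.trans (hbest g hg)⟩

/-! ### The number of steps -/

/-- All parameters are at most the number of states. -/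
theorem Params.bound_le (c : Params) (hm : 1 ≤ c.m) (hL : 1 ≤ c.L) (hV : 1 ≤ c.V) {n : ℕ}
    (hn : 1 ≤ n) : n * 50 + c.L * 100 + 400 + c.bound n ≤ 10000 * n ^ 2 * c.size ^ 3 := by
  have hR : 2 ≤ c.R := Nat.succ_le_succ hm
  have hLD : c.L ≤ c.D := Nat.le_mul_of_pos_right _ hV
  have hVD : c.V ≤ c.D := Nat.le_mul_of_pos_left _ hL
  have hDS : c.D + 2 ≤ c.size :=
    (Nat.lt_two_pow_self).le.trans (Nat.pow_le_pow_left hR _)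
  have hDR : c.D * c.R ≤ c.size := by
    refine le_trans (Nat.mul_le_mul_right _ ((Nat.lt_two_pow_self).le.trans
      (Nat.pow_le_pow_left hR _))) ?_
    rw [← pow_succ]
    exact Nat.pow_le_pow_right (by omega) (by omega)
  have hRS : c.R ≤ c.size := Nat.le_self_pow (by omega) _
  unfold Params.bound Params.solveBound
  generalize c.size = S at *
  generalize c.D = D at *
  generalize c.R = R at *
  generalize c.L = L at *
  generalize c.V = V at *
  have hS : 1 ≤ S := by omega
  have hn2 : n ≤ n ^ 2 := Nat.le_self_pow (by omega) _
  have hS2 : S ≤ S ^ 2 := Nat.le_self_pow (by omega) _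
  have key : ∀ x ≤ n ^ 2, ∀ y ≤ S ^ 2, x * y ≤ n ^ 2 * S ^ 2 := fun x hx y hy =>
    Nat.mul_le_mul hx hy
  have b1 := key n hn2 S hS2
  have b2 := key (n ^ 2) le_rfl S hS2
  have b3 := key (n ^ 2) le_rfl 1 (by omega)
  have b4 := key n hn2 1 (by omega)
  have b5 := key 1 (by omega) S hS2
  have b6 := key 1 (by omega) (S ^ 2) le_rfl
  have b7 := key 1 (by omega) 1 (by omega)
  rw [mul_one] at b3 b4 b7
  rw [one_mul] at b5 b6
  have c1 : n * (L * 50 + V * 50 + 300) ≤ 400 * (n * S) := by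
    calc n * (L * 50 + V * 50 + 300) ≤ n * (400 * S) := Nat.mul_le_mul_left _ (by omega)
      _ = 400 * (n * S) := by ring
  have c2 : n * (n * 70 + D * 30 + 200) ≤ 70 * n ^ 2 + 230 * (n * S) := by
    calc n * (n * 70 + D * 30 + 200) ≤ n * (n * 70 + 230 * S) := Nat.mul_le_mul_left _ (by omega)
      _ = 70 * n ^ 2 + 230 * (n * S) := by ring
  have c3 : S * (D * 240 + 350) ≤ 590 * S ^ 2 := by
    calc S * (D * 240 + 350) ≤ S * (590 * S) := Nat.mul_le_mul_left _ (by linarith)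
      _ = 590 * S ^ 2 := by ring
  have c4 : (D + 2) * (R * 50 + 150) ≤ 200 * S ^ 2 := by
    calc (D + 2) * (R * 50 + 150) ≤ S * (200 * S) := Nat.mul_le_mul hDS (by omega)
      _ = 200 * S ^ 2 := by ring
  set W := n ^ 2 * S ^ 2 with hW
  set Y := n * (L * 50 + V * 50 + 300) + n * (n * 70 + D * 30 + 200) + n * 62 + D * R * 20 +
    S * (D * 240 + 350) + D * 30 + 200 with hY
  have hYle : Y ≤ 2000 * W := by linarith
  have c5 : R * (Y + 60) ≤ S * (2060 * W) := Nat.mul_le_mul hRS (by linarith)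
  have c6 : 10000 * n ^ 2 * S ^ 3 = 10000 * (S * W) := by
    rw [hW]
    ring
  have c7 : W ≤ S * W := Nat.le_mul_of_pos_left _ hS
  have c8 : S * (2060 * W) = 2060 * (S * W) := by ring
  linarith

theorem one_le_levelCounts (I : Instance) {ε : ℝ} (hε : 0 < ε) :
    1 ≤ (levelCounts I ε).1 ∧ 1 ≤ (levelCounts I ε).2 := by
  unfold levelCounts
  split_ifs with h
  · exact ⟨le_rfl, le_rfl⟩
  · have hq : 1 ≤ ⌈16 / ε⌉₊ := Nat.one_le_ceil_iff.2 (by positivity)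
    exact ⟨Nat.mul_pos hq (by omega), by omega⟩

/-- The number of digits of the state numbers is logarithmic in the number of stages. -/
theorem digits_le_log {I : Instance} {ε : ℝ} (hε : 0 < ε)
    (h : ¬ (I.T ≤ 1 ∨ 1 ≤ ε)) :
    (((params I ε 0).D + 2 : ℕ) : ℝ) ≤ 18 * 17 ^ 5 * (1 / ε) ^ 5 * Real.log I.T := by
  have hT : 2 ≤ I.T := by
    by_contra hlt
    exact h (Or.inl (by omega))
  have hε1 : ε < 1 := not_le.1 fun h' => h (Or.inr h')
  set q := ⌈16 / ε⌉₊ with hq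
  set t := Nat.clog 2 (min I.T I.n) with ht
  have hD : (params I ε 0).D = q * (t + q) * (q ^ 3 + 2) := by
    simp only [Params.D, params, levelCounts, if_neg h]
    rfl
  have hTR : (2 : ℝ) ≤ I.T := by exact_mod_cast hT
  have hlog2 : Real.log 2 ≤ Real.log I.T := Real.log_le_log (by norm_num) hTR
  have hl2 := Real.log_two_gt_d9
  set l := Real.log I.T with hl
  have hq1 : (1 : ℝ) ≤ q := by
    have : 1 ≤ q := Nat.one_le_ceil_iff.2 (by positivity)
    exact_mod_cast this
  have hqε : (q : ℝ) ≤ 17 * (1 / ε) := by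
    have h1 : (q : ℝ) < 16 / ε + 1 := Nat.ceil_lt_add_one (by positivity)
    have h2 : 1 ≤ 1 / ε := by
      rw [le_div_iff₀ hε]
      linarith
    have h3 : 16 / ε = 16 * (1 / ε) := by ring
    linarith
  have htl : (t : ℝ) ≤ 3 * l := by
    rcases Nat.eq_zero_or_pos t with h0 | h0
    · rw [h0, Nat.cast_zero]
      linarith
    · have hm : 1 < min I.T I.n := by
        by_contra hle
        have : t = 0 := Nat.clog_of_right_le_one (by omega) 2
        omega
      have h1 : 2 ^ (t - 1) < min I.T I.n := Nat.pow_pred_clog_lt_self (by norm_num) hm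
      have h2 : ((2 : ℝ) ^ (t - 1)) ≤ I.T := by
        exact_mod_cast h1.le.trans (min_le_left _ _)
      have h3 := Real.log_le_log (by positivity) h2
      rw [Real.log_pow, Nat.cast_sub h0, Nat.cast_one] at h3
      nlinarith
  have hql : 1 ≤ 2 * l := by linarith
  have h1 : (t : ℝ) + q ≤ 5 * (q * l) := by nlinarith
  have h2 : (q : ℝ) ^ 3 + 2 ≤ 3 * (q : ℝ) ^ 3 := by
    have : (1 : ℝ) ≤ (q : ℝ) ^ 3 := one_le_pow₀ hq1
    linarith
  have hl0 : 0 < l := by linarith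
  have h3 : (q : ℝ) ^ 5 ≤ 17 ^ 5 * (1 / ε) ^ 5 := by
    rw [← mul_pow]
    gcongr
  have h4 : (1 : ℝ) ≤ (q : ℝ) ^ 5 := one_le_pow₀ hq1
  rw [hD]
  push_cast
  calc (q : ℝ) * (t + q) * (q ^ 3 + 2) + 2 ≤ q * (5 * (q * l)) * (3 * q ^ 3) + 3 * l := by
        have : (2 : ℝ) ≤ 3 * l := by linarith
        gcongr
    _ = (15 * q ^ 5 + 3 * 1) * l := by ring
    _ ≤ (15 * q ^ 5 + 3 * q ^ 5) * l := by gcongr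
    _ = 18 * q ^ 5 * l := by ring
    _ ≤ 18 * (17 ^ 5 * (1 / ε) ^ 5) * l := by gcongr
    _ = 18 * 17 ^ 5 * (1 / ε) ^ 5 * l := by ring

/-- In the trivial cases there is one class and three digits; otherwise the base `m + 1` is at most
`T ^ 2`. -/
theorem size_pow_le {I : Instance} {ε : ℝ} (hε : 0 < ε) (hn : 1 ≤ I.n) (hT : 1 ≤ I.T) :
    ((params I ε 0).size : ℝ) ^ 3 ≤ 512 * (I.n : ℝ) ^ 9 *
      (I.T : ℝ) ^ (((108 * 17 ^ 5 : ℕ) : ℝ) * (1 / ε) ^ 5 * Real.log I.T) := by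
  have hTR : (1 : ℝ) ≤ I.T := by exact_mod_cast hT
  have hnR : (1 : ℝ) ≤ I.n := by exact_mod_cast hn
  have hlog : 0 ≤ Real.log I.T := Real.log_nonneg hTR
  have hR : (params I ε 0).R = min I.T I.n + 1 := rfl
  by_cases h : I.T ≤ 1 ∨ 1 ≤ ε
  · have hD : (params I ε 0).D = 1 := by
      simp only [Params.D, params, levelCounts, if_pos h, mul_one]
    have hle : (((params I ε 0).R : ℕ) : ℝ) ≤ 2 * I.n := by
      have : min I.T I.n + 1 ≤ 2 * I.n := by omega
      rw [hR]
      exact_mod_cast this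
    rw [Params.size, hD, Nat.cast_pow, ← pow_mul]
    calc (((params I ε 0).R : ℕ) : ℝ) ^ ((1 + 2) * 3) ≤ (2 * I.n) ^ ((1 + 2) * 3) := by gcongr
      _ = 512 * (I.n : ℝ) ^ 9 * 1 := by ring
      _ ≤ _ := by
        gcongr
        exact Real.one_le_rpow hTR (by positivity)
  · have hT2 : 2 ≤ I.T := by
      by_contra hlt
      exact h (Or.inl (by omega))
    have hle : (((params I ε 0).R : ℕ) : ℝ) ≤ (I.T : ℝ) ^ 2 := by
      have : min I.T I.n + 1 ≤ I.T ^ 2 := by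
        have := min_le_left I.T I.n
        nlinarith
      rw [hR]
      exact_mod_cast this
    have hexp := digits_le_log hε h
    have h9 : (1 : ℝ) ≤ 512 * (I.n : ℝ) ^ 9 := by
      have := one_le_pow₀ (n := 9) hnR
      linarith
    rw [Params.size, Nat.cast_pow, ← pow_mul]
    calc (((params I ε 0).R : ℕ) : ℝ) ^ (((params I ε 0).D + 2) * 3)
        ≤ ((I.T : ℝ) ^ 2) ^ (((params I ε 0).D + 2) * 3) := by gcongr
      _ = (I.T : ℝ) ^ (((6 * ((params I ε 0).D + 2) : ℕ)) : ℝ) := by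
        rw [Real.rpow_natCast, ← pow_mul]
        congr 1
        ring
      _ ≤ (I.T : ℝ) ^ (((108 * 17 ^ 5 : ℕ) : ℝ) * (1 / ε) ^ 5 * Real.log I.T) := by
        refine Real.rpow_le_rpow_of_exponent_le hTR ?_
        push_cast at hexp ⊢
        linarith
      _ = 1 * (I.T : ℝ) ^ (((108 * 17 ^ 5 : ℕ) : ℝ) * (1 / ε) ^ 5 * Real.log I.T) := by
        rw [one_mul]
      _ ≤ _ := by gcongr

end SeqHiring

theorem theorem2 :
    ∃ (P : SeqHiring.Prog) (C a b d : ℕ),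
      ∀ (ε : ℝ), 0 < ε → ∀ (I : SeqHiring.Instance), 1 ≤ I.n → 1 ≤ I.T →
        ∃ (steps : ℕ) (out : SeqHiring.Mem) (H : SeqHiring.Policy I),
          SeqHiring.Exec P (I.input ε) steps out ∧
          (steps : ℝ) ≤
            (C : ℝ) * (I.n : ℝ) ^ a * (I.T : ℝ) ^ ((b : ℝ) * (1 / ε) ^ d * Real.log (I.T : ℝ)) ∧
          out.diagram.Represents H ∧
          ∀ H' : SeqHiring.Policy I, (1 - ε) * H'.expectedReward ≤ H.expectedReward := by
  refine ⟨SeqHiring.hiringProgram, 10000 * 512, 11, 108 * 17 ^ 5, 5, fun ε hε I hn hT => ?_⟩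
  obtain ⟨steps, out, hexec, hsteps, M, X, hroot, hsolved, hopt⟩ :=
    SeqHiring.hiringProgram_ensures hε hn hT
  obtain ⟨hrep, hval⟩ := hsolved.represents hn rfl rfl hroot
  refine ⟨steps, out, _, hexec, ?_, hrep, fun H' => ?_⟩
  · have hL := SeqHiring.one_le_levelCounts I hε
    have hle := hsteps.trans ((SeqHiring.params I ε 0).bound_le
      (show 1 ≤ min I.T I.n from le_min hT hn) hL.1 hL.2 hn)
    calc (steps : ℝ) ≤ 10000 * (I.n : ℝ) ^ 2 * ((SeqHiring.params I ε 0).size : ℝ) ^ 3 := by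
          exact_mod_cast hle
      _ ≤ 10000 * (I.n : ℝ) ^ 2 * (512 * (I.n : ℝ) ^ 9 *
          (I.T : ℝ) ^ (((108 * 17 ^ 5 : ℕ) : ℝ) * (1 / ε) ^ 5 * Real.log I.T)) := by
        gcongr
        exact SeqHiring.size_pow_le hε hn hT
      _ = _ := by
        push_cast
        ring
  · rcases le_or_gt ε 1 with hε1 | hε1
    · refine le_trans (mul_le_mul_of_nonneg_left ?_ (sub_nonneg.2 hε1)) (hopt.trans hval)
      rw [SeqHiring.Policy.expectedReward_eq_value]
      exact H'.value_le_bestVal _ _ _ le_rfl le_rfl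
    · -- the factor is negative, and rewards are not
      refine le_trans (mul_nonpos_of_nonpos_of_nonneg (by linarith) ?_) ?_
      · rw [SeqHiring.Policy.expectedReward_eq_value]
        exact H'.value_nonneg _ _ _
      · rw [SeqHiring.Policy.expectedReward_eq_value]
        exact SeqHiring.Policy.value_nonneg _ _ _ _
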